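/- **Setting.** Let $\mathbb H=\mathbb R^3$ be the Heisenberg group with product $(x,y,z)(x',y',z')=(x+x',y+y',z+z'+\frac{xy'-yx'}2)$, left-invariant fields $X=(1,0,-\frac y2)$, $Y=(0,1,\frac x2)$, $Z=(0,0,1)$, horizontal distribution $\operatorname{span}(X,Y)$ and Carnot–Carathéodory distance $d$. Let $V_0=\{y=0\}$ with coordinates $(x,z)$ and Lebesgue measure $\mu$, $\Pi(x,y,z)=(x,z-\frac{xy}2)$, $\pi(x,y,z)=(x,y)$. For $f\colon U\to\mathbb R$, $U\subset V_0$ open, let $\Psi_f(v)=v\cdot(0,f(v),0)$ and $\Gamma_f=\Psi_f(U)$; $f$ is intrinsic Lipschitz if for some $\lambda\in(0,1)$, $|y(q)-y(p)|\le\lambda\,d(p,q)$ for all $p,q\in\Gamma_f$. Let $\nabla_f=\partial_x-f\partial_z$. The function $\nabla_ff\in L_\infty^{\rm loc}(U)$ is defined by $\int_U\nabla_ff\,\eta\,d\mu=\int_U(-f\partial_x\eta+\frac{f^2}2\partial_z\eta)\,d\mu$ for all $\eta\in C^1_c(U)$, and $E_U(f)=\frac12\int_U(\nabla_ff)^2\,d\mu$.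 For $\psi\in C^\infty(\mathbb H)$ let $V_\psi=(Y\psi)X-(X\psi)Y+\psi Z$. For bounded open $U$, the graph $\Gamma_f$ is contact harmonic on $U$ if for every $\psi\in C^\infty(\mathbb H)$ with $YY\psi=0$ and $\operatorname{supp}\psi\subset\Pi^{-1}(U)$, with flow $\phi_t$ of $V_\psi$ and $\Gamma_{f_t}=\phi_t(\Gamma_f)$, one has $\frac{d}{dt}E_U(f_t)|_{t=0}=0$; for general open $U$ this is required on every bounded open subset of $U$. **Herringbone singularities.** An intrinsic Lipschitz graph $\Gamma=\Gamma_f$ over $U$ has a smooth herringbone singularity along $C$ if $C\subset\Gamma$ is a smooth horizontal curve, $\Pi(C)$ is parametrized by $\gamma(t)=(t,\gamma_z(t))$, $t\in I$ ($I$ an interval), which cuts $U$ into two connected sets $U^+=\{(x,z)\in U: z>\gamma_z(x)\}$ and $U^-=\{(x,z)\in U: z<\gamma_z(x)\}$, $f$ is smooth on $U^\pm$, and there is a neighborhood $N$ of $C$ such that $\pi$ restricts to an embedding of $N\cap\Gamma$ and the projection by $\pi$ of the horizontal foliation of $N\cap\Psi_f(U^\pm)$ extends to a smooth foliation $F^\pm$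 of a neighborhood of the closure of $\pi(N\cap\Psi_f(U^\pm))$, with tangent lines of bounded slope, transverse to $\pi(C)$. Let $c(t)=\Psi_f(\gamma(t))$; let $\sigma^0(t)=(y\circ c)'(t)$ be the slope of $\pi(C)$ at $\pi(c(t))$, let $\sigma^\pm(t)$ be the slope of $F^\pm$ there, and let $\delta=(\sigma^+-\sigma^0)^2-(\sigma^0-\sigma^-)^2$. **Theorem.** Let $U\subset V_0$ be open and let $w_2\in C^\infty_c(U)$. 1. Suppose $\mu(U)<\infty$. For every $M$ there are $\epsilon_0>0$ and $D>0$, depending only on $U$, $w_2$, $M$, such that the following holds for every $f$ with $\|f\|_{L_\infty(U)}\le M$ whose graph has a smooth herringbone singularity. If $\phi_t$ is the flow of $V_\psi$, $\psi=w_2\circ\Pi$, then for all $|t|\le\epsilon_0$ (for which $\phi_t$ is given) there is $f_t\colon U\to\mathbb R$ with $\Gamma_{f_t}=\phi_t(\Gamma_f)$, the energies $E_U(f)$ and $E_U(f_t)$ are finite, and $$\left|E_U(f_t)-E_U(f)-A_2t\right|\le D\,(E_U(f)+\mu(U))\,t^2,\qquad A_2=\int_U-\nabla_f^2w_2\cdot\nabla_ff+\tfrac12(\nabla_ff)^2\,\partial_zw_2\,d\mu.$$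 2. If the graph of $f$ over $U$ has a smooth herringbone singularity, then all the integrals below converge absolutely and $$A_2=\frac12\int_Iw_2(\gamma(s))\,\delta(s)\,ds+\int_U\bigl(w_2\,\partial_zf+\nabla_fw_2\bigr)\cdot\nabla_f^2f\,d\mu.$$ 3. If, moreover, $\Gamma_f$ is contact harmonic on $U$, then $\delta(s)=0$ and $\sigma^0(s)=\frac{\sigma^+(s)+\sigma^-(s)}2$ for all $s\in I$; that is, the slope of $\pi(C)$ is the average of the slopes of $F^+$ and $F^-$. -/

import Mathlib

open MeasureTheory Set
open scoped ContDiff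

namespace Heis

noncomputable section

/-! ### The Heisenberg group -/

/-- The Heisenberg group as a set: `ℝ³` with coordinates `(x, y, z)`. -/
abbrev H : Type := ℝ × ℝ × ℝ

/-- The plane `V₀ = {y = 0}`, with coordinates `(x, z)`. Its measure `μ` is `volume`. -/
abbrev V₀ : Type := ℝ × ℝ

/-- The group law of the Heisenberg group. -/
def mul (p q : H) : H :=
  (p.1 + q.1, p.2.1 + q.2.1, p.2.2 + q.2.2 + (p.1 * q.2.1 - p.2.1 * q.1) / 2)

/-- The left-invariant vector fields `X`, `Y`, `Z`. -/
def X (p : H) : H := (1, 0, -p.2.1 / 2)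

def Y (p : H) : H := (0, 1, p.1 / 2)

def Z (_ : H) : H := (0, 0, 1)

/-- The inclusion of `V₀` in the Heisenberg group. -/
def incl (v : V₀) : H := (v.1, 0, v.2)

/-- The projection `Π` to `V₀` along the cosets of `⟨Y⟩`:
`Π (x, y, z) = (x, y, z) · Y^(-y) = (x, 0, z - x y / 2)`. -/
def proj₀ (p : H) : V₀ := (p.1, p.2.2 - p.1 * p.2.1 / 2)

theorem incl_proj₀ (p : H) : incl (proj₀ p) = mul p (0, -p.2.1, 0) := by
  ext <;> simp [incl, proj₀, mul]
  ring

/-- The projection `π (x, y, z) = (x, y)`. -/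
def projXY (p : H) : ℝ × ℝ := (p.1, p.2.1)

/-! ### The Carnot–Carathéodory distance -/

/-- A horizontal curve `[0,1] → ℍ`: Lipschitz and almost everywhere tangent to `span (X, Y)`. -/
def IsHorizontalCurve (c : ℝ → H) : Prop :=
  (∃ K, LipschitzOnWith K c (Icc 0 1)) ∧
    ∀ᵐ t ∂(volume.restrict (Icc (0 : ℝ) 1)),
      ∃ a b : ℝ, HasDerivAt c (a • X (c t) + b • Y (c t)) t

/-- The length of a horizontal curve on `[0,1]`, i.e. the Euclidean length of its projection
to the `xy`-plane. -/
def length (c : ℝ → H) : ℝ :=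
  ∫ t in Icc (0 : ℝ) 1, Real.sqrt ((deriv c t).1 ^ 2 + (deriv c t).2.1 ^ 2)

/-- The Carnot–Carathéodory distance. -/
def ccDist (p q : H) : ℝ :=
  sInf {l | ∃ c : ℝ → H, IsHorizontalCurve c ∧ c 0 = p ∧ c 1 = q ∧ l = length c}

/-! ### Intrinsic graphs -/

/-- `Ψ_f (v) = v · Y^(f v)`. -/
def Psi (f : V₀ → ℝ) (v : V₀) : H := mul (incl v) (0, f v, 0)

/-- The intrinsic graph of `f` over `U`. -/
def graph (U : Set V₀) (f : V₀ → ℝ) : Set H := Psi f '' U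

/-- `f` is an intrinsic Lipschitz function on `U`. -/
def IsIntrinsicLipschitz (U : Set V₀) (f : V₀ → ℝ) : Prop :=
  ∃ lam : ℝ, 0 < lam ∧ lam < 1 ∧
    ∀ p ∈ graph U f, ∀ q ∈ graph U f, |q.2.1 - p.2.1| ≤ lam * ccDist p q

/-- Partial derivatives on `V₀`. -/
def dx (g : V₀ → ℝ) (v : V₀) : ℝ := fderiv ℝ g v (1, 0)

def dz (g : V₀ → ℝ) (v : V₀) : ℝ := fderiv ℝ g v (0, 1)

/-- The operator `∇_f = ∂_x - f ∂_z` (pointwise; used only where its argument is smooth). -/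
def nabla (f g : V₀ → ℝ) (v : V₀) : ℝ := dx g v - f v * dz g v

/-! ### The intrinsic Dirichlet energy -/

/-- `θ` is the distributional intrinsic gradient `∇_f f` of the continuous function `f` on the
open set `U`: it is in `L^∞_loc(U)` and
`∫ θ η = ∫ (-f ∂_x η + (f² / 2) ∂_z η)` for all `η ∈ C¹_c(U)`. -/
def IsIntrinsicGradient (U : Set V₀) (f θ : V₀ → ℝ) : Prop :=
  ContinuousOn f U ∧
  (∀ K ⊆ U, IsCompact K → MemLp θ ⊤ (volume.restrict K)) ∧
  ∀ η : V₀ → ℝ, ContDiff ℝ 1 η → HasCompactSupport η → tsupport η ⊆ U →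
    ∫ v in U, θ v * η v = ∫ v in U, (-f v * dx η v + f v ^ 2 / 2 * dz η v)

open Classical in
/-- The distributional intrinsic gradient of `f` on `U` (unique up to null sets). -/
def intrinsicGradient (U : Set V₀) (f : V₀ → ℝ) : V₀ → ℝ :=
  if h : ∃ θ, IsIntrinsicGradient U f θ then h.choose else 0

/-- The distributional intrinsic gradient of `f` exists on `U` and is square integrable there. -/
def HasFiniteEnergy (U : Set V₀) (f : V₀ → ℝ) : Prop :=
  ∃ θ, IsIntrinsicGradient U f θ ∧ IntegrableOn (fun v => θ v ^ 2) U

/-- The intrinsic Dirichlet energy `E_U(f) = ½ ∫_U (∇_f f)²`. -/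
def energy (U : Set V₀) (f : V₀ → ℝ) : ℝ :=
  1 / 2 * ∫ v in U, intrinsicGradient U f v ^ 2

/-! ### Contact variations -/

/-- The derivatives of a function on the Heisenberg group along `X` and `Y`. -/
def derivX (ψ : H → ℝ) (p : H) : ℝ := fderiv ℝ ψ p (X p)

def derivY (ψ : H → ℝ) (p : H) : ℝ := fderiv ℝ ψ p (Y p)

/-- The contact vector field `V_ψ = (Yψ) X - (Xψ) Y + ψ Z` with potential `ψ`. -/
def contactField (ψ : H → ℝ) (p : H) : H :=
  derivY ψ p • X p - derivX ψ p • Y p + ψ p • Z p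

/-- `φ t`, `|t| < ε`, is the flow of the vector field `V`, starting at the points of `S`. -/
def IsFlowOn (V : H → H) (S : Set H) (ε : ℝ) (φ : ℝ → H → H) : Prop :=
  ∀ p ∈ S, φ 0 p = p ∧
    ∀ t ∈ Ioo (-ε) ε, HasDerivAt (fun s => φ s p) (V (φ t p)) t

/-- `f` is a critical point of `E_U` among the contact graph variations of its intrinsic graph
whose potentials `ψ` (with `YYψ = 0`) have support in `Π⁻¹(U)`. Here `U` is bounded. -/
def IsCriticalPoint (U : Set V₀) (f : V₀ → ℝ) : Prop :=
  ∀ ψ : H → ℝ, ContDiff ℝ ∞ ψ → (∀ p, derivY (derivY ψ) p = 0) →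
    tsupport ψ ⊆ proj₀ ⁻¹' U →
    ∀ (ε : ℝ) (φ : ℝ → H → H) (F : ℝ → V₀ → ℝ), 0 < ε →
      IsFlowOn (contactField ψ) (graph U f) ε φ →
      (∀ t ∈ Ioo (-ε) ε, graph U (F t) = φ t '' graph U f) →
      HasDerivAt (fun t => energy U (F t)) 0 0

/-- The graph of `f` is contact harmonic on `U`. The energy is defined on bounded sets; when `U`
is bounded the condition for `U' = U` implies the others, because a variation supported over `U'`
does not change the energy density of `f` off `U'`. -/
def ContactHarmonic (U : Set V₀) (f : V₀ → ℝ) : Prop :=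
  ∀ U' ⊆ U, IsOpen U' → Bornology.IsBounded U' → IsCriticalPoint U' f

/-! ### Smooth herringbone singularities -/

/-- The parts of `U` above and below the curve `z = γ(x)`. -/
def above (U : Set V₀) (γ : ℝ → ℝ) : Set V₀ := {v ∈ U | γ v.1 < v.2}

def below (U : Set V₀) (γ : ℝ → ℝ) : Set V₀ := {v ∈ U | v.2 < γ v.1}

/-- A smooth foliation `F` of a neighbourhood of the closure of `π(N ∩ Ψ_f(W))`, with tangent lines
of bounded slope, that extends the projection under `π` of the horizontal foliation of
`N ∩ Ψ_f(W)`, where `f` is smooth on `W`. A smooth foliation of a planar domain is a smooth line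
field; bounded slopes mean that it is spanned by `∂_x + slope ∂_y` with `slope` smooth and bounded.
The horizontal foliation of the graph of a smooth `f` is tangent to `X + (∇_f f) Y`. -/
structure FoliationExtension (f : V₀ → ℝ) (N : Set H) (W : Set V₀) where
  dom : Set (ℝ × ℝ)
  slope : ℝ × ℝ → ℝ
  isOpen_dom : IsOpen dom
  closure_subset : closure (projXY '' (N ∩ graph W f)) ⊆ dom
  smooth : ContDiffOn ℝ ∞ slope dom
  bounded : ∃ B : ℝ, ∀ q ∈ dom, |slope q| ≤ B
  extends_horizontal : ∀ v ∈ W, Psi f v ∈ N → slope (projXY (Psi f v)) = nabla f f v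

/-- An intrinsic Lipschitz graph `Γ_f` over `U` with a smooth herringbone singularity along the
horizontal curve `C`, where `C` is parametrized by `c t = Ψ_f (t, γ t)`, `t ∈ I`. -/
structure SmoothHerringbone (U : Set V₀) (f : V₀ → ℝ) where
  lipschitz : IsIntrinsicLipschitz U f
  I : Set ℝ
  ordConnected : I.OrdConnected
  γ : ℝ → ℝ
  /-- `Π(C)` is a curve in `U` -/
  curve_mem : ∀ t ∈ I, (t, γ t) ∈ U
  /-- `U` is the union of `Π(C)`, `above U γ` and `below U γ` -/
  fst_mem : ∀ v ∈ U, v.1 ∈ I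
  isConnected_above : IsConnected (above U γ)
  isConnected_below : IsConnected (below U γ)
  /-- `C` is smooth and horizontal -/
  curve_smooth : ContDiffOn ℝ ∞ (fun t => Psi f (t, γ t)) I
  curve_horizontal : ∀ t ∈ I, ∃ a b : ℝ,
    HasDerivAt (fun s => Psi f (s, γ s)) (a • X (Psi f (t, γ t)) + b • Y (Psi f (t, γ t))) t
  smooth_above : ContDiffOn ℝ ∞ f (above U γ)
  smooth_below : ContDiffOn ℝ ∞ f (below U γ)
  /-- a neighbourhood of `C` on which `π` embeds the graph -/
  N : Set H
  isOpen_N : IsOpen N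
  curve_mem_N : ∀ t ∈ I, Psi f (t, γ t) ∈ N
  isEmbedding : Topology.IsEmbedding (fun p : ↥(N ∩ graph U f) => projXY p)
  /-- the foliations on the two sides -/
  Fplus : FoliationExtension f N (above U γ)
  Fminus : FoliationExtension f N (below U γ)
  /-- both foliations are transverse to `π(C)`, whose slope is `(y ∘ c)'` -/
  transverse_plus : ∀ t ∈ I,
    Fplus.slope (projXY (Psi f (t, γ t))) ≠ deriv (fun s => (Psi f (s, γ s)).2.1) t
  transverse_minus : ∀ t ∈ I,
    Fminus.slope (projXY (Psi f (t, γ t))) ≠ deriv (fun s => (Psi f (s, γ s)).2.1) t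

namespace SmoothHerringbone

variable {U : Set V₀} {f : V₀ → ℝ} (S : SmoothHerringbone U f)

/-- The parametrization `c` of `C`. -/
def curve (t : ℝ) : H := Psi f (t, S.γ t)

/-- The slope `σ⁰` of `π(C)`. -/
def σ0 (t : ℝ) : ℝ := deriv (fun s => (S.curve s).2.1) t

/-- The slopes `σ⁺`, `σ⁻` of the two foliations along `π(C)`. -/
def σplus (t : ℝ) : ℝ := S.Fplus.slope (projXY (S.curve t))

def σminus (t : ℝ) : ℝ := S.Fminus.slope (projXY (S.curve t))

/-- `δ = (σ⁺ - σ⁰)² - (σ⁰ - σ⁻)²`. -/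
def δ (t : ℝ) : ℝ := (S.σplus t - S.σ0 t) ^ 2 - (S.σ0 t - S.σminus t) ^ 2

end SmoothHerringbone

/-! ### The first variation -/

/-- The integrand `-∇_f² w · ∇_f f + ½ (∇_f f)² ∂_z w`. -/
def variationIntegrand (f w : V₀ → ℝ) (v : V₀) : ℝ :=
  -nabla f (nabla f w) v * nabla f f v + 1 / 2 * nabla f f v ^ 2 * dz w v

/-- The integrand `(w ∂_z f + ∇_f w) ∇_f² f`. -/
def interiorIntegrand (f w : V₀ → ℝ) (v : V₀) : ℝ :=
  (w v * dz f v + nabla f w v) * nabla f (nabla f f) v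

/-- The first variation `A₂`. -/
def A₂ (U : Set V₀) (f w : V₀ → ℝ) : ℝ := ∫ v in U, variationIntegrand f w v

end

end Heis

/-! ### The Carnot–Carathéodory distance and Hölder continuity of intrinsic Lipschitz graphs. -/

namespace Heis

/-! Since ψ = w ∘ Π satisfies Yψ = 0, the contact flow fixes x, covers the flow (x, z) ↦ (x, h_t) of
w ∂_z on V₀, and acts on heights by y ↦ yJ - K, where J = ∂_z h_t and K = ∂_x h_t. Pulled back by
the planar flow, f_t is therefore fJ - K. The planar flow carries ∂_x - f ∂_z to ∂_x - f_t ∂_z, so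
with θ = ∇_f f the pulled back gradient of f_t is Jθ + a, where a = 2f ∂_x J - f² ∂_z J - ∂_x K;
`IsVerticalFlow.weak_identity` proves this distributionally. A change of variables turns the new
energy into ½∫ J (Jθ + a)², and its expansion in t needs only bounds depending on w and on sup |f|
(`IsVerticalFlow.exists_energy_expansion`). The linear coefficient is A₂.

For the formula for A₂, the difference of the two integrands is, on each side of the curve, the
divergence of an explicit field. Its flux towards the curve involves ∂_z f, which may blow up there.
Adding the rotated gradient of S = w σ (f - f₀), with f₀ the trace of f on the curve and σ the slope
of the foliation, leaves only the unbounded term (θ - σ)(f - f₀) w ∂_z f. The smooth extension of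
the foliation gives θ - σ = O(|f - f₀|), the Hölder estimate gives (f - f₀)² = O(distance to the
curve) (`exists_gradient_bound`), and ∂_z f is integrable because injectivity of π on the graph
makes f monotone in z (`integrableOn_dz`). So the term is harmless, the flux tends to w (σ σ⁰ - ½
σ²), and the two sides together give ½ w δ (`HalfHerringbone.first_variation`).

For a contact harmonic graph A₂ vanishes for every w. Taking w equal to φ(x) on the curve and
supported in a strip of width of order ε, the interior integral tends to 0 while the curve integral
does not depend on ε, so ∫ φ δ = 0 and δ = 0. This equates two squares; the monotonicity of f in z
also gives σ⁺ ≤ σ⁰ ≤ σ⁻ (`mul_σ_le`), which fixes the signs and yields the average. -/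

theorem ccDist_le_of_curve {c : ℝ → H} (hc : ContDiff ℝ 1 c) (a b : ℝ → ℝ)
    (h : ∀ t, HasDerivAt c (a t • X (c t) + b t • Y (c t)) t) {L : ℝ}
    (hL : ∀ t ∈ Icc (0 : ℝ) 1, |a t| + |b t| ≤ L) : ccDist (c 0) (c 1) ≤ L := by
  have hmem : length c ∈ {l | ∃ c' : ℝ → H, IsHorizontalCurve c' ∧ c' 0 = c 0 ∧ c' 1 = c 1 ∧
      l = length c'} := by
    refine ⟨c, ⟨?_, ?_⟩, rfl, rfl, rfl⟩
    · exact hc.contDiffOn.exists_lipschitzOnWith one_ne_zero (convex_Icc 0 1) isCompact_Icc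
    · exact Filter.Eventually.of_forall fun t => ⟨a t, b t, h t⟩
  have hbdd : BddBelow {l | ∃ c' : ℝ → H, IsHorizontalCurve c' ∧ c' 0 = c 0 ∧ c' 1 = c 1 ∧
      l = length c'} := by
    refine ⟨0, ?_⟩
    rintro l ⟨c', -, -, -, rfl⟩
    exact integral_nonneg fun t => Real.sqrt_nonneg _
  refine (csInf_le hbdd hmem).trans ?_
  have hle : ∀ t ∈ Icc (0 : ℝ) 1,
      ‖Real.sqrt ((deriv c t).1 ^ 2 + (deriv c t).2.1 ^ 2)‖ ≤ L := by
    intro t ht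
    rw [Real.norm_of_nonneg (Real.sqrt_nonneg _)]
    refine le_trans ?_ (hL t ht)
    rw [(h t).deriv]
    simp only [X, Y, Prod.smul_mk, smul_eq_mul, Prod.mk_add_mk, mul_one, mul_zero, add_zero,
      zero_add]
    rw [Real.sqrt_le_left (by positivity)]
    nlinarith [sq_abs (a t), sq_abs (b t), mul_nonneg (abs_nonneg (a t)) (abs_nonneg (b t))]
  have := norm_setIntegral_le_of_norm_le_const (μ := volume) (by simp) hle
  simp only [measureReal_def, Real.volume_Icc] at this
  refine (le_abs_self _).trans ?_
  simpa [length] using this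

noncomputable section

/-- The vertical component of `p⁻¹ q`. -/
def relHeight (p q : H) : ℝ := q.2.2 - p.2.2 - (p.1 * q.2.1 - p.2.1 * q.1) / 2

end

/-- The connecting curve projects to the straight segment plus a closed planar loop (r u, β v). The
segment accounts for the horizontal displacement; the signed area of the loop, whose size is the
square root of the missing height, accounts for the vertical one. -/
theorem ccDist_le (p q : H) :
    ccDist p q ≤ |q.1 - p.1| + |q.2.1 - p.2.1| + 5000 * Real.sqrt |relHeight p q| := by
  set a := q.1 - p.1 with ha
  set b := q.2.1 - p.2.1 with hb
  set r := Real.sqrt |relHeight p q| with hr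
  have hr0 : 0 ≤ r := Real.sqrt_nonneg _
  -- The loop chosen below contributes -rβ/70 to the vertical component, hence the factor -70; the
  -- sign of β carries the sign of the height.
  obtain ⟨β, hβ, hβr⟩ : ∃ β : ℝ, |β| = 70 * r ∧ r * β = -70 * relHeight p q := by
    have hrr : r * r = |relHeight p q| := Real.mul_self_sqrt (abs_nonneg _)
    rcases le_total 0 (relHeight p q) with h | h
    · refine ⟨-70 * r, by rw [abs_mul, abs_of_nonneg hr0]; norm_num, ?_⟩
      rw [abs_of_nonneg h] at hrr
      linear_combination (-70) * hrr
    · refine ⟨70 * r, by rw [abs_mul, abs_of_nonneg hr0]; norm_num, ?_⟩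
      rw [abs_of_nonpos h] at hrr
      linear_combination 70 * hrr
  -- Both u and v vanish at 0 and 1 and have mean zero on [0, 1], so the cross terms between segment
  -- and loop disappear from z 1.
  let u : ℝ → ℝ := fun t => t - 3 * t ^ 2 + 2 * t ^ 3
  let v : ℝ → ℝ := fun t => t - 6 * t ^ 2 + 10 * t ^ 3 - 5 * t ^ 4
  let u' : ℝ → ℝ := fun t => 1 - 6 * t + 6 * t ^ 2
  let v' : ℝ → ℝ := fun t => 1 - 12 * t + 30 * t ^ 2 - 20 * t ^ 3
  -- The primitive, vanishing at 0, of half the area form (x y' - y x')/2 of the planar curve.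
  let z : ℝ → ℝ := fun t => (a * β * (t * v t - 2 * (t ^ 2 / 2 - 2 * t ^ 3 + 5 / 2 * t ^ 4 - t ^ 5))
    + b * r * (2 * (t ^ 2 / 2 - t ^ 3 + t ^ 4 / 2) - t * u t)
    + r * β * (-t ^ 3 + 4 * t ^ 4 - 33 / 5 * t ^ 5 + 5 * t ^ 6 - 10 / 7 * t ^ 7)) / 2
  let c : ℝ → H := fun t => mul p (a * t + r * u t, b * t + β * v t, z t)
  have hc : ContDiff ℝ 1 c := by
    simp only [c, mul, z, u, v]
    fun_prop
  have hu : ∀ t, HasDerivAt u (u' t) t := by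
    intro t
    have := (((hasDerivAt_id t).sub ((hasDerivAt_pow 2 t).const_mul 3)).add
      ((hasDerivAt_pow 3 t).const_mul 2))
    refine this.congr_deriv ?_
    simp [u']; ring
  have hv : ∀ t, HasDerivAt v (v' t) t := by
    intro t
    have := (((hasDerivAt_id t).sub ((hasDerivAt_pow 2 t).const_mul 6)).add
      ((hasDerivAt_pow 3 t).const_mul 10)).sub ((hasDerivAt_pow 4 t).const_mul 5)
    refine this.congr_deriv ?_
    simp [v']; ring
  have hx : ∀ t, HasDerivAt (fun t => a * t + r * u t) (a + r * u' t) t := fun t => by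
    simpa using ((hasDerivAt_id t).const_mul a).fun_add ((hu t).const_mul r)
  have hy : ∀ t, HasDerivAt (fun t => b * t + β * v t) (b + β * v' t) t := fun t => by
    simpa using ((hasDerivAt_id t).const_mul b).fun_add ((hv t).const_mul β)
  have hz : ∀ t, HasDerivAt z (((a * t + r * u t) * (b + β * v' t)
      - (b * t + β * v t) * (a + r * u' t)) / 2) t := by
    intro t
    have h1 := (((((hasDerivAt_id t).mul (hv t)).sub (((((hasDerivAt_pow 2 t).div_const 2).sub
      ((hasDerivAt_pow 3 t).const_mul 2)).add ((hasDerivAt_pow 4 t).const_mul (5 / 2))).sub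
      (hasDerivAt_pow 5 t) |>.const_mul 2)).const_mul (a * β)).add
      ((((((hasDerivAt_pow 2 t).div_const 2).sub (hasDerivAt_pow 3 t)).add
      ((hasDerivAt_pow 4 t).div_const 2)).const_mul 2).sub ((hasDerivAt_id t).mul (hu t))
      |>.const_mul (b * r))).add
      ((((((hasDerivAt_pow 3 t).neg.add ((hasDerivAt_pow 4 t).const_mul 4)).sub
      ((hasDerivAt_pow 5 t).const_mul (33 / 5))).add ((hasDerivAt_pow 6 t).const_mul 5)).sub
      ((hasDerivAt_pow 7 t).const_mul (10 / 7))).const_mul (r * β)) |>.div_const 2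
    refine h1.congr_deriv ?_
    simp [u, v, u', v']; ring
  have hder : ∀ t, HasDerivAt c ((a + r * u' t) • X (c t) + (b + β * v' t) • Y (c t)) t := by
    intro t
    have h3 := (((hz t).const_add p.2.2).add
      ((((hy t).const_mul p.1).sub ((hx t).const_mul p.2.1)).div_const 2))
    have := ((hx t).const_add p.1).prodMk (((hy t).const_add p.2.1).prodMk h3)
    have hc' : HasDerivAt c _ t := this
    refine hc'.congr_deriv ?_
    simp only [c, mul, X, Y, Prod.smul_mk, smul_eq_mul, Prod.mk_add_mk, Prod.mk.injEq]
    refine ⟨by ring, by ring, by ring⟩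
  have h0 : c 0 = p := by
    ext <;> simp [c, mul, u, v, z]
  have h1 : c 1 = q := by
    ext
    · simp [c, mul, u, ha]; ring
    · simp [c, mul, v, hb]; ring
    · have : z 1 = relHeight p q := by
        simp only [z, u, v, hβr]; ring
      simp only [c, mul, this]
      simp only [u, v, relHeight, ha, hb]
      ring
  have := ccDist_le_of_curve hc _ _ hder (L := |a| + |b| + 5000 * r) ?_
  · rwa [h0, h1] at this
  intro t ht
  -- Crude bounds are enough: 13 + 70 · 63 = 4423 is below 5000.
  have hp1 : |u' t| ≤ 13 := by
    rw [abs_le]; constructor <;> simp only [u'] <;> nlinarith [ht.1, ht.2, mul_nonneg ht.1 ht.1]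
  have ht2 : t ^ 2 ≤ 1 := by nlinarith [ht.1, ht.2]
  have ht3 : t ^ 3 ≤ 1 := pow_le_one₀ ht.1 ht.2
  have hp2 : |v' t| ≤ 63 := by
    have h2 := pow_nonneg ht.1 2
    have h3 := pow_nonneg ht.1 3
    rw [abs_le]; constructor <;> simp only [v'] <;> linarith [ht.1, ht.2]
  have e1 : |a + r * u' t| ≤ |a| + r * 13 := by
    refine (abs_add_le _ _).trans ?_
    rw [abs_mul, abs_of_nonneg hr0]
    gcongr
  have e2 : |b + β * v' t| ≤ |b| + 70 * r * 63 := by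
    refine (abs_add_le _ _).trans ?_
    rw [abs_mul, hβ]
    gcongr
  linarith

/-- Intrinsic Lipschitz functions are Hölder continuous along the graph. -/
theorem IsIntrinsicLipschitz.exists_holder {U : Set V₀} {f : V₀ → ℝ}
    (hf : IsIntrinsicLipschitz U f) : ∃ K : ℝ, 0 < K ∧ ∀ v ∈ U, ∀ v' ∈ U,
      |f v' - f v| ≤ K * (|v'.1 - v.1| + Real.sqrt |v'.2 - v.2 + (v'.1 - v.1) * f v|) := by
  obtain ⟨lam, h0, h1, h⟩ := hf
  have h1' : 0 < 1 - lam := by linarith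
  refine ⟨2 * (1 + 5000 + 5000 ^ 2 / (1 - lam)) / (1 - lam), by positivity, ?_⟩
  intro v hv v' hv'
  have key := h _ ⟨v, hv, rfl⟩ _ ⟨v', hv', rfl⟩
  have hcc := ccDist_le (Psi f v) (Psi f v')
  have hrel : relHeight (Psi f v) (Psi f v') =
      (v'.2 - v.2 + (v'.1 - v.1) * f v) + (v'.1 - v.1) * (f v' - f v) / 2 := by
    simp only [relHeight, Psi, mul, incl]
    ring
  rw [hrel] at hcc
  simp only [Psi, mul, incl, add_zero, zero_add] at key hcc
  set a := v'.1 - v.1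
  set b := f v' - f v
  set e := v'.2 - v.2 + a * f v
  have hs : Real.sqrt |e + a * b / 2| ≤ Real.sqrt |e| + Real.sqrt (|a| * |b|) := by
    rw [Real.sqrt_le_left (by positivity)]
    have e1 := Real.sq_sqrt (abs_nonneg e)
    have e2 := Real.sq_sqrt (mul_nonneg (abs_nonneg a) (abs_nonneg b))
    have e3 : |e + a * b / 2| ≤ |e| + |a| * |b| / 2 := by
      refine (abs_add_le _ _).trans ?_
      rw [abs_div, abs_mul]; norm_num
    nlinarith [Real.sqrt_nonneg |e|, Real.sqrt_nonneg (|a| * |b|),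
      mul_nonneg (Real.sqrt_nonneg |e|) (Real.sqrt_nonneg (|a| * |b|)),
      mul_nonneg (abs_nonneg a) (abs_nonneg b)]
  -- A weighted arithmetic–geometric inequality: half of the slack 1 - lam, positive because lam <
  -- 1, absorbs the mixed term into the left-hand side.
  have hamgm : 5000 * Real.sqrt (|a| * |b|) ≤ (1 - lam) / 2 * |b| + 5000 ^ 2 / (1 - lam) * |a| := by
    have e2 := Real.sq_sqrt (mul_nonneg (abs_nonneg a) (abs_nonneg b))
    have : (5000 * Real.sqrt (|a| * |b|)) ^ 2
        ≤ ((1 - lam) / 2 * |b| + 5000 ^ 2 / (1 - lam) * |a|) ^ 2 := by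
      rw [mul_pow, e2]
      have h4 : (1 - lam) / 2 * (5000 ^ 2 / (1 - lam)) = 5000 ^ 2 / 2 := by field_simp
      have : ((1 - lam) / 2 * |b| + 5000 ^ 2 / (1 - lam) * |a|) ^ 2
          = ((1 - lam) / 2 * |b| - 5000 ^ 2 / (1 - lam) * |a|) ^ 2
            + 4 * ((1 - lam) / 2 * (5000 ^ 2 / (1 - lam))) * (|a| * |b|) := by ring
      rw [this, h4]
      nlinarith [sq_nonneg ((1 - lam) / 2 * |b| - 5000 ^ 2 / (1 - lam) * |a|),
        mul_nonneg (abs_nonneg a) (abs_nonneg b)]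
    exact le_of_sq_le_sq this (by positivity)
  have hsn := Real.sqrt_nonneg |e|
  have hfin : (1 - lam) / 2 * |b| ≤ (1 + 5000 + 5000 ^ 2 / (1 - lam)) * (|a| + Real.sqrt |e|) := by
    have hD : 0 ≤ 5000 ^ 2 / (1 - lam) := by positivity
    have h5 : lam * ccDist (v.1, f v, v.2 + v.1 * f v / 2 ) (v'.1, f v', v'.2 + v'.1 * f v' / 2)
        ≤ lam * (|a| + |b|) + 1 * (5000 * (Real.sqrt |e| + Real.sqrt (|a| * |b|))) := by
      refine (mul_le_mul_of_nonneg_left (by simpa using hcc) h0.le).trans ?_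
      rw [mul_add]
      gcongr
    have h6 : |b| ≤ lam * (|a| + |b|) + 1 * (5000 * (Real.sqrt |e| + Real.sqrt (|a| * |b|))) := by
      refine le_trans (by simpa using key) h5
    have h7 : lam * |a| ≤ 1 * |a| := by gcongr
    nlinarith [abs_nonneg a, mul_nonneg hD hsn]
  rw [div_mul_eq_mul_div, le_div_iff₀ h1']
  linarith

/-- The Hölder estimate satisfied by intrinsic Lipschitz functions. -/
def IsIntrinsicHolder (U : Set V₀) (f : V₀ → ℝ) (K : ℝ) : Prop :=
  ∀ v ∈ U, ∀ v' ∈ U,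
    |f v' - f v| ≤ K * (|v'.1 - v.1| + Real.sqrt |v'.2 - v.2 + (v'.1 - v.1) * f v|)

theorem IsIntrinsicHolder.continuousOn {U : Set V₀} {f : V₀ → ℝ} {K : ℝ}
    (hf : IsIntrinsicHolder U f K) : ContinuousOn f U := by
  intro v hv
  rw [ContinuousWithinAt, tendsto_iff_dist_tendsto_zero]
  have hlim : Filter.Tendsto (fun v' : V₀ => K * (|v'.1 - v.1| +
      Real.sqrt |v'.2 - v.2 + (v'.1 - v.1) * f v|)) (nhdsWithin v U) (nhds 0) := by
    have : ContinuousAt (fun v' : V₀ => K * (|v'.1 - v.1| +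
      Real.sqrt |v'.2 - v.2 + (v'.1 - v.1) * f v|)) v := by fun_prop
    simpa [ContinuousAt] using this.tendsto.mono_left nhdsWithin_le_nhds
  refine squeeze_zero' (Filter.Eventually.of_forall fun _ => dist_nonneg) ?_ hlim
  filter_upwards [self_mem_nhdsWithin] with v' hv'
  rw [Real.dist_eq]
  exact hf v hv v' hv'

theorem IsIntrinsicHolder.abs_sub_le {U : Set V₀} {f : V₀ → ℝ} {K : ℝ}
    (hf : IsIntrinsicHolder U f K) {x z z' : ℝ} (h : (x, z) ∈ U) (h' : (x, z') ∈ U) :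
    |f (x, z') - f (x, z)| ≤ K * Real.sqrt |z' - z| := by
  simpa using hf _ h _ h'

/-- Along the line through v in the direction (1, -f v) the square root term vanishes identically,
so difference quotients at v are at most K. Where f is not differentiable, `fderiv` is zero by
default, so the bound holds at every point of U. -/
theorem IsIntrinsicHolder.abs_nabla_le {U : Set V₀} (hU : IsOpen U) {f : V₀ → ℝ} {K : ℝ}
    (hK : 0 ≤ K) (hf : IsIntrinsicHolder U f K) {v : V₀} (hv : v ∈ U) :
    |nabla f f v| ≤ K := by
  by_cases hd : DifferentiableAt ℝ f v
  · have hl : HasDerivAt (fun s : ℝ => v + s • ((1, -f v) : V₀)) ((1, -f v) : V₀) 0 := by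
      simpa using ((hasDerivAt_id (0 : ℝ)).smul_const ((1, -f v) : V₀)).const_add v
    have hd' : HasFDerivAt f (fderiv ℝ f v) (v + (0 : ℝ) • ((1, -f v) : V₀)) := by
      simpa using hd.hasFDerivAt
    have hcomp := hd'.comp_hasDerivAt (0 : ℝ) hl
    have hval : fderiv ℝ f v ((1, -f v) : V₀) = nabla f f v := by
      have : ((1, -f v) : V₀) = (1, 0) + (-f v) • (0, 1) := by simp
      rw [this, map_add, map_smul]
      simp [nabla, dx, dz]
      ring
    rw [hval] at hcomp
    have hcont : Filter.Tendsto (fun s : ℝ => v + s • ((1, -f v) : V₀)) (nhds 0) (nhds v) := by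
      simpa using hl.continuousAt.tendsto
    have hle := hcomp.hasFDerivAt.le_of_lip' (C := K) hK ?_
    · simpa using hle
    filter_upwards [hcont (hU.mem_nhds hv)] with s hs
    have := hf v hv _ hs
    simp only [Function.comp, zero_smul, add_zero, sub_zero]
    simpa using this
  · simp [nabla, dx, dz, fderiv_zero_of_not_differentiableAt hd, hK]

end Heis

namespace Heis

open Filter Topology

/-! ### Scalar differential equations -/

/-- A bounded right-hand side lets Picard–Lindelöf run on an interval of any length: within time T
the solution moves by at most L T. -/
theorem exists_solution_Icc {g : ℝ → ℝ} {K : NNReal} (hK : LipschitzWith K g) {L : NNReal}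
    (hL : ∀ x, ‖g x‖ ≤ L) (z T : ℝ) (hT : 0 ≤ T) :
    ∃ α : ℝ → ℝ, α 0 = z ∧ ∀ t ∈ Ioo (-T) T, HasDerivAt α (g (α t)) t := by
  have h0 : (0 : ℝ) ∈ Icc (-T) T := ⟨by linarith, hT⟩
  have hp : IsPicardLindelof (fun _ => g) (⟨0, h0⟩ : Icc (-T) T) z (L * ⟨T, hT⟩) 0 L K := by
    refine IsPicardLindelof.of_time_independent (fun x _ => hL x) hK.lipschitzOnWith ?_
    simp only [sub_zero, zero_sub, neg_neg, max_self, NNReal.coe_zero]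
    exact le_of_eq rfl
  obtain ⟨α, h1, h2⟩ := hp.exists_eq_forall_mem_Icc_hasDerivWithinAt₀
  exact ⟨α, h1, fun t ht => (h2 t (Ioo_subset_Icc_self ht)).hasDerivAt (Icc_mem_nhds ht.1 ht.2)⟩

theorem solution_unique {g : ℝ → ℝ} {K : NNReal} (hK : LipschitzWith K g) {T : ℝ}
    {α β : ℝ → ℝ} (hα : ∀ t ∈ Ioo (-T) T, HasDerivAt α (g (α t)) t)
    (hβ : ∀ t ∈ Ioo (-T) T, HasDerivAt β (g (β t)) t) (h0 : α 0 = β 0) :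
    ∀ t ∈ Ioo (-T) T, α t = β t := by
  intro t ht
  have hT : 0 < T := by linarith [ht.1, ht.2]
  exact ODE_solution_unique_of_mem_Ioo (v := fun _ => g) (s := fun _ => univ) (t₀ := 0)
    (fun _ _ => hK.lipschitzOnWith) ⟨by linarith, hT⟩ (fun t ht => ⟨hα t ht, trivial⟩)
    (fun t ht => ⟨hβ t ht, trivial⟩) h0 ht

/-- The solutions on the intervals (-n, n) agree on overlaps by uniqueness and glue to a global one.
-/
theorem exists_solution {g : ℝ → ℝ} {K : NNReal} (hK : LipschitzWith K g) {L : NNReal}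
    (hL : ∀ x, ‖g x‖ ≤ L) (z : ℝ) :
    ∃ α : ℝ → ℝ, α 0 = z ∧ ∀ t, HasDerivAt α (g (α t)) t := by
  choose α h1 h2 using fun n : ℕ => exists_solution_Icc hK hL z (n : ℝ) n.cast_nonneg
  have hagree : ∀ n m : ℕ, ∀ t ∈ Ioo (-(n : ℝ)) n, t ∈ Ioo (-(m : ℝ)) m → α n t = α m t := by
    intro n m t hn hm
    have hmin : t ∈ Ioo (-(min n m : ℝ)) (min n m : ℝ) := by
      rcases le_total (n : ℝ) m with h | h
      · rwa [min_eq_left h]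
      · rwa [min_eq_right h]
    refine solution_unique hK (T := min (n : ℝ) m) (fun s hs => h2 n s ?_) (fun s hs => h2 m s ?_)
      ((h1 n).trans (h1 m).symm) t hmin
    · exact ⟨by linarith [hs.1, min_le_left (n : ℝ) m], by linarith [hs.2, min_le_left (n : ℝ) m]⟩
    · exact ⟨by linarith [hs.1, min_le_right (n : ℝ) m], by linarith [hs.2, min_le_right (n : ℝ) m]⟩
  have hmem : ∀ t : ℝ, t ∈ Ioo (-((⌈|t|⌉₊ + 1 : ℕ) : ℝ)) ((⌈|t|⌉₊ + 1 : ℕ) : ℝ) := by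
    intro t
    have : |t| < ((⌈|t|⌉₊ + 1 : ℕ) : ℝ) := by
      push_cast
      linarith [Nat.le_ceil |t|]
    exact abs_lt.1 this
  refine ⟨fun t => α (⌈|t|⌉₊ + 1) t, by simpa using h1 1, fun t => ?_⟩
  refine (h2 _ t (hmem t)).congr_of_eventuallyEq ?_
  filter_upwards [isOpen_Ioo.mem_nhds (hmem t)] with s hs
  exact hagree _ _ s (hmem s) hs

/-- Grönwall's inequality in both time directions, the negative one by reflection. The rate L + 1
avoids the degenerate case L = 0 and gives ε / (L + 1) ≤ ε. -/
theorem abs_le_of_abs_deriv_le {D D' : ℝ → ℝ} {T L ε : ℝ} (hL : 0 ≤ L) (hε : 0 ≤ ε)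
    (hD : ∀ t, HasDerivAt D (D' t) t) (h : ∀ t, |t| ≤ T → |D' t| ≤ L * |D t| + ε)
    {t : ℝ} (ht : |t| ≤ T) : |D t| ≤ (|D 0| + ε) * Real.exp ((L + 1) * T) := by
  have key : ∀ (D D' : ℝ → ℝ), (∀ t, HasDerivAt D (D' t) t) →
      (∀ t, |t| ≤ T → |D' t| ≤ L * |D t| + ε) → ∀ t, 0 ≤ t → t ≤ T →
      |D t| ≤ (|D 0| + ε) * Real.exp ((L + 1) * T) := by
    intro D D' hD h t h0 ht
    have hg := norm_le_gronwallBound_of_norm_deriv_right_le (f := D) (f' := D') (δ := |D 0|)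
      (K := L + 1) (ε := ε) (a := 0) (b := T)
      (fun s _ => (hD s).continuousAt.continuousWithinAt)
      (fun s _ => (hD s).hasDerivWithinAt) le_rfl
      (fun s hs => (h s (by rw [abs_of_nonneg hs.1]; exact hs.2.le)).trans (by
        rw [Real.norm_eq_abs]; nlinarith [abs_nonneg (D s)])) t ⟨h0, ht⟩
    rw [gronwallBound_of_K_ne_0 (by linarith), sub_zero, Real.norm_eq_abs] at hg
    have e1 : Real.exp ((L + 1) * t) ≤ Real.exp ((L + 1) * T) := by
      rw [Real.exp_le_exp]; gcongr
    have e0 := Real.one_le_exp (mul_nonneg (by linarith : 0 ≤ L + 1) h0)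
    have e2 : ε / (L + 1) ≤ ε := div_le_self hε (by linarith)
    calc |D t| ≤ |D 0| * Real.exp ((L + 1) * t) + ε / (L + 1) * (Real.exp ((L + 1) * t) - 1) := hg
      _ ≤ |D 0| * Real.exp ((L + 1) * t) + ε * (Real.exp ((L + 1) * t) - 1) := by gcongr
      _ ≤ (|D 0| + ε) * Real.exp ((L + 1) * t) := by nlinarith
      _ ≤ _ := by gcongr
  rcases le_total 0 t with h0 | h0
  · exact key D D' hD h t h0 ((le_abs_self t).trans ht)
  · have := key (fun s => D (-s)) (fun s => -D' (-s)) (fun s => by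
      simpa [Function.comp_def] using (hD (-s)).scomp s (hasDerivAt_neg s)) (fun s hs => by
      simpa using h (-s) (by simpa using hs)) (-t) (by linarith) (by rwa [abs_of_nonpos h0] at ht)
    simpa using this

/-! ### Partial derivatives -/

section PartialDerivatives

variable {g h : V₀ → ℝ} {v : V₀} {W : Set V₀}

theorem fderiv_apply_eq (g : V₀ → ℝ) (v : V₀) (a b : ℝ) :
    fderiv ℝ g v (a, b) = a * dx g v + b * dz g v := by
  have : ((a, b) : V₀) = a • (1, 0) + b • (0, 1) := by simp
  rw [this, map_add, map_smul, map_smul]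
  simp [dx, dz]

theorem fderiv_eq_smul_add_smul (g : V₀ → ℝ) (v : V₀) :
    fderiv ℝ g v = dx g v • ContinuousLinearMap.fst ℝ ℝ ℝ + dz g v • ContinuousLinearMap.snd ℝ ℝ ℝ := by
  ext <;> simp [dx, dz]

theorem dx_eq_of_hasFDerivAt {a b : ℝ} (hg : HasFDerivAt g
    (a • ContinuousLinearMap.fst ℝ ℝ ℝ + b • ContinuousLinearMap.snd ℝ ℝ ℝ) v) : dx g v = a := by
  simp [dx, hg.fderiv]

theorem dz_eq_of_hasFDerivAt {a b : ℝ} (hg : HasFDerivAt g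
    (a • ContinuousLinearMap.fst ℝ ℝ ℝ + b • ContinuousLinearMap.snd ℝ ℝ ℝ) v) : dz g v = b := by
  simp [dz, hg.fderiv]

theorem dx_add (hg : DifferentiableAt ℝ g v) (hh : DifferentiableAt ℝ h v) :
    dx (fun p => g p + h p) v = dx g v + dx h v := by simp [dx, fderiv_fun_add hg hh]

theorem dz_add (hg : DifferentiableAt ℝ g v) (hh : DifferentiableAt ℝ h v) :
    dz (fun p => g p + h p) v = dz g v + dz h v := by simp [dz, fderiv_fun_add hg hh]

theorem dx_sub (hg : DifferentiableAt ℝ g v) (hh : DifferentiableAt ℝ h v) :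
    dx (fun p => g p - h p) v = dx g v - dx h v := by simp [dx, fderiv_fun_sub hg hh]

theorem dz_sub (hg : DifferentiableAt ℝ g v) (hh : DifferentiableAt ℝ h v) :
    dz (fun p => g p - h p) v = dz g v - dz h v := by simp [dz, fderiv_fun_sub hg hh]

theorem dx_mul (hg : DifferentiableAt ℝ g v) (hh : DifferentiableAt ℝ h v) :
    dx (fun p => g p * h p) v = g v * dx h v + h v * dx g v := by simp [dx, fderiv_fun_mul hg hh]

theorem dz_mul (hg : DifferentiableAt ℝ g v) (hh : DifferentiableAt ℝ h v) :
    dz (fun p => g p * h p) v = g v * dz h v + h v * dz g v := by simp [dz, fderiv_fun_mul hg hh]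

theorem dx_congr (e : g =ᶠ[𝓝 v] h) : dx g v = dx h v := by simp [dx, e.fderiv_eq]

theorem dz_congr (e : g =ᶠ[𝓝 v] h) : dz g v = dz h v := by simp [dz, e.fderiv_eq]

theorem dx_const (c : ℝ) : dx (fun _ => c) v = 0 := by simp [dx]

theorem dz_const (c : ℝ) : dz (fun _ => c) v = 0 := by simp [dz]

theorem dx_pow_two (hg : DifferentiableAt ℝ g v) : dx (fun p => g p ^ 2) v = 2 * g v * dx g v := by
  simp only [pow_two]; rw [dx_mul hg hg]; ring

theorem dz_pow_two (hg : DifferentiableAt ℝ g v) : dz (fun p => g p ^ 2) v = 2 * g v * dz g v := by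
  simp only [pow_two]; rw [dz_mul hg hg]; ring

theorem hasFDerivAt_comp_fst {a : ℝ → ℝ} {a' : ℝ} (h : HasDerivAt a a' v.1) :
    HasFDerivAt (fun p : V₀ => a p.1)
      (a' • ContinuousLinearMap.fst ℝ ℝ ℝ + (0 : ℝ) • ContinuousLinearMap.snd ℝ ℝ ℝ) v := by
  have := h.comp_hasFDerivAt v (hasFDerivAt_fst (𝕜 := ℝ) (p := v))
  simpa [Function.comp_def] using this

theorem dx_comp_fst {a : ℝ → ℝ} {a' : ℝ} (h : HasDerivAt a a' v.1) :
    dx (fun p : V₀ => a p.1) v = a' := dx_eq_of_hasFDerivAt (hasFDerivAt_comp_fst h)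

theorem dz_comp_fst {a : ℝ → ℝ} {a' : ℝ} (h : HasDerivAt a a' v.1) :
    dz (fun p : V₀ => a p.1) v = 0 := dz_eq_of_hasFDerivAt (hasFDerivAt_comp_fst h)

theorem contDiffOn_dx (hW : IsOpen W) {n m : WithTop ℕ∞} (hg : ContDiffOn ℝ n g W) (hm : m + 1 ≤ n) :
    ContDiffOn ℝ m (dx g) W :=
  (hg.fderiv_of_isOpen hW hm).clm_apply contDiffOn_const

theorem contDiffOn_dz (hW : IsOpen W) {n m : WithTop ℕ∞} (hg : ContDiffOn ℝ n g W) (hm : m + 1 ≤ n) :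
    ContDiffOn ℝ m (dz g) W :=
  (hg.fderiv_of_isOpen hW hm).clm_apply contDiffOn_const

theorem contDiff_dx {n m : WithTop ℕ∞} (hg : ContDiff ℝ n g) (hm : m + 1 ≤ n) :
    ContDiff ℝ m (dx g) := (hg.fderiv_right hm).clm_apply contDiff_const

theorem contDiff_dz {n m : WithTop ℕ∞} (hg : ContDiff ℝ n g) (hm : m + 1 ≤ n) :
    ContDiff ℝ m (dz g) := (hg.fderiv_right hm).clm_apply contDiff_const

theorem tsupport_dx_subset (g : V₀ → ℝ) : tsupport (dx g) ⊆ tsupport g :=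
  (tsupport_fderiv_apply_subset ℝ (1, 0))

theorem tsupport_dz_subset (g : V₀ → ℝ) : tsupport (dz g) ⊆ tsupport g :=
  (tsupport_fderiv_apply_subset ℝ (0, 1))

theorem hasCompactSupport_dx (hg : HasCompactSupport g) : HasCompactSupport (dx g) :=
  hg.fderiv_apply ℝ (1, 0)

theorem hasCompactSupport_dz (hg : HasCompactSupport g) : HasCompactSupport (dz g) :=
  hg.fderiv_apply ℝ (0, 1)

theorem dx_dz_comm (hW : IsOpen W) (hg : ContDiffOn ℝ 2 g W) (hv : v ∈ W) :
    dx (dz g) v = dz (dx g) v := by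
  have h2 : ContDiffAt ℝ 2 g v := (hg v hv).contDiffAt (hW.mem_nhds hv)
  have hs : IsSymmSndFDerivAt ℝ g v := h2.isSymmSndFDerivAt (by simp)
  have hd : DifferentiableAt ℝ (fderiv ℝ g) v :=
    (h2.fderiv_right (m := 1) (by norm_num)).differentiableAt (by norm_num)
  have e : ∀ a b : V₀, fderiv ℝ (fun p => fderiv ℝ g p a) v b = fderiv ℝ (fderiv ℝ g) v b a := by
    intro a b
    rw [fderiv_clm_apply hd (by fun_prop)]
    simp
  show fderiv ℝ (fun p => fderiv ℝ g p (0, 1)) v (1, 0) =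
    fderiv ℝ (fun p => fderiv ℝ g p (1, 0)) v (0, 1)
  rw [e, e]
  exact hs _ _

end PartialDerivatives

/-! ### Families of functions that are continuously differentiable in space -/

/-- A family of functions, jointly continuous together with its space derivative. -/
structure SpaceC1 (g : ℝ → V₀ → ℝ) : Prop where
  cont : Continuous fun p : ℝ × V₀ => g p.1 p.2
  diff : ∀ t, Differentiable ℝ (g t)
  cont_fderiv : Continuous fun p : ℝ × V₀ => fderiv ℝ (g p.1) p.2

namespace SpaceC1

variable {g k : ℝ → V₀ → ℝ}

theorem contDiff (hg : SpaceC1 g) (t : ℝ) : ContDiff ℝ 1 (g t) :=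
  contDiff_one_iff_fderiv.2 ⟨hg.diff t, hg.cont_fderiv.comp (by fun_prop :
    Continuous fun v : V₀ => (t, v))⟩

theorem cont_dx (hg : SpaceC1 g) : Continuous fun p : ℝ × V₀ => dx (g p.1) p.2 :=
  hg.cont_fderiv.clm_apply continuous_const

theorem cont_dz (hg : SpaceC1 g) : Continuous fun p : ℝ × V₀ => dz (g p.1) p.2 :=
  hg.cont_fderiv.clm_apply continuous_const

theorem mul (hg : SpaceC1 g) (hk : SpaceC1 k) : SpaceC1 fun t v => g t v * k t v where
  cont := hg.cont.mul hk.cont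
  diff t := (hg.diff t).mul (hk.diff t)
  cont_fderiv := by
    have : (fun p : ℝ × V₀ => fderiv ℝ (fun v => g p.1 v * k p.1 v) p.2) = fun p =>
        g p.1 p.2 • fderiv ℝ (k p.1) p.2 + k p.1 p.2 • fderiv ℝ (g p.1) p.2 := by
      funext p
      exact fderiv_fun_mul (hg.diff p.1 p.2) (hk.diff p.1 p.2)
    rw [this]
    exact (hg.cont.smul hk.cont_fderiv).add (hk.cont.smul hg.cont_fderiv)

theorem comp {a : ℝ → ℝ} (ha : ContDiff ℝ 1 a) (hg : SpaceC1 g) :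
    SpaceC1 fun t v => a (g t v) where
  cont := ha.continuous.comp hg.cont
  diff t := (ha.differentiable (by norm_num)).comp (hg.diff t)
  cont_fderiv := by
    have : (fun p : ℝ × V₀ => fderiv ℝ (fun v => a (g p.1 v)) p.2) = fun p =>
        deriv a (g p.1 p.2) • fderiv ℝ (g p.1) p.2 := by
      funext p
      exact ((ha.differentiable (by norm_num)).differentiableAt.hasDerivAt.comp_hasFDerivAt p.2
        (hg.diff p.1 p.2).hasFDerivAt).fderiv
    rw [this]
    exact ((ha.continuous_deriv le_rfl).comp hg.cont).smul hg.cont_fderiv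

theorem neg (hg : SpaceC1 g) : SpaceC1 fun t v => -g t v :=
  comp (a := fun x => -x) (by fun_prop) hg

theorem hasFDerivAt_comp_graph (hg : SpaceC1 g) {W : V₀ → ℝ} (hW : ContDiff ℝ 1 W) (t : ℝ) (v : V₀) :
    HasFDerivAt (fun v : V₀ => W (v.1, g t v))
      ((dx W (v.1, g t v) + dz W (v.1, g t v) * dx (g t) v) • ContinuousLinearMap.fst ℝ ℝ ℝ +
        (dz W (v.1, g t v) * dz (g t) v) • ContinuousLinearMap.snd ℝ ℝ ℝ) v := by
  have h1 : HasFDerivAt (fun v : V₀ => ((v.1, g t v) : V₀))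
      ((ContinuousLinearMap.fst ℝ ℝ ℝ).prod (fderiv ℝ (g t) v)) v :=
    hasFDerivAt_fst.prodMk (hg.diff t v).hasFDerivAt
  have h2 := ((hW.differentiable (by norm_num)) (v.1, g t v)).hasFDerivAt.comp v h1
  refine h2.congr_fderiv ?_
  rw [fderiv_eq_smul_add_smul W, fderiv_eq_smul_add_smul (g t)]
  ext <;> simp

theorem comp_graph (hg : SpaceC1 g) {W : V₀ → ℝ} (hW : ContDiff ℝ 1 W) :
    SpaceC1 fun t v => W (v.1, g t v) where
  cont := hW.continuous.comp (by have := hg.cont; fun_prop)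
  diff t v := (hg.hasFDerivAt_comp_graph hW t v).differentiableAt
  cont_fderiv := by
    simp only [fun p : ℝ × V₀ => (hg.hasFDerivAt_comp_graph hW p.1 p.2).fderiv]
    have h1 : Continuous fun p : ℝ × V₀ => dx W (p.2.1, g p.1 p.2) :=
      (contDiff_dx hW (m := 0) (by norm_num)).continuous.comp (by have := hg.cont; fun_prop)
    have h2 : Continuous fun p : ℝ × V₀ => dz W (p.2.1, g p.1 p.2) :=
      (contDiff_dz hW (m := 0) (by norm_num)).continuous.comp (by have := hg.cont; fun_prop)
    have h3 := hg.cont_dx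
    have h4 := hg.cont_dz
    fun_prop

theorem hasFDerivAt_integral (hg : SpaceC1 g) (t : ℝ) (v : V₀) :
    HasFDerivAt (fun v => ∫ s in (0 : ℝ)..t, g s v) (∫ s in (0 : ℝ)..t, fderiv ℝ (g s) v) v := by
  have hc : ∀ v, Continuous fun s => g s v := fun v => hg.cont.comp (by fun_prop :
    Continuous fun s : ℝ => (s, v))
  have hc' : Continuous fun s => fderiv ℝ (g s) v := hg.cont_fderiv.comp (by fun_prop :
    Continuous fun s : ℝ => (s, v))
  obtain ⟨C, hC⟩ := (isCompact_uIcc (a := (0 : ℝ)) (b := t)).prod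
    (isCompact_closedBall v 1) |>.exists_bound_of_continuousOn hg.cont_fderiv.continuousOn
  refine intervalIntegral.hasFDerivAt_integral_of_dominated_of_fderiv_le
    (F := fun v s => g s v) (F' := fun v s => fderiv ℝ (g s) v) (s := Metric.closedBall v 1) (bound := fun _ => C) (Metric.closedBall_mem_nhds v one_pos)
    (Eventually.of_forall fun v => (hc v).aestronglyMeasurable)
    ((hc v).intervalIntegrable _ _) hc'.aestronglyMeasurable ?_ (by simp) ?_
  · exact Eventually.of_forall fun s hs v' hv' => hC (s, v') ⟨uIoc_subset_uIcc hs, hv'⟩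
  · exact Eventually.of_forall fun s _ v' _ => (hg.diff s v').hasFDerivAt

theorem integral (hg : SpaceC1 g) : SpaceC1 fun t v => ∫ s in (0 : ℝ)..t, g s v where
  cont := by
    refine intervalIntegral.continuous_parametric_intervalIntegral_of_continuous
      (f := fun (p : ℝ × V₀) s => g s p.2) ?_ continuous_fst
    exact hg.cont.comp (by fun_prop : Continuous fun q : (ℝ × V₀) × ℝ => (q.2, q.1.2))
  diff t v := (hg.hasFDerivAt_integral t v).differentiableAt
  cont_fderiv := by
    simp only [fun p : ℝ × V₀ => (hg.hasFDerivAt_integral p.1 p.2).fderiv]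
    refine intervalIntegral.continuous_parametric_intervalIntegral_of_continuous
      (f := fun (p : ℝ × V₀) s => fderiv ℝ (g s) p.2) ?_ continuous_fst
    exact hg.cont_fderiv.comp (by fun_prop : Continuous fun q : (ℝ × V₀) × ℝ => (q.2, q.1.2))

theorem dx_integral (hg : SpaceC1 g) (t : ℝ) (v : V₀) :
    dx (fun v => ∫ s in (0 : ℝ)..t, g s v) v = ∫ s in (0 : ℝ)..t, dx (g s) v := by
  have hc' : Continuous fun s => fderiv ℝ (g s) v := hg.cont_fderiv.comp (by fun_prop :
    Continuous fun s : ℝ => (s, v))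
  simp only [dx, (hg.hasFDerivAt_integral t v).fderiv]
  exact ContinuousLinearMap.intervalIntegral_apply (hc'.intervalIntegrable _ _) _

theorem dz_integral (hg : SpaceC1 g) (t : ℝ) (v : V₀) :
    dz (fun v => ∫ s in (0 : ℝ)..t, g s v) v = ∫ s in (0 : ℝ)..t, dz (g s) v := by
  have hc' : Continuous fun s => fderiv ℝ (g s) v := hg.cont_fderiv.comp (by fun_prop :
    Continuous fun s : ℝ => (s, v))
  simp only [dz, (hg.hasFDerivAt_integral t v).fderiv]
  exact ContinuousLinearMap.intervalIntegral_apply (hc'.intervalIntegrable _ _) _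

end SpaceC1

/-! ### The flow of a vertical field on `V₀` -/

/-- `h t` is the vertical coordinate of the flow of `w ∂_z`. -/
structure IsVerticalFlow (w : V₀ → ℝ) (h : ℝ → V₀ → ℝ) : Prop where
  zero : ∀ v, h 0 v = v.2
  deriv : ∀ v t, HasDerivAt (fun t => h t v) (w (v.1, h t v)) t

/-- Bounds for a smooth compactly supported function on `V₀`. -/
theorem exists_bounds {w : V₀ → ℝ} (hw : ContDiff ℝ ∞ w) (hc : HasCompactSupport w) :
    ∃ L : NNReal, (∀ p, ‖w p‖ ≤ L) ∧ LipschitzWith L w ∧ LipschitzWith L (fderiv ℝ w) := by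
  obtain ⟨C, hC⟩ := hc.exists_bound_of_continuous hw.continuous
  have hw1 : ContDiff ℝ 1 w := hw.of_le (by exact_mod_cast le_top)
  have hw2 : ContDiff ℝ 1 (fderiv ℝ w) := hw.fderiv_right (m := 1) (by decide)
  obtain ⟨L1, hL1⟩ := hw1.lipschitzWith_of_hasCompactSupport hc one_ne_zero
  obtain ⟨L2, hL2⟩ := hw2.lipschitzWith_of_hasCompactSupport (hc.fderiv ℝ) one_ne_zero
  refine ⟨C.toNNReal ⊔ (L1 ⊔ L2), fun p => ?_, hL1.weaken ?_, hL2.weaken ?_⟩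
  · refine (hC p).trans ((Real.le_coe_toNNReal C).trans ?_)
    exact_mod_cast le_sup_left
  · exact le_sup_left.trans le_sup_right
  · exact le_sup_right.trans le_sup_right

theorem lipschitzWith_slice {w : V₀ → ℝ} {L : NNReal} (hw : LipschitzWith L w) (x : ℝ) :
    LipschitzWith L fun z => w (x, z) := by
  refine LipschitzWith.of_dist_le_mul fun a b => (hw.dist_le_mul _ _).trans ?_
  simp [Prod.dist_eq]

theorem exists_isVerticalFlow {w : V₀ → ℝ} (hw : ContDiff ℝ ∞ w) (hc : HasCompactSupport w) :
    ∃ h, IsVerticalFlow w h := by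
  obtain ⟨L, h1, h2, -⟩ := exists_bounds hw hc
  choose α h3 h4 using fun v : V₀ =>
    exists_solution (lipschitzWith_slice h2 v.1) (fun z => h1 (v.1, z)) v.2
  exact ⟨fun t v => α v t, h3, h4⟩

namespace IsVerticalFlow

variable {w : V₀ → ℝ} {h : ℝ → V₀ → ℝ}

theorem eq_of_hasDerivAt (H : IsVerticalFlow w h) (hw : ContDiff ℝ ∞ w) (hc : HasCompactSupport w)
    {v : V₀} {T : ℝ} {α : ℝ → ℝ} (h0 : α 0 = v.2)
    (hα : ∀ t ∈ Ioo (-T) T, HasDerivAt α (w (v.1, α t)) t) : ∀ t ∈ Ioo (-T) T, α t = h t v := by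
  obtain ⟨L, -, h2, -⟩ := exists_bounds hw hc
  exact solution_unique (lipschitzWith_slice h2 v.1) hα (fun t _ => H.deriv v t)
    (h0.trans (H.zero v).symm)

theorem eq_of_hasDerivAt' (H : IsVerticalFlow w h) (hw : ContDiff ℝ ∞ w) (hc : HasCompactSupport w)
    {v : V₀} {α : ℝ → ℝ} (h0 : α 0 = v.2)
    (hα : ∀ t, HasDerivAt α (w (v.1, α t)) t) (t : ℝ) : α t = h t v :=
  H.eq_of_hasDerivAt hw hc h0 (fun t _ => hα t) (T := |t| + 1) t (abs_lt.1 (lt_add_one _))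

theorem add (H : IsVerticalFlow w h) (hw : ContDiff ℝ ∞ w) (hc : HasCompactSupport w)
    (s t : ℝ) (v : V₀) : h s (v.1, h t v) = h (t + s) v := by
  symm
  refine H.eq_of_hasDerivAt' hw hc (v := (v.1, h t v)) (α := fun s => h (t + s) v) (by simp) ?_ s
  intro s
  simpa [Function.comp_def] using (H.deriv v (t + s)).scomp s ((hasDerivAt_id s).const_add t)

theorem neg_apply (H : IsVerticalFlow w h) (hw : ContDiff ℝ ∞ w) (hc : HasCompactSupport w)
    (t : ℝ) (v : V₀) : h (-t) (v.1, h t v) = v.2 := by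
  rw [H.add hw hc, add_neg_cancel, H.zero]

theorem eq_snd (H : IsVerticalFlow w h) (hw : ContDiff ℝ ∞ w) (hc : HasCompactSupport w)
    (t : ℝ) {v : V₀} (hv : v ∉ tsupport w) : h t v = v.2 := by
  symm
  refine H.eq_of_hasDerivAt' hw hc (α := fun _ => v.2) rfl (fun t => ?_) t
  rw [show w (v.1, v.2) = 0 from image_eq_zero_of_notMem_tsupport hv]
  exact hasDerivAt_const _ _

theorem abs_sub_le (H : IsVerticalFlow w h) (hw : ContDiff ℝ ∞ w) (hc : HasCompactSupport w)
    (T : ℝ) : ∃ C : ℝ, 0 ≤ C ∧ ∀ t, |t| ≤ T → ∀ v v', |h t v' - h t v| ≤ C * ‖v' - v‖ := by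
  obtain ⟨L, -, h2, -⟩ := exists_bounds hw hc
  refine ⟨(1 + L) * Real.exp ((L + 1) * T), by positivity, fun t ht v v' => ?_⟩
  have h1 : ‖v'.1 - v.1‖ ≤ ‖v' - v‖ := norm_fst_le (v' - v)
  have h1' : ‖v'.2 - v.2‖ ≤ ‖v' - v‖ := norm_snd_le (v' - v)
  have := abs_le_of_abs_deriv_le (D := fun t => h t v' - h t v) (T := T) (L := L)
    (ε := L * ‖v' - v‖) (by positivity) (by positivity)
    (fun t => (H.deriv v' t).sub (H.deriv v t)) (fun t _ => ?_) ht
  · refine this.trans ?_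
    simp only [H.zero]
    rw [mul_right_comm]
    gcongr
    rw [Real.norm_eq_abs] at h1'
    linarith
  · have := h2.dist_le_mul (v'.1, h t v') (v.1, h t v)
    rw [dist_eq_norm, dist_eq_norm] at this
    rw [← Real.norm_eq_abs, ← Real.norm_eq_abs, ← mul_add]
    refine this.trans ?_
    gcongr
    rw [Prod.mk_sub_mk, Prod.norm_mk]
    refine max_le ?_ ?_
    · linarith [norm_nonneg (h t v' - h t v)]
    · linarith [norm_nonneg (v' - v)]

theorem continuous (H : IsVerticalFlow w h) (hw : ContDiff ℝ ∞ w) (hc : HasCompactSupport w) :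
    Continuous fun p : ℝ × V₀ => h p.1 p.2 := by
  rw [continuous_iff_continuousAt]
  rintro ⟨t, v⟩
  obtain ⟨C, hC0, hC⟩ := H.abs_sub_le hw hc (|t| + 1)
  rw [ContinuousAt, tendsto_iff_norm_sub_tendsto_zero]
  have hlim : Tendsto (fun p : ℝ × V₀ => C * ‖p.2 - v‖ + |h p.1 v - h t v|) (𝓝 (t, v)) (𝓝 0) := by
    have h1 : ContinuousAt (fun p : ℝ × V₀ => h p.1 v) (t, v) :=
      ContinuousAt.comp (g := fun s => h s v) (H.deriv v t).continuousAt continuousAt_fst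
    have : ContinuousAt (fun p : ℝ × V₀ => C * ‖p.2 - v‖ + |h p.1 v - h t v|) (t, v) := by
      refine ContinuousAt.add ?_ ?_
      · fun_prop
      · exact (h1.sub continuousAt_const).abs
    simpa [ContinuousAt] using this.tendsto
  refine squeeze_zero' (Eventually.of_forall fun _ => norm_nonneg _) ?_ hlim
  have hev : ∀ᶠ p : ℝ × V₀ in 𝓝 (t, v), |p.1| < |t| + 1 := by
    have : ContinuousAt (fun p : ℝ × V₀ => |p.1|) (t, v) := by fun_prop
    exact this.eventually_lt_const (by simp)
  filter_upwards [hev] with p hp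
  calc ‖h p.1 p.2 - h t v‖ = |(h p.1 p.2 - h p.1 v) + (h p.1 v - h t v)| := by
        rw [Real.norm_eq_abs]; ring_nf
    _ ≤ _ := (abs_add_le _ _).trans (add_le_add_left (hC _ hp.le _ _) _)

end IsVerticalFlow

noncomputable section

/-- The vertical derivative of the vertical flow. -/
def flowJ (w : V₀ → ℝ) (h : ℝ → V₀ → ℝ) (t : ℝ) (v : V₀) : ℝ :=
  Real.exp (∫ s in (0 : ℝ)..t, dz w (v.1, h s v))

/-- The derivative of the vertical flow along `∂_x`. -/
def flowK (w : V₀ → ℝ) (h : ℝ → V₀ → ℝ) (t : ℝ) (v : V₀) : ℝ :=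
  flowJ w h t v *
    ∫ s in (0 : ℝ)..t, dx w (v.1, h s v) * Real.exp (-∫ r in (0 : ℝ)..s, dz w (v.1, h r v))

end

theorem abs_sub_taylor_le {w : V₀ → ℝ} {L : NNReal} (hw : Differentiable ℝ w)
    (hL : LipschitzWith L (fderiv ℝ w)) (p q : V₀) :
    |w q - w p - dx w p * (q.1 - p.1) - dz w p * (q.2 - p.2)| ≤ L * ‖q - p‖ ^ 2 := by
  have := (convex_segment p q).norm_image_sub_le_of_norm_hasFDerivWithin_le' (f := w)
    (f' := fderiv ℝ w) (φ := fderiv ℝ w p) (C := L * ‖q - p‖)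
    (fun x _ => (hw x).hasFDerivAt.hasFDerivWithinAt) (fun x hx => ?_) (left_mem_segment ℝ p q)
    (right_mem_segment ℝ p q)
  · rw [show q - p = (q.1 - p.1, q.2 - p.2) from rfl, fderiv_apply_eq] at this
    refine le_trans (le_of_eq ?_) (this.trans_eq (by rw [show q - p = (q.1 - p.1, q.2 - p.2) from rfl]; ring))
    rw [Real.norm_eq_abs]
    ring_nf
  · rw [← dist_eq_norm]
    refine (hL.dist_le_mul x p).trans ?_
    gcongr
    rw [dist_eq_norm]
    exact norm_sub_le_of_mem_segment hx

namespace IsVerticalFlow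

variable {w : V₀ → ℝ} {h : ℝ → V₀ → ℝ}

theorem flowJ_zero (v : V₀) : flowJ w h 0 v = 1 := by simp [flowJ]

theorem flowK_zero (v : V₀) : flowK w h 0 v = 0 := by simp [flowK]

theorem flowJ_pos (t : ℝ) (v : V₀) : 0 < flowJ w h t v := Real.exp_pos _

theorem continuous_comp_flow (H : IsVerticalFlow w h) (hw : ContDiff ℝ ∞ w)
    (hc : HasCompactSupport w) {W : V₀ → ℝ} (hW : Continuous W) :
    Continuous fun p : ℝ × V₀ => W (p.2.1, h p.1 p.2) :=
  hW.comp (by have := H.continuous hw hc; fun_prop)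

theorem continuous_comp_flow_apply (H : IsVerticalFlow w h) (hw : ContDiff ℝ ∞ w)
    (hc : HasCompactSupport w) {W : V₀ → ℝ} (hW : Continuous W) (v : V₀) :
    Continuous fun t : ℝ => W (v.1, h t v) :=
  (H.continuous_comp_flow hw hc hW).comp (by fun_prop : Continuous fun t : ℝ => (t, v))

theorem continuous_integral {g : ℝ → V₀ → ℝ} (hg : Continuous fun p : ℝ × V₀ => g p.1 p.2) :
    Continuous fun p : ℝ × V₀ => ∫ s in (0 : ℝ)..p.1, g s p.2 := by
  refine intervalIntegral.continuous_parametric_intervalIntegral_of_continuous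
    (f := fun (p : ℝ × V₀) s => g s p.2) ?_ continuous_fst
  exact hg.comp (by fun_prop : Continuous fun q : (ℝ × V₀) × ℝ => (q.2, q.1.2))

theorem continuous_flowJ (H : IsVerticalFlow w h) (hw : ContDiff ℝ ∞ w)
    (hc : HasCompactSupport w) : Continuous fun p : ℝ × V₀ => flowJ w h p.1 p.2 :=
  Real.continuous_exp.comp (continuous_integral (g := fun s v => dz w (v.1, h s v)) (H.continuous_comp_flow hw hc
    (contDiff_dz hw (m := 0) (by simp)).continuous))

theorem continuous_flowK (H : IsVerticalFlow w h) (hw : ContDiff ℝ ∞ w)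
    (hc : HasCompactSupport w) : Continuous fun p : ℝ × V₀ => flowK w h p.1 p.2 :=
  (H.continuous_flowJ hw hc).mul (continuous_integral (g := fun s v => dx w (v.1, h s v) *
    Real.exp (-∫ r in (0 : ℝ)..s, dz w (v.1, h r v))) ((H.continuous_comp_flow hw hc
    (contDiff_dx hw (m := 0) (by simp)).continuous).mul (Real.continuous_exp.comp
    (continuous_integral (g := fun s v => dz w (v.1, h s v)) (H.continuous_comp_flow hw hc
    (contDiff_dz hw (m := 0) (by simp)).continuous)).neg)))

theorem hasDerivAt_flowJ (H : IsVerticalFlow w h) (hw : ContDiff ℝ ∞ w)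
    (hc : HasCompactSupport w) (v : V₀) (t : ℝ) :
    HasDerivAt (fun t => flowJ w h t v) (dz w (v.1, h t v) * flowJ w h t v) t := by
  have hc1 := H.continuous_comp_flow_apply hw hc
    (contDiff_dz hw (m := 0) (by simp)).continuous v
  refine (hc1.integral_hasStrictDerivAt 0 t).hasDerivAt.exp.congr_deriv ?_
  rw [mul_comm, flowJ]

/-- `flowK` is the variation-of-constants solution of the equation obtained by differentiating ∂_t h
= w(x, h) in x. -/
theorem hasDerivAt_flowK (H : IsVerticalFlow w h) (hw : ContDiff ℝ ∞ w)
    (hc : HasCompactSupport w) (v : V₀) (t : ℝ) :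
    HasDerivAt (fun t => flowK w h t v)
      (dx w (v.1, h t v) + dz w (v.1, h t v) * flowK w h t v) t := by
  have hc1 := H.continuous_comp_flow_apply hw hc
    (contDiff_dx hw (m := 0) (by simp)).continuous v
  have hc2 := H.continuous_comp_flow_apply hw hc
    (contDiff_dz hw (m := 0) (by simp)).continuous v
  have hc3 : Continuous fun s => dx w (v.1, h s v) *
      Real.exp (-∫ r in (0 : ℝ)..s, dz w (v.1, h r v)) :=
    hc1.mul (Real.continuous_exp.comp
      (continuous_iff_continuousAt.2 fun s =>
        (hc2.integral_hasStrictDerivAt 0 s).hasDerivAt.continuousAt).neg)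
  refine ((H.hasDerivAt_flowJ hw hc v t).mul
    (hc3.integral_hasStrictDerivAt 0 t).hasDerivAt).congr_deriv ?_
  have he : flowJ w h t v * Real.exp (-∫ r in (0 : ℝ)..t, dz w (v.1, h r v)) = 1 := by
    rw [flowJ, ← Real.exp_add]; simp
  rw [flowK]
  linear_combination dx w (v.1, h t v) * he

/-- The error of the linear approximation vanishes at time 0 and satisfies the linearized equation
up to the Taylor remainder of w. That remainder is quadratic in the distance of the initial points,
because the flow is Lipschitz in space; Grönwall then makes the error quadratic. -/
theorem hasFDerivAt (H : IsVerticalFlow w h) (hw : ContDiff ℝ ∞ w) (hc : HasCompactSupport w)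
    (t : ℝ) (v : V₀) : HasFDerivAt (h t) (flowK w h t v • ContinuousLinearMap.fst ℝ ℝ ℝ +
      flowJ w h t v • ContinuousLinearMap.snd ℝ ℝ ℝ) v := by
  obtain ⟨L, -, h2, h3⟩ := exists_bounds hw hc
  obtain ⟨C, hC0, hC⟩ := H.abs_sub_le hw hc |t|
  have hwd : Differentiable ℝ w := hw.differentiable (by simp)
  have hdz : ∀ p, |dz w p| ≤ L := fun p => by
    have := (fderiv ℝ w p).le_of_opNorm_le (norm_fderiv_le_of_lipschitz ℝ h2) (0, 1)
    simpa [dz, Prod.norm_mk] using this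
  rw [hasFDerivAt_iff_isLittleO]
  refine Asymptotics.IsBigO.trans_isLittleO ?_ (Asymptotics.isLittleO_pow_sub_sub v one_lt_two)
  refine Asymptotics.IsBigO.of_bound (L * (1 + C) ^ 2 * Real.exp ((L + 1) * |t|))
    (Eventually.of_forall fun v' => ?_)
  have key := abs_le_of_abs_deriv_le (D := fun t => h t v' - h t v
    - flowK w h t v * (v'.1 - v.1) - flowJ w h t v * (v'.2 - v.2)) (T := |t|) (L := L)
    (ε := L * ((1 + C) * ‖v' - v‖) ^ 2) (by positivity) (by positivity)
    (fun t => (((H.deriv v' t).sub (H.deriv v t)).sub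
      ((H.hasDerivAt_flowK hw hc v t).mul_const _)).sub
      ((H.hasDerivAt_flowJ hw hc v t).mul_const _)) (fun s hs => ?_) (t := t) le_rfl
  · simp only [H.zero, flowK_zero, flowJ_zero] at key
    rw [Real.norm_eq_abs, Real.norm_of_nonneg (by positivity)]
    refine le_trans (le_of_eq ?_) (key.trans (le_of_eq ?_))
    · simp; ring_nf
    · simp; ring
  · have ht := abs_sub_taylor_le hwd h3 (v.1, h s v) (v'.1, h s v')
    have hn : ‖((v'.1, h s v') : V₀) - (v.1, h s v)‖ ≤ (1 + C) * ‖v' - v‖ := by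
      rw [Prod.mk_sub_mk, Prod.norm_mk]
      have h1 : ‖v'.1 - v.1‖ ≤ ‖v' - v‖ := norm_fst_le (v' - v)
      have h1' : ‖h s v' - h s v‖ ≤ C * ‖v' - v‖ := hC s hs v v'
      have := mul_nonneg hC0 (norm_nonneg (v' - v))
      refine max_le ?_ ?_ <;> linarith [norm_nonneg (v' - v)]
    have ht' := ht.trans (mul_le_mul_of_nonneg_left (pow_le_pow_left₀ (norm_nonneg _) hn 2)
      L.coe_nonneg)
    dsimp only at ht'
    rw [show w (v'.1, h s v') - w (v.1, h s v)
        - (dx w (v.1, h s v) + dz w (v.1, h s v) * flowK w h s v) * (v'.1 - v.1)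
        - dz w (v.1, h s v) * flowJ w h s v * (v'.2 - v.2)
      = dz w (v.1, h s v) * (h s v' - h s v - flowK w h s v * (v'.1 - v.1)
          - flowJ w h s v * (v'.2 - v.2))
        + (w (v'.1, h s v') - w (v.1, h s v) - dx w (v.1, h s v) * (v'.1 - v.1) -
          dz w (v.1, h s v) * (h s v' - h s v)) by ring]
    refine (abs_add_le _ _).trans (add_le_add ?_ ht')
    rw [abs_mul]
    exact mul_le_mul_of_nonneg_right (hdz _) (abs_nonneg _)

theorem spaceC1 (H : IsVerticalFlow w h) (hw : ContDiff ℝ ∞ w) (hc : HasCompactSupport w) :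
    SpaceC1 h where
  cont := H.continuous hw hc
  diff t v := (H.hasFDerivAt hw hc t v).differentiableAt
  cont_fderiv := by
    simp only [fun p : ℝ × V₀ => (H.hasFDerivAt hw hc p.1 p.2).fderiv]
    have h1 := H.continuous_flowJ hw hc
    have h2 := H.continuous_flowK hw hc
    fun_prop

theorem dx_eq (H : IsVerticalFlow w h) (hw : ContDiff ℝ ∞ w) (hc : HasCompactSupport w) (t : ℝ) :
    dx (h t) = flowK w h t := funext fun v => dx_eq_of_hasFDerivAt (H.hasFDerivAt hw hc t v)

theorem dz_eq (H : IsVerticalFlow w h) (hw : ContDiff ℝ ∞ w) (hc : HasCompactSupport w) (t : ℝ) :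
    dz (h t) = flowJ w h t := funext fun v => dz_eq_of_hasFDerivAt (H.hasFDerivAt hw hc t v)

theorem spaceC1_flowJ (H : IsVerticalFlow w h) (hw : ContDiff ℝ ∞ w) (hc : HasCompactSupport w) :
    SpaceC1 (flowJ w h) :=
  SpaceC1.comp Real.contDiff_exp
    ((H.spaceC1 hw hc).comp_graph (contDiff_dz hw (m := 1) (by decide))).integral

theorem spaceC1_flowK (H : IsVerticalFlow w h) (hw : ContDiff ℝ ∞ w) (hc : HasCompactSupport w) :
    SpaceC1 (flowK w h) := by
  have h1 := (H.spaceC1 hw hc).comp_graph (contDiff_dz hw (m := 1) (by decide))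
  have h2 := (H.spaceC1 hw hc).comp_graph (contDiff_dx hw (m := 1) (by decide))
  exact (H.spaceC1_flowJ hw hc).mul (h2.mul (SpaceC1.comp Real.contDiff_exp h1.integral.neg)).integral

/-- The first derivatives J and K are composed of w, the C¹ flow, products and time integrals, hence
are C¹. The gain is the symmetry ∂_z K = ∂_x J. -/
theorem contDiff_two (H : IsVerticalFlow w h) (hw : ContDiff ℝ ∞ w) (hc : HasCompactSupport w)
    (t : ℝ) : ContDiff ℝ 2 (h t) := by
  rw [show (2 : WithTop ℕ∞) = 1 + 1 by norm_num, contDiff_succ_iff_fderiv]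
  refine ⟨(H.spaceC1 hw hc).diff t, by simp, ?_⟩
  rw [funext fun v => (H.hasFDerivAt hw hc t v).fderiv]
  exact (((H.spaceC1_flowK hw hc).contDiff t).smul contDiff_const).add
    (((H.spaceC1_flowJ hw hc).contDiff t).smul contDiff_const)

theorem dz_flowK (H : IsVerticalFlow w h) (hw : ContDiff ℝ ∞ w) (hc : HasCompactSupport w)
    (t : ℝ) (v : V₀) : dz (flowK w h t) v = dx (flowJ w h t) v := by
  rw [← H.dx_eq hw hc, ← H.dz_eq hw hc]
  exact (dx_dz_comm isOpen_univ (H.contDiff_two hw hc t).contDiffOn (mem_univ v)).symm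

end IsVerticalFlow

/-! ### Uniform expansions in time -/

theorem SpaceC1.add {g k : ℝ → V₀ → ℝ} (hg : SpaceC1 g) (hk : SpaceC1 k) :
    SpaceC1 fun t v => g t v + k t v where
  cont := hg.cont.add hk.cont
  diff t := (hg.diff t).add (hk.diff t)
  cont_fderiv := by
    simp only [fun p : ℝ × V₀ => fderiv_fun_add (hg.diff p.1 p.2) (hk.diff p.1 p.2)]
    exact hg.cont_fderiv.add hk.cont_fderiv

section TimeDerivative

variable {g G : ℝ → V₀ → ℝ}

theorem SpaceC1.eq_integral (hG : SpaceC1 G) (h : ∀ v t, HasDerivAt (fun t => g t v) (G t v) t)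
    (t : ℝ) : g t = fun v => g 0 v + ∫ s in (0 : ℝ)..t, G s v := by
  funext v
  have hc : Continuous fun s => G s v := hG.cont.comp (by fun_prop : Continuous fun s : ℝ => (s, v))
  rw [intervalIntegral.integral_eq_sub_of_hasDerivAt (fun s _ => h v s)
    (hc.intervalIntegrable _ _)]
  ring

/-- Time and space derivatives commute: write g as its initial value plus a time integral of G,
differentiate under the integral, and apply the fundamental theorem of calculus. -/
theorem SpaceC1.hasDerivAt_dx (hG : SpaceC1 G) (hg : Differentiable ℝ (g 0))
    (h : ∀ v t, HasDerivAt (fun t => g t v) (G t v) t) (v : V₀) (t : ℝ) :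
    HasDerivAt (fun t => dx (g t) v) (dx (G t) v) t := by
  have e : ∀ t, dx (g t) v = dx (g 0) v + ∫ s in (0 : ℝ)..t, dx (G s) v := by
    intro t
    conv_lhs => rw [hG.eq_integral h t]
    rw [dx_add (hg v) (hG.integral.diff t v), hG.dx_integral]
  rw [show (fun t => dx (g t) v) = fun t => dx (g 0) v + ∫ s in (0 : ℝ)..t, dx (G s) v from funext e]
  have hc : Continuous fun s => dx (G s) v := hG.cont_dx.comp
    (by fun_prop : Continuous fun s : ℝ => (s, v))
  exact (hc.integral_hasStrictDerivAt 0 t).hasDerivAt.const_add _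

theorem SpaceC1.hasDerivAt_dz (hG : SpaceC1 G) (hg : Differentiable ℝ (g 0))
    (h : ∀ v t, HasDerivAt (fun t => g t v) (G t v) t) (v : V₀) (t : ℝ) :
    HasDerivAt (fun t => dz (g t) v) (dz (G t) v) t := by
  have e : ∀ t, dz (g t) v = dz (g 0) v + ∫ s in (0 : ℝ)..t, dz (G s) v := by
    intro t
    conv_lhs => rw [hG.eq_integral h t]
    rw [dz_add (hg v) (hG.integral.diff t v), hG.dz_integral]
  rw [show (fun t => dz (g t) v) = fun t => dz (g 0) v + ∫ s in (0 : ℝ)..t, dz (G s) v from funext e]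
  have hc : Continuous fun s => dz (G s) v := hG.cont_dz.comp
    (by fun_prop : Continuous fun s : ℝ => (s, v))
  exact (hc.integral_hasStrictDerivAt 0 t).hasDerivAt.const_add _

end TimeDerivative

/-- Boundedness, uniformly in space, for times in `[-1, 1]`. -/
def UnifBounded (g : ℝ → V₀ → ℝ) : Prop := ∃ C : ℝ, ∀ t, |t| ≤ 1 → ∀ v, |g t v| ≤ C

/-- Lipschitz continuity at time `0`, uniformly in space, for times in `[-1, 1]`. -/
def UnifLip (g : ℝ → V₀ → ℝ) : Prop := ∃ C : ℝ, ∀ t, |t| ≤ 1 → ∀ v, |g t v - g 0 v| ≤ C * |t|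

section Uniform

variable {g k G : ℝ → V₀ → ℝ}

theorem UnifBounded.mul (hg : UnifBounded g) (hk : UnifBounded k) :
    UnifBounded fun t v => g t v * k t v := by
  obtain ⟨C, hC⟩ := hg
  obtain ⟨D, hD⟩ := hk
  refine ⟨C * D, fun t ht v => ?_⟩
  rw [abs_mul]
  exact mul_le_mul (hC t ht v) (hD t ht v) (abs_nonneg _) ((abs_nonneg _).trans (hC t ht v))

theorem UnifBounded.add (hg : UnifBounded g) (hk : UnifBounded k) :
    UnifBounded fun t v => g t v + k t v := by
  obtain ⟨C, hC⟩ := hg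
  obtain ⟨D, hD⟩ := hk
  exact ⟨C + D, fun t ht v => (abs_add_le _ _).trans (add_le_add (hC t ht v) (hD t ht v))⟩

theorem UnifLip.add (hg : UnifLip g) (hk : UnifLip k) : UnifLip fun t v => g t v + k t v := by
  obtain ⟨C, hC⟩ := hg
  obtain ⟨D, hD⟩ := hk
  refine ⟨C + D, fun t ht v => ?_⟩
  rw [show g t v + k t v - (g 0 v + k 0 v) = (g t v - g 0 v) + (k t v - k 0 v) by ring, add_mul]
  exact (abs_add_le _ _).trans (add_le_add (hC t ht v) (hD t ht v))

theorem UnifLip.mul (hg : UnifLip g) (hk : UnifLip k) (hg' : UnifBounded g)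
    (hk' : UnifBounded k) : UnifLip fun t v => g t v * k t v := by
  obtain ⟨C, hC⟩ := hg
  obtain ⟨D, hD⟩ := hk
  obtain ⟨C', hC'⟩ := hg'
  obtain ⟨D', hD'⟩ := hk'
  refine ⟨C * D' + C' * D, fun t ht v => ?_⟩
  rw [show g t v * k t v - g 0 v * k 0 v =
    (g t v - g 0 v) * k t v + g 0 v * (k t v - k 0 v) by ring]
  refine (abs_add_le _ _).trans ?_
  rw [abs_mul, abs_mul]
  have h1 := hC t ht v
  have h2 := hD t ht v
  have h3 := hC' 0 (by simp) v
  have h4 := hD' t ht v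
  calc _ ≤ C * |t| * D' + C' * (D * |t|) := add_le_add
        (mul_le_mul h1 h4 (abs_nonneg _) ((abs_nonneg _).trans h1))
        (mul_le_mul h3 h2 (abs_nonneg _) ((abs_nonneg _).trans h3))
    _ = _ := by ring

theorem abs_sub_le_of_hasDerivAt {a a' : ℝ → ℝ} {C T : ℝ}
    (h : ∀ t, HasDerivAt a (a' t) t) (hC : ∀ t, |t| ≤ T → |a' t| ≤ C) {t : ℝ} (ht : |t| ≤ T) :
    |a t - a 0| ≤ C * |t| := by
  have hT : 0 ≤ T := (abs_nonneg t).trans ht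
  have := (convex_Icc (-T) T).norm_image_sub_le_of_norm_hasDerivWithin_le (f := a) (f' := a')
    (C := C) (x := 0) (y := t) (fun s _ => (h s).hasDerivWithinAt)
    (fun s hs => hC s (abs_le.2 hs)) ⟨by linarith, hT⟩ (abs_le.1 ht)
  simpa using this

theorem UnifBounded.unifLip (hG : UnifBounded G) (h : ∀ v t, HasDerivAt (fun t => g t v) (G t v) t) :
    UnifLip g := by
  obtain ⟨C, hC⟩ := hG
  exact ⟨C, fun t ht v => abs_sub_le_of_hasDerivAt (h v) (fun s hs => hC s hs v) ht⟩

theorem UnifLip.taylor (hG : UnifLip G) (h : ∀ v t, HasDerivAt (fun t => g t v) (G t v) t) :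
    ∃ C : ℝ, ∀ t, |t| ≤ 1 → ∀ v, |g t v - g 0 v - t * G 0 v| ≤ C * t ^ 2 := by
  obtain ⟨C, hC⟩ := hG
  refine ⟨max C 0, fun t ht v => ?_⟩
  have := abs_sub_le_of_hasDerivAt (a := fun s => g s v - s * G 0 v)
    (a' := fun s => G s v - G 0 v) (C := max C 0 * |t|) (T := |t|)
    (fun s => by simpa using (h v s).fun_sub ((hasDerivAt_id s).mul_const (G 0 v)))
    (fun s hs => (hC s (hs.trans ht) v).trans
      (mul_le_mul (le_max_left _ _) hs (abs_nonneg _) (le_max_right _ _))) le_rfl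
  rw [← sq_abs t, pow_two, ← mul_assoc]
  refine le_trans (le_of_eq ?_) this
  congr 1
  ring

theorem unifBounded_of_eq_const {K : Set V₀} (hK : IsCompact K)
    (hg : Continuous fun p : ℝ × V₀ => g p.1 p.2) {c : ℝ} (h : ∀ t, ∀ v ∉ K, g t v = c) :
    UnifBounded g := by
  obtain ⟨C, hC⟩ := ((isCompact_Icc (a := (-1 : ℝ)) (b := 1)).prod hK).exists_bound_of_continuousOn
    hg.continuousOn
  refine ⟨max C |c|, fun t ht v => ?_⟩
  by_cases hv : v ∈ K
  · exact (hC (t, v) ⟨abs_le.1 ht, hv⟩).trans (le_max_left _ _)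
  · rw [h t v hv]
    exact le_max_right _ _

end Uniform

namespace IsVerticalFlow

variable {w : V₀ → ℝ} {h : ℝ → V₀ → ℝ}

theorem unifBounded_comp {W : V₀ → ℝ} (hW : Continuous W) (hWc : HasCompactSupport W) :
    UnifBounded fun t v => W (v.1, h t v) := by
  obtain ⟨C, hC⟩ := hWc.exists_bound_of_continuous hW
  exact ⟨C, fun t _ v => hC _⟩

theorem unifLip_comp (H : IsVerticalFlow w h) (hw : ContDiff ℝ ∞ w) (hc : HasCompactSupport w)
    {W : V₀ → ℝ} (hW : ContDiff ℝ 1 W) (hWc : HasCompactSupport W) :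
    UnifLip fun t v => W (v.1, h t v) := by
  have hWd : ∀ v t, HasDerivAt (fun t => W (v.1, h t v))
      (dz W (v.1, h t v) * w (v.1, h t v)) t := by
    intro v t
    have h1 : HasDerivAt (fun t => ((v.1, h t v) : V₀)) (0, w (v.1, h t v)) t :=
      (hasDerivAt_const t v.1).prodMk (H.deriv v t)
    have h2 := ((hW.differentiable (by norm_num)) (v.1, h t v)).hasFDerivAt.comp_hasDerivAt t h1
    refine h2.congr_deriv ?_
    rw [fderiv_apply_eq]
    ring
  refine UnifBounded.unifLip ?_ hWd
  exact (unifBounded_comp (contDiff_dz hW (m := 0) (by simp)).continuous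
    (hasCompactSupport_dz hWc)).mul (unifBounded_comp hw.continuous hc)

variable (H : IsVerticalFlow w h) (hw : ContDiff ℝ ∞ w) (hc : HasCompactSupport w)

include H hw hc

theorem eventuallyEq_snd (t : ℝ) {v : V₀} (hv : v ∉ tsupport w) : h t =ᶠ[𝓝 v] Prod.snd := by
  filter_upwards [(isClosed_tsupport w).isOpen_compl.mem_nhds hv] with v' hv'
  exact H.eq_snd hw hc t hv'

theorem flowJ_eq_one (t : ℝ) {v : V₀} (hv : v ∉ tsupport w) : flowJ w h t v = 1 := by
  rw [← H.dz_eq hw hc, dz_congr (H.eventuallyEq_snd hw hc t hv)]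
  simp [dz, fderiv_snd]

theorem flowK_eq_zero (t : ℝ) {v : V₀} (hv : v ∉ tsupport w) : flowK w h t v = 0 := by
  rw [← H.dx_eq hw hc, dx_congr (H.eventuallyEq_snd hw hc t hv)]
  simp [dx, fderiv_snd]

theorem flowJ_eventuallyEq (t : ℝ) {v : V₀} (hv : v ∉ tsupport w) :
    flowJ w h t =ᶠ[𝓝 v] fun _ => 1 := by
  filter_upwards [(isClosed_tsupport w).isOpen_compl.mem_nhds hv] with v' hv'
  exact H.flowJ_eq_one hw hc t hv'

theorem flowK_eventuallyEq (t : ℝ) {v : V₀} (hv : v ∉ tsupport w) :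
    flowK w h t =ᶠ[𝓝 v] fun _ => 0 := by
  filter_upwards [(isClosed_tsupport w).isOpen_compl.mem_nhds hv] with v' hv'
  exact H.flowK_eq_zero hw hc t hv'

theorem dz_flowJ_eq_zero (t : ℝ) {v : V₀} (hv : v ∉ tsupport w) : dz (flowJ w h t) v = 0 := by
  rw [dz_congr (H.flowJ_eventuallyEq hw hc t hv), dz_const]

theorem dx_flowJ_eq_zero (t : ℝ) {v : V₀} (hv : v ∉ tsupport w) : dx (flowJ w h t) v = 0 := by
  rw [dx_congr (H.flowJ_eventuallyEq hw hc t hv), dx_const]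

theorem dx_flowK_eq_zero (t : ℝ) {v : V₀} (hv : v ∉ tsupport w) : dx (flowK w h t) v = 0 := by
  rw [dx_congr (H.flowK_eventuallyEq hw hc t hv), dx_const]

theorem unifBounded_flowJ : UnifBounded (flowJ w h) :=
  unifBounded_of_eq_const hc (H.continuous_flowJ hw hc) fun t _ hv => H.flowJ_eq_one hw hc t hv

theorem unifBounded_flowK : UnifBounded (flowK w h) :=
  unifBounded_of_eq_const hc (H.continuous_flowK hw hc) fun t _ hv => H.flowK_eq_zero hw hc t hv

theorem unifBounded_dz_flowJ : UnifBounded fun t => dz (flowJ w h t) :=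
  unifBounded_of_eq_const hc (H.spaceC1_flowJ hw hc).cont_dz
    fun t _ hv => H.dz_flowJ_eq_zero hw hc t hv

theorem unifBounded_dx_flowJ : UnifBounded fun t => dx (flowJ w h t) :=
  unifBounded_of_eq_const hc (H.spaceC1_flowJ hw hc).cont_dx
    fun t _ hv => H.dx_flowJ_eq_zero hw hc t hv

theorem unifBounded_dx_flowK : UnifBounded fun t => dx (flowK w h t) :=
  unifBounded_of_eq_const hc (H.spaceC1_flowK hw hc).cont_dx
    fun t _ hv => H.dx_flowK_eq_zero hw hc t hv

theorem dx_comp_flow {W : V₀ → ℝ} (hW : ContDiff ℝ 1 W) (t : ℝ) (v : V₀) :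
    dx (fun v => W (v.1, h t v)) v = dx W (v.1, h t v) + dz W (v.1, h t v) * flowK w h t v := by
  rw [dx_eq_of_hasFDerivAt ((H.spaceC1 hw hc).hasFDerivAt_comp_graph hW t v), H.dx_eq hw hc]

theorem dz_comp_flow {W : V₀ → ℝ} (hW : ContDiff ℝ 1 W) (t : ℝ) (v : V₀) :
    dz (fun v => W (v.1, h t v)) v = dz W (v.1, h t v) * flowJ w h t v := by
  rw [dz_eq_of_hasFDerivAt ((H.spaceC1 hw hc).hasFDerivAt_comp_graph hW t v), H.dz_eq hw hc]

/-- The second order expansions in time of the derivatives of the flow. -/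
theorem exists_taylor : ∃ C : ℝ, ∀ t, |t| ≤ 1 → ∀ v,
    |flowJ w h t v - 1 - t * dz w v| ≤ C * t ^ 2 ∧
    |dz (flowJ w h t) v - t * dz (dz w) v| ≤ C * t ^ 2 ∧
    |dx (flowJ w h t) v - t * dx (dz w) v| ≤ C * t ^ 2 ∧
    |dx (flowK w h t) v - t * dx (dx w) v| ≤ C * t ^ 2 := by
  have hz : ContDiff ℝ ∞ (dz w) := contDiff_dz hw (by simp)
  have hx : ContDiff ℝ ∞ (dx w) := contDiff_dx hw (by simp)
  have hzc := hasCompactSupport_dz hc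
  have hxc := hasCompactSupport_dx hc
  have hz1 : ContDiff ℝ 1 (dz w) := hz.of_le (by decide)
  have hx1 : ContDiff ℝ 1 (dx w) := hx.of_le (by decide)
  have hzz : ContDiff ℝ 1 (dz (dz w)) := contDiff_dz hz (by decide)
  have hxz : ContDiff ℝ 1 (dx (dz w)) := contDiff_dx hz (by decide)
  have hxx : ContDiff ℝ 1 (dx (dx w)) := contDiff_dx hx (by decide)
  have hzx : ContDiff ℝ 1 (dz (dx w)) := contDiff_dz hx (by decide)
  have B : ∀ {W : V₀ → ℝ}, ContDiff ℝ 1 W → HasCompactSupport W →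
      UnifBounded fun t v => W (v.1, h t v) := fun hW hWc => unifBounded_comp hW.continuous hWc
  have Li : ∀ {W : V₀ → ℝ}, ContDiff ℝ 1 W → HasCompactSupport W →
      UnifLip fun t v => W (v.1, h t v) := fun hW hWc => H.unifLip_comp hw hc hW hWc
  have bJ := H.unifBounded_flowJ hw hc
  have bK := H.unifBounded_flowK hw hc
  have bP := H.unifBounded_dz_flowJ hw hc
  have bQ := H.unifBounded_dx_flowJ hw hc
  have bR := H.unifBounded_dx_flowK hw hc
  have bz := B hz1 hzc
  have lz := Li hz1 hzc
  have lJ : UnifLip (flowJ w h) := (bz.mul bJ).unifLip (H.hasDerivAt_flowJ hw hc)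
  have lK : UnifLip (flowK w h) :=
    ((B hx1 hxc).add (bz.mul bK)).unifLip (H.hasDerivAt_flowK hw hc)
  have cJ := H.spaceC1_flowJ hw hc
  have cK := H.spaceC1_flowK hw hc
  have cz := (H.spaceC1 hw hc).comp_graph hz1
  have cx := (H.spaceC1 hw hc).comp_graph hx1
  have dJ0 : Differentiable ℝ (flowJ w h 0) := cJ.diff 0
  have dK0 : Differentiable ℝ (flowK w h 0) := cK.diff 0
  -- The evolution equations of ∂_z J, ∂_x J and ∂_x K result from differentiating the linear
  -- equations for J and K in space.
  have tP : ∀ v t, HasDerivAt (fun t => dz (flowJ w h t) v) (dz w (v.1, h t v) * dz (flowJ w h t) v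
      + flowJ w h t v * (dz (dz w) (v.1, h t v) * flowJ w h t v)) t := fun v t => by
    have := (cz.mul cJ).hasDerivAt_dz dJ0 (H.hasDerivAt_flowJ hw hc) v t
    rwa [dz_mul (cz.diff t v) (cJ.diff t v), H.dz_comp_flow hw hc hz1] at this
  have tQ : ∀ v t, HasDerivAt (fun t => dx (flowJ w h t) v) (dz w (v.1, h t v) * dx (flowJ w h t) v
      + flowJ w h t v * (dx (dz w) (v.1, h t v) + dz (dz w) (v.1, h t v) * flowK w h t v)) t :=
    fun v t => by
    have := (cz.mul cJ).hasDerivAt_dx dJ0 (H.hasDerivAt_flowJ hw hc) v t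
    rwa [dx_mul (cz.diff t v) (cJ.diff t v), H.dx_comp_flow hw hc hz1] at this
  have tR : ∀ v t, HasDerivAt (fun t => dx (flowK w h t) v)
      (dx (dx w) (v.1, h t v) + dz (dx w) (v.1, h t v) * flowK w h t v +
      (dz w (v.1, h t v) * dx (flowK w h t) v + flowK w h t v *
        (dx (dz w) (v.1, h t v) + dz (dz w) (v.1, h t v) * flowK w h t v))) t := fun v t => by
    have := (cx.add (cz.mul cK)).hasDerivAt_dx dK0 (H.hasDerivAt_flowK hw hc) v t
    rwa [dx_add (cx.diff t v) ((cz.mul cK).diff t v), dx_mul (cz.diff t v) (cK.diff t v),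
      H.dx_comp_flow hw hc hz1, H.dx_comp_flow hw hc hx1] at this
  have bzz := B hzz (hasCompactSupport_dz hzc)
  have bxz := B hxz (hasCompactSupport_dx hzc)
  have bxx := B hxx (hasCompactSupport_dx hxc)
  have bzx := B hzx (hasCompactSupport_dz hxc)
  have lzz := Li hzz (hasCompactSupport_dz hzc)
  have lxz := Li hxz (hasCompactSupport_dx hzc)
  have lxx := Li hxx (hasCompactSupport_dx hxc)
  have lzx := Li hzx (hasCompactSupport_dz hxc)
  have lP : UnifLip fun t => dz (flowJ w h t) :=
    ((bz.mul bP).add (bJ.mul (bzz.mul bJ))).unifLip tP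
  have lQ : UnifLip fun t => dx (flowJ w h t) :=
    ((bz.mul bQ).add (bJ.mul (bxz.add (bzz.mul bK)))).unifLip tQ
  have lR : UnifLip fun t => dx (flowK w h t) :=
    ((bxx.add (bzx.mul bK)).add ((bz.mul bR).add (bK.mul (bxz.add (bzz.mul bK))))).unifLip tR
  -- Boundedness of the right-hand sides made every quantity Lipschitz at time 0; hence the
  -- right-hand sides are themselves Lipschitz there, and the first order expansions have quadratic
  -- error.
  obtain ⟨C1, h1⟩ := (lz.mul lJ bz bJ).taylor (H.hasDerivAt_flowJ hw hc)
  obtain ⟨C2, h2⟩ := ((lz.mul lP bz bP).add (lJ.mul (lzz.mul lJ bzz bJ) bJ (bzz.mul bJ))).taylor tP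
  obtain ⟨C3, h3⟩ := ((lz.mul lQ bz bQ).add (lJ.mul (lxz.add (lzz.mul lK bzz bK)) bJ
    (bxz.add (bzz.mul bK)))).taylor tQ
  obtain ⟨C4, h4⟩ := ((lxx.add (lzx.mul lK bzx bK)).add ((lz.mul lR bz bR).add
    (lK.mul (lxz.add (lzz.mul lK bzz bK)) bK (bxz.add (bzz.mul bK))))).taylor tR
  have J0 : flowJ w h 0 = fun _ => 1 := funext flowJ_zero
  have K0 : flowK w h 0 = fun _ => 0 := funext flowK_zero
  refine ⟨max (max C1 C2) (max C3 C4), fun t ht v => ⟨?_, ?_, ?_, ?_⟩⟩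
  · have := h1 t ht v
    simp only [H.zero, J0, mul_one] at this
    exact this.trans (by gcongr; exact (le_max_left _ _).trans (le_max_left _ _))
  · have := h2 t ht v
    simp only [H.zero, J0, mul_one, dz_const, mul_zero, zero_add, sub_zero, one_mul] at this
    exact this.trans (by gcongr; exact (le_max_right _ _).trans (le_max_left _ _))
  · have := h3 t ht v
    simp only [H.zero, J0, K0, dx_const, mul_zero, zero_add, sub_zero, one_mul,
      add_zero] at this
    exact this.trans (by gcongr; exact (le_max_left _ _).trans (le_max_right _ _))
  · have := h4 t ht v
    simp only [H.zero, K0, dx_const, mul_zero, sub_zero, zero_mul, add_zero] at this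
    exact this.trans (by gcongr; exact (le_max_right _ _).trans (le_max_right _ _))

end IsVerticalFlow

/-! ### Integration on open sets -/

theorem integrableOn_of_continuousOn {U K : Set V₀} (hU : IsOpen U) (hK : IsCompact K) (hKU : K ⊆ U)
    {F : V₀ → ℝ} (hF : ContinuousOn F U) (h0 : ∀ v ∈ U, v ∉ K → F v = 0) : IntegrableOn F U :=
  ((hF.mono hKU).integrableOn_compact hK).of_forall_sdiff_eq_zero hU.measurableSet
    fun v hv => h0 v hv.1 hv.2

theorem integral_dx_eq_zero {q : V₀ → ℝ} (hq : ContDiff ℝ 1 q) (hc : HasCompactSupport q) :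
    ∫ v, dx q v = 0 := by
  have h1 : Integrable (dx q) := (contDiff_dx hq (m := 0) (by simp)).continuous.integrable_of_hasCompactSupport
    (hasCompactSupport_dx hc)
  have := integral_mul_fderiv_eq_neg_fderiv_mul_of_integrable (μ := (volume : Measure V₀))
    (f := fun _ : V₀ => (1 : ℝ)) (g := q) (v := (1, 0)) (by simp)
    (by simp only [one_mul]; exact h1) (by simpa using hq.continuous.integrable_of_hasCompactSupport hc)
    (fun _ _ => by fun_prop) (fun x _ => hq.differentiable (by norm_num) x)
  simpa [dx] using this

theorem integral_dz_eq_zero {q : V₀ → ℝ} (hq : ContDiff ℝ 1 q) (hc : HasCompactSupport q) :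
    ∫ v, dz q v = 0 := by
  have h1 : Integrable (dz q) := (contDiff_dz hq (m := 0) (by simp)).continuous.integrable_of_hasCompactSupport
    (hasCompactSupport_dz hc)
  have := integral_mul_fderiv_eq_neg_fderiv_mul_of_integrable (μ := (volume : Measure V₀))
    (f := fun _ : V₀ => (1 : ℝ)) (g := q) (v := (0, 1)) (by simp)
    (by simp only [one_mul]; exact h1) (by simpa using hq.continuous.integrable_of_hasCompactSupport hc)
    (fun _ _ => by fun_prop) (fun x _ => hq.differentiable (by norm_num) x)
  simpa [dz] using this

theorem dx_eq_zero_of_notMem {q : V₀ → ℝ} {v : V₀} (hv : v ∉ tsupport q) : dx q v = 0 :=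
  image_eq_zero_of_notMem_tsupport fun h => hv (tsupport_dx_subset q h)

theorem dz_eq_zero_of_notMem {q : V₀ → ℝ} {v : V₀} (hv : v ∉ tsupport q) : dz q v = 0 :=
  image_eq_zero_of_notMem_tsupport fun h => hv (tsupport_dz_subset q h)

theorem setIntegral_dx_eq_zero {U : Set V₀} {q : V₀ → ℝ} (hq : ContDiff ℝ 1 q)
    (hc : HasCompactSupport q) (hU : tsupport q ⊆ U) : ∫ v in U, dx q v = 0 := by
  rw [setIntegral_eq_integral_of_forall_compl_eq_zero, integral_dx_eq_zero hq hc]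
  exact fun v hv => dx_eq_zero_of_notMem fun h => hv (hU h)

theorem setIntegral_dz_eq_zero {U : Set V₀} {q : V₀ → ℝ} (hq : ContDiff ℝ 1 q)
    (hc : HasCompactSupport q) (hU : tsupport q ⊆ U) : ∫ v in U, dz q v = 0 := by
  rw [setIntegral_eq_integral_of_forall_compl_eq_zero, integral_dz_eq_zero hq hc]
  exact fun v hv => dz_eq_zero_of_notMem fun h => hv (hU h)

/-! ### Uniqueness of the intrinsic gradient -/

theorem IsIntrinsicGradient.locallyIntegrableOn {U : Set V₀} (hU : IsOpen U) {f θ : V₀ → ℝ}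
    (h : IsIntrinsicGradient U f θ) : LocallyIntegrableOn θ U := by
  rw [locallyIntegrableOn_iff hU.isLocallyClosed]
  intro K hKU hK
  have : IsFiniteMeasure (volume.restrict K) := ⟨by simpa using hK.measure_lt_top⟩
  exact (h.2.1 K hKU hK).integrable le_top

/-- The difference of two intrinsic gradients integrates to zero against smooth test functions.
Hence the choice made in `intrinsicGradient` does not affect the energy. -/
theorem IsIntrinsicGradient.ae_eq {U : Set V₀} (hU : IsOpen U) {f θ θ' : V₀ → ℝ}
    (h : IsIntrinsicGradient U f θ) (h' : IsIntrinsicGradient U f θ') :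
    ∀ᵐ v ∂(volume.restrict U), θ v = θ' v := by
  have hl := h.locallyIntegrableOn hU
  have hl' := h'.locallyIntegrableOn hU
  have key := hU.ae_eq_zero_of_integral_contDiff_smul_eq_zero (hl.sub hl') ?_
  · rw [ae_restrict_iff' hU.measurableSet]
    filter_upwards [key] with v hv hvU
    exact sub_eq_zero.1 (hv hvU)
  intro g hg hgc hgU
  have e1 := h.2.2 g (hg.of_le (by decide)) hgc hgU
  have e2 := h'.2.2 g (hg.of_le (by decide)) hgc hgU
  have hi : ∀ {θ : V₀ → ℝ}, LocallyIntegrableOn θ U → IntegrableOn (fun v => θ v * g v) U := by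
    intro θ hθ
    have hK := (hθ.integrableOn_compact_subset hgU hgc)
    have : IntegrableOn (fun v => θ v * g v) (tsupport g) :=
      hK.mul_continuousOn hg.continuous.continuousOn hgc
    exact this.of_forall_sdiff_eq_zero hU.measurableSet fun v hv => by
      simp [image_eq_zero_of_notMem_tsupport hv.2]
  have e3 : ∫ v in U, (θ v * g v - θ' v * g v) = 0 := by
    rw [integral_sub (hi hl) (hi hl'), e1, e2, sub_self]
  rw [← setIntegral_eq_integral_of_forall_compl_eq_zero (s := U)]
  · rw [← e3]
    congr 1
    ext v
    simp [smul_eq_mul]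
    ring
  · intro v hv
    simp [image_eq_zero_of_notMem_tsupport fun h => hv (hgU h)]

theorem IsIntrinsicGradient.energy_eq {U : Set V₀} (hU : IsOpen U) {f θ : V₀ → ℝ}
    (h : IsIntrinsicGradient U f θ) : energy U f = 1 / 2 * ∫ v in U, θ v ^ 2 := by
  have hex : ∃ θ, IsIntrinsicGradient U f θ := ⟨θ, h⟩
  have hch : IsIntrinsicGradient U f (intrinsicGradient U f) := by
    rw [intrinsicGradient, dif_pos hex]
    exact hex.choose_spec
  rw [energy]
  congr 1
  refine integral_congr_ae ?_
  filter_upwards [hch.ae_eq hU h] with v hv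
  rw [hv]

theorem IsIntrinsicGradient.mono {U U' : Set V₀} (h' : U' ⊆ U) {f θ : V₀ → ℝ}
    (h : IsIntrinsicGradient U f θ) : IsIntrinsicGradient U' f θ := by
  refine ⟨h.1.mono h', fun K hK => h.2.1 K (hK.trans h'), fun η hη hc hs => ?_⟩
  have := h.2.2 η hη hc (hs.trans h')
  have e : ∀ {F : V₀ → ℝ}, (∀ v ∉ tsupport η, F v = 0) → ∫ v in U, F v = ∫ v in U', F v := by
    intro F hF
    rw [setIntegral_eq_integral_of_forall_compl_eq_zero fun v hv => hF v fun h => hv (h' (hs h)),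
      setIntegral_eq_integral_of_forall_compl_eq_zero fun v hv => hF v fun h => hv (hs h)]
  rwa [e fun v hv => by simp [image_eq_zero_of_notMem_tsupport hv],
    e fun v hv => by simp [dx_eq_zero_of_notMem hv, dz_eq_zero_of_notMem hv]] at this

/-! ### The diffeomorphisms of `V₀` -/

/-- The flow of `w ∂_z`. -/
def flowMap (h : ℝ → V₀ → ℝ) (t : ℝ) (v : V₀) : V₀ := (v.1, h t v)

namespace IsVerticalFlow

variable {w : V₀ → ℝ} {h : ℝ → V₀ → ℝ}
variable (H : IsVerticalFlow w h) (hw : ContDiff ℝ ∞ w) (hc : HasCompactSupport w)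

include H hw hc

theorem flowMap_neg_flowMap (t : ℝ) (v : V₀) : flowMap h (-t) (flowMap h t v) = v := by
  ext
  · rfl
  · exact H.neg_apply hw hc t v

theorem flowMap_flowMap_neg (t : ℝ) (v : V₀) : flowMap h t (flowMap h (-t) v) = v := by
  simpa using H.flowMap_neg_flowMap hw hc (-t) v

theorem flowMap_eq_self (t : ℝ) {v : V₀} (hv : v ∉ tsupport w) : flowMap h t v = v := by
  ext
  · rfl
  · exact H.eq_snd hw hc t hv

theorem flowMap_mem (t : ℝ) {v : V₀} {U : Set V₀} (hU : tsupport w ⊆ U) (hv : v ∈ U) :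
    flowMap h t v ∈ U := by
  by_cases h' : flowMap h t v ∈ tsupport w
  · exact hU h'
  · have := H.flowMap_eq_self hw hc (-t) h'
    rw [H.flowMap_neg_flowMap hw hc] at this
    rwa [← this]

theorem image_flowMap (t : ℝ) {U : Set V₀} (hU : tsupport w ⊆ U) : flowMap h t '' U = U := by
  refine Subset.antisymm ?_ fun v hv => ?_
  · rintro _ ⟨v, hv, rfl⟩
    exact H.flowMap_mem hw hc t hU hv
  · exact ⟨flowMap h (-t) v, H.flowMap_mem hw hc (-t) hU hv, H.flowMap_flowMap_neg hw hc t v⟩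

theorem contDiff_flowMap (t : ℝ) : ContDiff ℝ 1 (flowMap h t) :=
  contDiff_fst.prodMk ((H.spaceC1 hw hc).contDiff t)

theorem continuous_flowMap (t : ℝ) : Continuous (flowMap h t) :=
  (H.contDiff_flowMap hw hc t).continuous

theorem hasFDerivAt_flowMap (t : ℝ) (v : V₀) : HasFDerivAt (flowMap h t)
    ((ContinuousLinearMap.fst ℝ ℝ ℝ).prod (flowK w h t v • ContinuousLinearMap.fst ℝ ℝ ℝ +
      flowJ w h t v • ContinuousLinearMap.snd ℝ ℝ ℝ)) v :=
  hasFDerivAt_fst.prodMk (H.hasFDerivAt hw hc t v)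

omit H hw hc in
theorem det_prod_smul_add_smul (a b : ℝ) : ((ContinuousLinearMap.fst ℝ ℝ ℝ).prod
    (a • ContinuousLinearMap.fst ℝ ℝ ℝ + b • ContinuousLinearMap.snd ℝ ℝ ℝ)).det = b := by
  rw [ContinuousLinearMap.det, ← LinearMap.det_toMatrix (Module.Basis.finTwoProd ℝ),
    Matrix.det_fin_two]
  simp [LinearMap.toMatrix_apply]

/-- The flow map sends U onto itself because w is supported in U. Its differential is triangular
with diagonal 1, J, so the Jacobian is J > 0. -/
theorem setIntegral_comp (t : ℝ) {U : Set V₀} (hUo : IsOpen U) (hU : tsupport w ⊆ U) (F : V₀ → ℝ) :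
    ∫ v in U, F v = ∫ v in U, flowJ w h t v * F (flowMap h t v) := by
  have hinj : InjOn (flowMap h t) U := fun a _ b _ hab => by
    rw [← H.flowMap_neg_flowMap hw hc t a, hab, H.flowMap_neg_flowMap hw hc]
  have := integral_image_eq_integral_abs_det_fderiv_smul volume hUo.measurableSet
    (fun v _ => (H.hasFDerivAt_flowMap hw hc t v).hasFDerivWithinAt) hinj F
  rw [H.image_flowMap hw hc t hU] at this
  rw [this]
  simp only [det_prod_smul_add_smul, smul_eq_mul, abs_of_pos (flowJ_pos t _)]

end IsVerticalFlow

/-! ### The contact flow with potential `w ∘ Π` -/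

theorem hasFDerivAt_proj₀ (p : H) : HasFDerivAt proj₀
    ((ContinuousLinearMap.fst ℝ ℝ (ℝ × ℝ)).prod
      ((ContinuousLinearMap.snd ℝ ℝ ℝ).comp (ContinuousLinearMap.snd ℝ ℝ (ℝ × ℝ)) -
        ((p.1 / 2) • (ContinuousLinearMap.fst ℝ ℝ ℝ).comp (ContinuousLinearMap.snd ℝ ℝ (ℝ × ℝ)) +
          (p.2.1 / 2) • ContinuousLinearMap.fst ℝ ℝ (ℝ × ℝ)))) p := by
  have h1 : HasFDerivAt (fun p : H => p.1) (ContinuousLinearMap.fst ℝ ℝ (ℝ × ℝ)) p := hasFDerivAt_fst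
  have h2 : HasFDerivAt (fun p : H => p.2) (ContinuousLinearMap.snd ℝ ℝ (ℝ × ℝ)) p := hasFDerivAt_snd
  have h3 := h1.prodMk (h2.snd.sub ((h1.mul h2.fst).mul_const (1 / 2)))
  have h4 : HasFDerivAt proj₀ _ p := h3.congr_of_eventuallyEq
    (Eventually.of_forall fun q => by ext <;> simp [proj₀]; ring)
  refine h4.congr_fderiv ?_
  ext <;> simp <;> ring

theorem fderiv_comp_proj₀ {w : V₀ → ℝ} (hw : Differentiable ℝ w) (p : H) (a b c : ℝ) :
    fderiv ℝ (w ∘ proj₀) p (a, b, c) =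
      a * dx w (proj₀ p) + (c - (p.1 * b + p.2.1 * a) / 2) * dz w (proj₀ p) := by
  rw [((hw (proj₀ p)).hasFDerivAt.comp p (hasFDerivAt_proj₀ p)).fderiv]
  rw [ContinuousLinearMap.comp_apply, ContinuousLinearMap.prod_apply, fderiv_apply_eq]
  simp [-add_right_inj, -mul_eq_mul_right_iff]
  ring

theorem derivY_comp_proj₀ {w : V₀ → ℝ} (hw : Differentiable ℝ w) (p : H) :
    derivY (w ∘ proj₀) p = 0 := by
  rw [derivY, Y, fderiv_comp_proj₀ hw]
  ring

theorem derivX_comp_proj₀ {w : V₀ → ℝ} (hw : Differentiable ℝ w) (p : H) :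
    derivX (w ∘ proj₀) p = dx w (proj₀ p) - p.2.1 * dz w (proj₀ p) := by
  rw [derivX, X, fderiv_comp_proj₀ hw]
  ring

theorem contactField_comp_proj₀ {w : V₀ → ℝ} (hw : Differentiable ℝ w) (p : H) :
    contactField (w ∘ proj₀) p = (0, p.2.1 * dz w (proj₀ p) - dx w (proj₀ p),
      (p.2.1 * dz w (proj₀ p) - dx w (proj₀ p)) * p.1 / 2 + w (proj₀ p)) := by
  rw [contactField, derivY_comp_proj₀ hw, derivX_comp_proj₀ hw]
  ext
  · simp [Y, Z]
  · simp [Y, Z]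
  · simp [Y, Z]; ring

theorem contDiff_proj₀ : ContDiff ℝ ∞ proj₀ := by
  unfold proj₀
  fun_prop

theorem proj₀_Psi (f : V₀ → ℝ) (v : V₀) : proj₀ (Psi f v) = v := by
  ext
  · simp [proj₀, Psi, mul, incl]
  · simp [proj₀, Psi, mul, incl]

theorem Psi_eq (f : V₀ → ℝ) (v : V₀) : Psi f v = (v.1, f v, v.2 + v.1 * f v / 2) := by
  simp [Psi, mul, incl]

noncomputable section

/-- The flow of the contact field with potential `w ∘ Π`. -/
def contactFlow (w : V₀ → ℝ) (h : ℝ → V₀ → ℝ) (t : ℝ) (p : H) : H :=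
  (p.1, p.2.1 * flowJ w h t (proj₀ p) - flowK w h t (proj₀ p), h t (proj₀ p) +
    p.1 * (p.2.1 * flowJ w h t (proj₀ p) - flowK w h t (proj₀ p)) / 2)

/-- The function whose graph is the image of the graph of `f` under the contact flow. -/
def variation (w : V₀ → ℝ) (h : ℝ → V₀ → ℝ) (f : V₀ → ℝ) (t : ℝ) (v : V₀) : ℝ :=
  f (flowMap h (-t) v) * flowJ w h t (flowMap h (-t) v) - flowK w h t (flowMap h (-t) v)

end

namespace IsVerticalFlow

variable {w : V₀ → ℝ} {h : ℝ → V₀ → ℝ}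
variable (H : IsVerticalFlow w h) (hw : ContDiff ℝ ∞ w) (hc : HasCompactSupport w)

theorem proj₀_contactFlow (t : ℝ) (p : Heis.H) :
    proj₀ (contactFlow w h t p) = flowMap h t (proj₀ p) := by
  ext
  · simp [proj₀, contactFlow, flowMap]
  · simp [proj₀, contactFlow, flowMap]

include H hw hc

theorem hasDerivAt_height (v : V₀) (y t : ℝ) :
    HasDerivAt (fun t => y * flowJ w h t v - flowK w h t v)
      ((y * flowJ w h t v - flowK w h t v) * dz w (v.1, h t v) - dx w (v.1, h t v)) t := by
  refine (((H.hasDerivAt_flowJ hw hc v t).const_mul y).sub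
    (H.hasDerivAt_flowK hw hc v t)).congr_deriv ?_
  ring

theorem isFlowOn_contactFlow (S : Set Heis.H) (ε : ℝ) :
    IsFlowOn (contactField (w ∘ proj₀)) S ε (contactFlow w h) := by
  intro p _
  constructor
  · ext
    · simp [contactFlow]
    · simp [contactFlow, flowJ_zero, flowK_zero]
    · simp [contactFlow, flowJ_zero, flowK_zero, H.zero, proj₀]
  · intro t _
    rw [contactField_comp_proj₀ (hw.differentiable (by simp)), proj₀_contactFlow]
    have h1 := H.hasDerivAt_height hw hc (proj₀ p) p.2.1 t
    have h2 := (hasDerivAt_const t p.1).prodMk (h1.prodMk ((H.deriv (proj₀ p) t).add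
      ((h1.const_mul p.1).div_const 2)))
    have h3 : HasDerivAt (fun s => contactFlow w h s p) _ t := h2
    refine h3.congr_deriv ?_
    simp only [contactFlow, flowMap, Prod.mk.injEq, true_and]
    simp only [proj₀]
    ring

/-- The equations are triangular: x is constant, then z - xy/2 solves the scalar equation of the
vertical flow, and then y solves a linear equation with known coefficients. Uniqueness is applied to
each in turn. -/
theorem eq_contactFlow {ε : ℝ} {φ : ℝ → Heis.H → Heis.H}
    (hφ : IsFlowOn (contactField (w ∘ proj₀)) univ ε φ) {t : ℝ} (ht : |t| < ε) :
    φ t = contactFlow w h t := by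
  funext p
  obtain ⟨h0, hd⟩ := hφ p (mem_univ p)
  have hε : 0 < ε := (abs_nonneg t).trans_lt ht
  have hmem : t ∈ Ioo (-ε) ε := abs_lt.1 ht
  have hd' : ∀ s ∈ Ioo (-ε) ε, HasDerivAt (fun s => φ s p) _ s := fun s hs => by
    have := hd s hs
    rw [contactField_comp_proj₀ (hw.differentiable (by simp))] at this
    exact this
  have hx' : ∀ s ∈ Ioo (-ε) ε, HasDerivAt (fun s => (φ s p).1) 0 s := fun s hs => by
    simpa using (hd' s hs).hasFDerivAt.fst.hasDerivAt
  have hy' : ∀ s ∈ Ioo (-ε) ε, HasDerivAt (fun s => (φ s p).2.1)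
      ((φ s p).2.1 * dz w (proj₀ (φ s p)) - dx w (proj₀ (φ s p))) s := fun s hs => by
    simpa using (hd' s hs).hasFDerivAt.snd.fst.hasDerivAt
  have hz' : ∀ s ∈ Ioo (-ε) ε, HasDerivAt (fun s => (φ s p).2.2)
      (((φ s p).2.1 * dz w (proj₀ (φ s p)) - dx w (proj₀ (φ s p))) * (φ s p).1 / 2
        + w (proj₀ (φ s p))) s := fun s hs => by
    simpa using (hd' s hs).hasFDerivAt.snd.snd.hasDerivAt
  have hx : ∀ s ∈ Ioo (-ε) ε, (φ s p).1 = p.1 := by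
    refine solution_unique (g := fun _ => 0) (K := 0) (LipschitzWith.const 0) hx'
      (fun s _ => hasDerivAt_const s p.1) ?_
    simp [h0]
  have hζ : ∀ s ∈ Ioo (-ε) ε, proj₀ (φ s p) = flowMap h s (proj₀ p) := by
    intro s hs
    have : (proj₀ (φ s p)).2 = h s (proj₀ p) := by
      refine H.eq_of_hasDerivAt hw hc (α := fun s => (proj₀ (φ s p)).2) (T := ε) ?_ ?_ s hs
      · simp [h0]
      · intro s hs
        have h1 := (hz' s hs).sub (((hx' s hs).mul (hy' s hs)).div_const 2)
        have h2 : HasDerivAt (fun s => (proj₀ (φ s p)).2) _ s := h1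
        refine h2.congr_deriv ?_
        have : proj₀ (φ s p) = ((proj₀ p).1, (proj₀ (φ s p)).2) := by
          ext
          · exact hx s hs
          · rfl
        rw [← this]
        ring
    ext
    · exact hx s hs
    · exact this
  obtain ⟨L, -, h2, -⟩ := exists_bounds hw hc
  have hdz : ∀ q, |dz w q| ≤ L := fun q => by
    have := (fderiv ℝ w q).le_of_opNorm_le (norm_fderiv_le_of_lipschitz ℝ h2) (0, 1)
    simpa [dz, Prod.norm_mk] using this
  have hy : ∀ s ∈ Ioo (-ε) ε, (φ s p).2.1 =
      p.2.1 * flowJ w h s (proj₀ p) - flowK w h s (proj₀ p) := by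
    intro s hs
    refine ODE_solution_unique_of_mem_Ioo (K := L) (t₀ := 0) (s := fun _ => univ)
      (v := fun s y => y * dz w (flowMap h s (proj₀ p)) - dx w (flowMap h s (proj₀ p)))
      (f := fun s => (φ s p).2.1) (fun s _ => ?_) ⟨by linarith, hε⟩ (fun s hs => ⟨?_, trivial⟩)
      (fun s hs => ⟨H.hasDerivAt_height hw hc _ _ _, trivial⟩) ?_ hs
    · refine LipschitzWith.lipschitzOnWith (LipschitzWith.of_dist_le_mul fun a b => ?_)
      rw [Real.dist_eq, Real.dist_eq, sub_sub_sub_cancel_right, ← sub_mul, abs_mul, mul_comm]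
      exact mul_le_mul_of_nonneg_right (hdz _) (abs_nonneg _)
    · rw [← hζ s hs]
      exact hy' s hs
    · simp [h0, flowJ_zero, flowK_zero]
  have e2 := congrArg Prod.snd (hζ t hmem)
  simp only [proj₀, flowMap, hx t hmem] at e2
  ext
  · exact hx t hmem
  · exact hy t hmem
  · simp only [contactFlow]
    rw [← hy t hmem, proj₀]
    linarith

theorem contactFlow_Psi (f : V₀ → ℝ) (t : ℝ) (v : V₀) :
    contactFlow w h t (Psi f v) = Psi (variation w h f t) (flowMap h t v) := by
  rw [Psi_eq (variation w h f t), variation, H.flowMap_neg_flowMap hw hc, contactFlow, proj₀_Psi,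
    Psi_eq]
  rfl

theorem graph_variation (f : V₀ → ℝ) (t : ℝ) {U : Set V₀} (hU : tsupport w ⊆ U) :
    graph U (variation w h f t) = contactFlow w h t '' graph U f := by
  rw [graph, graph, image_image]
  conv_lhs => rw [← H.image_flowMap hw hc t hU, image_image]
  simp only [H.contactFlow_Psi hw hc]

end IsVerticalFlow

/-! ### The intrinsic gradient and the energy of a contact variation. -/

noncomputable section

/-- The increment of the intrinsic gradient under the contact flow. -/
def gradientIncrement (w : V₀ → ℝ) (h : ℝ → V₀ → ℝ) (f : V₀ → ℝ) (t : ℝ) (v : V₀) : ℝ :=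
  2 * f v * dx (flowJ w h t) v - f v ^ 2 * dz (flowJ w h t) v - dx (flowK w h t) v

/-- The intrinsic gradient of a contact variation. -/
def variationGradient (w : V₀ → ℝ) (h : ℝ → V₀ → ℝ) (f θ : V₀ → ℝ) (t : ℝ) (v : V₀) : ℝ :=
  flowJ w h t (flowMap h (-t) v) * θ (flowMap h (-t) v) +
    gradientIncrement w h f t (flowMap h (-t) v)

/-- The derivative at time zero of the increment of the intrinsic gradient. -/
def gradientVelocity (w f : V₀ → ℝ) (v : V₀) : ℝ :=
  2 * f v * dx (dz w) v - f v ^ 2 * dz (dz w) v - dx (dx w) v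

end

namespace IsVerticalFlow

variable {w : V₀ → ℝ} {h : ℝ → V₀ → ℝ}
variable (H : IsVerticalFlow w h) (hw : ContDiff ℝ ∞ w) (hc : HasCompactSupport w)

include H hw hc

theorem continuousOn_gradientIncrement {U : Set V₀} {f : V₀ → ℝ} (hf : ContinuousOn f U) (t : ℝ) :
    ContinuousOn (gradientIncrement w h f t) U := by
  have h1 := (contDiff_dx ((H.spaceC1_flowJ hw hc).contDiff t) (m := 0) (by simp)).continuous
  have h2 := (contDiff_dz ((H.spaceC1_flowJ hw hc).contDiff t) (m := 0) (by simp)).continuous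
  have h3 := (contDiff_dx ((H.spaceC1_flowK hw hc).contDiff t) (m := 0) (by simp)).continuous
  exact (((continuousOn_const.mul hf).mul h1.continuousOn).sub
    ((hf.pow 2).mul h2.continuousOn)).sub h3.continuousOn

/-- Both integrals are pulled back by the flow map, so that the weak equation of f can be tested
with a transported function. Since f is only continuous, the chain rule behind Jθ + a is replaced by
integration by parts of terms free of f. -/
theorem weak_identity {U : Set V₀} (hU : IsOpen U) (hwU : tsupport w ⊆ U) {f θ : V₀ → ℝ}
    (hθ : IsIntrinsicGradient U f θ) (t : ℝ) {η : V₀ → ℝ} (hη : ContDiff ℝ 1 η)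
    (hηc : HasCompactSupport η) (hηU : tsupport η ⊆ U) :
    ∫ v in U, variationGradient w h f θ t v * η v =
      ∫ v in U, (-variation w h f t v * dx η v + variation w h f t v ^ 2 / 2 * dz η v) := by
  have hJ := (H.spaceC1_flowJ hw hc).contDiff t
  have hK := (H.spaceC1_flowK hw hc).contDiff t
  have dJ := hJ.differentiable (by norm_num)
  have dK := hK.differentiable (by norm_num)
  set N : V₀ → ℝ := fun v => η (flowMap h t v) with hN
  have hN1 : ContDiff ℝ 1 N := hη.comp (H.contDiff_flowMap hw hc t)
  have dN := hN1.differentiable (by norm_num)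
  have hNK : IsCompact (flowMap h (-t) '' tsupport η) :=
    hηc.image (H.continuous_flowMap hw hc (-t))
  have hNs : tsupport N ⊆ flowMap h (-t) '' tsupport η := by
    refine closure_minimal (fun v hv => ?_) hNK.isClosed
    exact ⟨flowMap h t v, subset_tsupport _ hv, H.flowMap_neg_flowMap hw hc t v⟩
  have hNU : tsupport N ⊆ U := by
    refine hNs.trans ?_
    rintro _ ⟨v, hv, rfl⟩
    exact H.flowMap_mem hw hc _ hwU (hηU hv)
  have hNc : HasCompactSupport N := hNK.of_isClosed_subset (isClosed_tsupport N) hNs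
  have dxN : ∀ v, dx N v = dx η (flowMap h t v) + dz η (flowMap h t v) * flowK w h t v :=
    fun v => H.dx_comp_flow hw hc hη t v
  have dzN : ∀ v, dz N v = dz η (flowMap h t v) * flowJ w h t v :=
    fun v => H.dz_comp_flow hw hc hη t v
  -- One factor J is the Jacobian of the change of variables, the other is the coefficient of θ in
  -- the new gradient.
  set T : V₀ → ℝ := fun v => flowJ w h t v ^ 2 * N v with hT
  have hT1 : ContDiff ℝ 1 T := (hJ.pow 2).mul hN1
  have hTs : tsupport T ⊆ tsupport N := closure_mono fun v hv hv' => hv (by simp [hT, hv'])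
  have hTc : HasCompactSupport T := hNc.of_isClosed_subset (isClosed_tsupport T) hTs
  have dxT : ∀ v, dx T v = flowJ w h t v ^ 2 * dx N v + N v * (2 * flowJ w h t v * dx (flowJ w h t) v) :=
    fun v => by rw [hT, dx_mul (by fun_prop) (by fun_prop), dx_pow_two (dJ v)]
  have dzT : ∀ v, dz T v = flowJ w h t v ^ 2 * dz N v + N v * (2 * flowJ w h t v * dz (flowJ w h t) v) :=
    fun v => by rw [hT, dz_mul (by fun_prop) (by fun_prop), dz_pow_two (dJ v)]
  -- What is left after expanding (fJ - K) and (fJ - K)² is the divergence ∂_x q₁ - ½ ∂_z q₂, thanks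
  -- to ∂_z K = ∂_x J; it integrates to zero.
  set q₁ : V₀ → ℝ := fun v => flowK w h t v * flowJ w h t v * N v with hq₁
  set q₂ : V₀ → ℝ := fun v => flowK w h t v ^ 2 * N v with hq₂
  have hq₁1 : ContDiff ℝ 1 q₁ := (hK.mul hJ).mul hN1
  have hq₂1 : ContDiff ℝ 1 q₂ := (hK.pow 2).mul hN1
  have hq₁s : tsupport q₁ ⊆ tsupport N := closure_mono fun v hv hv' => hv (by simp [hq₁, hv'])
  have hq₂s : tsupport q₂ ⊆ tsupport N := closure_mono fun v hv hv' => hv (by simp [hq₂, hv'])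
  have hq₁c : HasCompactSupport q₁ := hNc.of_isClosed_subset (isClosed_tsupport _) hq₁s
  have hq₂c : HasCompactSupport q₂ := hNc.of_isClosed_subset (isClosed_tsupport _) hq₂s
  have dxq : ∀ v, dx q₁ v = flowK w h t v * flowJ w h t v * dx N v +
      N v * (flowK w h t v * dx (flowJ w h t) v + flowJ w h t v * dx (flowK w h t) v) :=
    fun v => by rw [hq₁, dx_mul (by fun_prop) (by fun_prop), dx_mul (dK v) (dJ v)]
  have dzq : ∀ v, dz q₂ v = flowK w h t v ^ 2 * dz N v +
      N v * (2 * flowK w h t v * dx (flowJ w h t) v) :=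
    fun v => by
      rw [hq₂, dz_mul (by fun_prop) (by fun_prop), dz_pow_two (dK v), H.dz_flowK hw hc]
  have hint : ∀ {F : V₀ → ℝ}, ContinuousOn F U → (∀ v ∉ tsupport N, F v = 0) →
      IntegrableOn F U := fun hF h0 =>
    integrableOn_of_continuousOn hU hNc hNU hF fun v _ hv => h0 v hv
  have N0 : ∀ v ∉ tsupport N, N v = 0 := fun v hv => image_eq_zero_of_notMem_tsupport hv
  have Nx0 : ∀ v ∉ tsupport N, dx N v = 0 := fun v hv => dx_eq_zero_of_notMem hv
  have Nz0 : ∀ v ∉ tsupport N, dz N v = 0 := fun v hv => dz_eq_zero_of_notMem hv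
  have cf := hθ.1
  have cT := hT1.continuous
  have cTx := (contDiff_dx hT1 (m := 0) (by simp)).continuous
  have cTz := (contDiff_dz hT1 (m := 0) (by simp)).continuous
  have ca := H.continuousOn_gradientIncrement hw hc cf t
  have iθ : IntegrableOn (fun v => θ v * T v) U := by
    have h1 := (hθ.locallyIntegrableOn hU).integrableOn_compact_subset hNU hNc
    refine (h1.mul_continuousOn cT.continuousOn hNc).of_forall_sdiff_eq_zero hU.measurableSet ?_
    intro v hv
    simp [hT, N0 v hv.2]
  have ia : IntegrableOn (fun v => gradientIncrement w h f t v * (flowJ w h t v * N v)) U :=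
    hint (ca.mul (hJ.continuous.mul hN1.continuous).continuousOn) fun v hv => by simp [N0 v hv]
  have iw : IntegrableOn (fun v => -f v * dx T v + f v ^ 2 / 2 * dz T v) U :=
    hint ((cf.neg.mul cTx.continuousOn).add (((cf.pow 2).div_const 2).mul cTz.continuousOn))
      fun v hv => by simp [dxT, dzT, N0 v hv, Nx0 v hv, Nz0 v hv]
  have iq₁ : IntegrableOn (fun v => dx q₁ v) U :=
    hint (contDiff_dx hq₁1 (m := 0) (by simp)).continuous.continuousOn
      fun v hv => by simp [dxq, N0 v hv, Nx0 v hv]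
  have iq₂ : IntegrableOn (fun v => 1 / 2 * dz q₂ v) U :=
    hint (continuousOn_const.mul (contDiff_dz hq₂1 (m := 0) (by simp)).continuous.continuousOn)
      fun v hv => by simp [dzq, N0 v hv, Nz0 v hv]
  have weak := hθ.2.2 T hT1 hTc (hTs.trans hNU)
  rw [H.setIntegral_comp hw hc t hU hwU, H.setIntegral_comp hw hc t hU hwU (fun v =>
    -variation w h f t v * dx η v + variation w h f t v ^ 2 / 2 * dz η v)]
  have lhs : ∀ v, flowJ w h t v * (variationGradient w h f θ t (flowMap h t v) * η (flowMap h t v))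
      = θ v * T v + gradientIncrement w h f t v * (flowJ w h t v * N v) := by
    intro v
    rw [variationGradient, H.flowMap_neg_flowMap hw hc, hT, hN]
    ring
  have rhs : ∀ v, flowJ w h t v * (-variation w h f t (flowMap h t v) * dx η (flowMap h t v) +
      variation w h f t (flowMap h t v) ^ 2 / 2 * dz η (flowMap h t v))
      = ((-f v * dx T v + f v ^ 2 / 2 * dz T v)
        + gradientIncrement w h f t v * (flowJ w h t v * N v)) + (dx q₁ v - 1 / 2 * dz q₂ v) := by
    intro v
    rw [variation, H.flowMap_neg_flowMap hw hc, dxT, dzT, dxq, dzq, dxN, dzN, gradientIncrement]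
    ring
  simp only [lhs, rhs]
  have z₁ := setIntegral_dx_eq_zero hq₁1 hq₁c (hq₁s.trans hNU)
  have z₂ := setIntegral_dz_eq_zero hq₂1 hq₂c (hq₂s.trans hNU)
  have iwa : IntegrableOn (fun v => -f v * dx T v + f v ^ 2 / 2 * dz T v +
    gradientIncrement w h f t v * (flowJ w h t v * N v)) U := iw.add ia
  have iqq : IntegrableOn (fun v => dx q₁ v - 1 / 2 * dz q₂ v) U := iq₁.sub iq₂
  rw [integral_add iθ ia, integral_add iwa iqq, integral_add iw ia, integral_sub iq₁ iq₂, integral_const_mul, z₁, z₂, weak]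
  ring

theorem isIntrinsicGradient_variation {U : Set V₀} (hU : IsOpen U) (hwU : tsupport w ⊆ U)
    {f θ : V₀ → ℝ} (hθ : IsIntrinsicGradient U f θ) (hm : Measurable θ) {B : ℝ}
    (hB : ∀ v, |θ v| ≤ B) (t : ℝ) :
    IsIntrinsicGradient U (variation w h f t) (variationGradient w h f θ t) := by
  have hmaps : MapsTo (flowMap h (-t)) U U := fun v hv => H.flowMap_mem hw hc _ hwU hv
  have hΞ := H.continuous_flowMap hw hc (-t)
  have hJ := ((H.spaceC1_flowJ hw hc).contDiff t).continuous
  have hK := ((H.spaceC1_flowK hw hc).contDiff t).continuous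
  refine ⟨?_, fun K hKU hKc => ?_, fun η hη hηc hηU => H.weak_identity hw hc hU hwU hθ t hη hηc hηU⟩
  · exact ((hθ.1.comp hΞ.continuousOn hmaps).mul (hJ.comp hΞ).continuousOn).sub
      (hK.comp hΞ).continuousOn
  · have ca : ContinuousOn (fun v => gradientIncrement w h f t (flowMap h (-t) v)) K :=
      ((H.continuousOn_gradientIncrement hw hc hθ.1 t).comp hΞ.continuousOn hmaps).mono hKU
    have cJ : Continuous fun v => flowJ w h t (flowMap h (-t) v) := hJ.comp hΞ
    obtain ⟨C, hC⟩ := hKc.exists_bound_of_continuousOn ca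
    obtain ⟨D, hD⟩ := hKc.exists_bound_of_continuousOn cJ.continuousOn
    refine memLp_top_of_bound ?_ (D * B + C) ?_
    · exact (cJ.aestronglyMeasurable.mul (hm.comp hΞ.measurable).aestronglyMeasurable).add
        (ca.aestronglyMeasurable hKc.measurableSet)
    · rw [ae_restrict_iff' hKc.measurableSet]
      refine Eventually.of_forall fun v hv => ?_
      refine (norm_add_le _ _).trans (add_le_add ?_ (hC v hv))
      rw [norm_mul]
      exact mul_le_mul (hD v hv) (hB _) (norm_nonneg _) ((norm_nonneg _).trans (hD v hv))

end IsVerticalFlow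

/-- To first order J³ = 1 + 3tp, which gives (3/2) p θ², and the cross term J² θ a gives a₁ θ. The
error is measured by ½θ² + 1, whose integral is the energy plus the area. -/
theorem energyDensity_expansion {C t J p a a₁ θ : ℝ} (hC : 1 ≤ C) (ht : |t| ≤ 1) (hp : |p| ≤ C)
    (ha₁ : |a₁| ≤ C) (hJ : |J - 1 - t * p| ≤ C * t ^ 2) (ha : |a - t * a₁| ≤ C * t ^ 2) :
    |1 / 2 * (J * (J * θ + a) ^ 2) - 1 / 2 * θ ^ 2 - t * (a₁ * θ + 3 / 2 * p * θ ^ 2)|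
      ≤ 100 * C ^ 3 * t ^ 2 * (1 / 2 * θ ^ 2 + 1) := by
  set s := |t| with hs
  have hs0 : 0 ≤ s := abs_nonneg t
  have hst : t ^ 2 = s ^ 2 := (sq_abs t).symm
  have hC0 : 0 ≤ C := by linarith
  have hC2 : C ≤ C ^ 2 := by nlinarith
  have hC3 : C ^ 2 ≤ C ^ 3 := by nlinarith [sq_nonneg C]
  rw [hst] at hJ ha ⊢
  have hss : s ^ 2 ≤ s := by nlinarith
  set e := J - 1 with he
  set j := J - 1 - t * p with hj
  set α := a - t * a₁ with hα
  have htp : |t * p| ≤ s * C := by rw [abs_mul]; gcongr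
  have hta : |t * a₁| ≤ s * C := by rw [abs_mul]; gcongr
  have hCs : C * s ^ 2 ≤ C * s := by gcongr
  have he1 : |e| ≤ 2 * C * s := by
    have : e = t * p + j := by rw [hj, he]; ring
    rw [this]; refine (abs_add_le _ _).trans ?_; linarith
  have ha1 : |a| ≤ 2 * C * s := by
    have : a = t * a₁ + α := by rw [hα]; ring
    rw [this]; refine (abs_add_le _ _).trans ?_; linarith
  have he2 : |e| ^ 2 ≤ 4 * C ^ 2 * s ^ 2 := by
    calc |e| ^ 2 ≤ (2 * C * s) ^ 2 := by gcongr
      _ = _ := by ring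
  have he2' : |e| ≤ 2 * C := he1.trans (by nlinarith)
  have ha2 : |a| ^ 2 ≤ 4 * C ^ 2 * s ^ 2 := by
    calc |a| ^ 2 ≤ (2 * C * s) ^ 2 := by gcongr
      _ = _ := by ring
  have hea : |e| * |a| ≤ 4 * C ^ 2 * s ^ 2 := by
    calc |e| * |a| ≤ (2 * C * s) * (2 * C * s) := by gcongr
      _ = _ := by ring
  -- In powers of θ every coefficient is now of second order: j and α are the Taylor errors, and e =
  -- J - 1 and a are each O(t).
  have split : 1 / 2 * (J * (J * θ + a) ^ 2) - 1 / 2 * θ ^ 2 - t * (a₁ * θ + 3 / 2 * p * θ ^ 2)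
      = (3 * j + 3 * e ^ 2 + e ^ 3) / 2 * θ ^ 2 + (α + (2 + e) * (e * a)) * θ
        + (1 + e) * a ^ 2 / 2 := by
    rw [hj, he, hα]; ring
  rw [split]
  have hD : 0 ≤ C ^ 3 * s ^ 2 := by positivity
  have c1 : |(3 * j + 3 * e ^ 2 + e ^ 3) / 2| ≤ 12 * C ^ 3 * s ^ 2 := by
    rw [abs_div, abs_two, div_le_iff₀ two_pos]
    refine (abs_add_le _ _).trans ((add_le_add_left (abs_add_le _ _) _).trans ?_)
    rw [abs_mul, abs_mul, abs_pow, abs_pow]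
    have h3 : |e| ^ 3 ≤ 8 * C ^ 3 * s ^ 2 := by
      calc |e| ^ 3 = |e| * |e| ^ 2 := by ring
        _ ≤ 2 * C * (4 * C ^ 2 * s ^ 2) := by gcongr
        _ = _ := by ring
    have h4 : C * s ^ 2 ≤ C ^ 3 * s ^ 2 := by gcongr; linarith
    have h5 : C ^ 2 * s ^ 2 ≤ C ^ 3 * s ^ 2 := by gcongr
    rw [sq_abs] at he2
    norm_num
    linarith
  have c2 : |α + (2 + e) * (e * a)| ≤ 20 * C ^ 3 * s ^ 2 := by
    refine (abs_add_le _ _).trans ?_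
    rw [abs_mul, abs_mul]
    have h1 : |2 + e| ≤ 2 + 2 * C := (abs_add_le _ _).trans (by norm_num; exact he2')
    have h2 : |2 + e| * (|e| * |a|) ≤ (2 + 2 * C) * (4 * C ^ 2 * s ^ 2) := by gcongr
    have h4 : C * s ^ 2 ≤ C ^ 3 * s ^ 2 := by gcongr; linarith
    have h5 : C ^ 2 * s ^ 2 ≤ C ^ 3 * s ^ 2 := by gcongr
    linarith
  have c3 : |(1 + e) * a ^ 2 / 2| ≤ 6 * C ^ 3 * s ^ 2 := by
    rw [abs_div, abs_two, div_le_iff₀ two_pos, abs_mul, abs_pow]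
    have h1 : |1 + e| ≤ 1 + 2 * C := (abs_add_le _ _).trans (by norm_num; exact he2')
    have h2 : |1 + e| * |a| ^ 2 ≤ (1 + 2 * C) * (4 * C ^ 2 * s ^ 2) := by gcongr
    have h5 : C ^ 2 * s ^ 2 ≤ C ^ 3 * s ^ 2 := by gcongr
    linarith
  have hθ : |θ| ≤ 1 / 2 * θ ^ 2 + 1 := by nlinarith [sq_abs θ, sq_nonneg (|θ| - 1)]
  refine (abs_add_le _ _).trans ((add_le_add_left (abs_add_le _ _) _).trans ?_)
  rw [abs_mul, abs_mul _ θ, abs_of_nonneg (sq_nonneg θ)]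
  have m1 := mul_le_mul_of_nonneg_right c1 (sq_nonneg θ)
  have m2 := mul_le_mul c2 hθ (abs_nonneg θ) (by positivity)
  have m3 := mul_nonneg hD (sq_nonneg θ)
  linarith

theorem integrableOn_of_abs_le {U : Set V₀} (hU : IsOpen U) (hfin : volume U ≠ ⊤) {F : V₀ → ℝ}
    (hF : AEStronglyMeasurable F (volume.restrict U)) {C : ℝ} (hC : ∀ v ∈ U, |F v| ≤ C) :
    IntegrableOn F U := by
  have : IsFiniteMeasure (volume.restrict U) := ⟨by simpa using hfin.lt_top⟩
  refine Integrable.of_bound hF C ?_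
  rw [ae_restrict_iff' hU.measurableSet]
  exact Eventually.of_forall hC

theorem exists_velocity_bound {w : V₀ → ℝ} (hw : ContDiff ℝ ∞ w) (hc : HasCompactSupport w) (M : ℝ) :
    ∃ C : ℝ, ∀ f : V₀ → ℝ, ∀ v, |f v| ≤ M → |dz w v| ≤ C ∧ |gradientVelocity w f v| ≤ C := by
  have hz : ContDiff ℝ ∞ (dz w) := contDiff_dz hw (by simp)
  have hx : ContDiff ℝ ∞ (dx w) := contDiff_dx hw (by simp)
  have hzc := hasCompactSupport_dz hc
  have hxc := hasCompactSupport_dx hc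
  obtain ⟨C1, h1⟩ := hzc.exists_bound_of_continuous hz.continuous
  obtain ⟨C2, h2⟩ := (hasCompactSupport_dx hzc).exists_bound_of_continuous
    (contDiff_dx hz (m := 0) (by simp)).continuous
  obtain ⟨C3, h3⟩ := (hasCompactSupport_dz hzc).exists_bound_of_continuous
    (contDiff_dz hz (m := 0) (by simp)).continuous
  obtain ⟨C4, h4⟩ := (hasCompactSupport_dx hxc).exists_bound_of_continuous
    (contDiff_dx hx (m := 0) (by simp)).continuous
  refine ⟨max C1 (2 * M * C2 + M ^ 2 * C3 + C4), fun f v hf =>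
    ⟨(h1 v).trans (le_max_left _ _), le_trans ?_ (le_max_right _ _)⟩⟩
  have hM : 0 ≤ M := (abs_nonneg _).trans hf
  have hf2 : |f v ^ 2| ≤ M ^ 2 := by rw [abs_pow]; gcongr
  refine (abs_sub _ _).trans (add_le_add ((abs_sub _ _).trans (add_le_add ?_ ?_)) (h4 v))
  · rw [abs_mul, abs_mul, abs_two]
    have := h2 v
    rw [Real.norm_eq_abs] at this
    gcongr
  · rw [abs_mul]
    exact mul_le_mul hf2 (h3 v) (abs_nonneg _) (by positivity)

namespace IsVerticalFlow

variable {w : V₀ → ℝ} {h : ℝ → V₀ → ℝ}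
variable (H : IsVerticalFlow w h) (hw : ContDiff ℝ ∞ w) (hc : HasCompactSupport w)

include H hw hc

/-- The increment is quadratic in f with coefficients depending only on the flow, so one constant
serves all f bounded by M. This is the source of the uniformity in f. -/
theorem exists_increment_bound (M : ℝ) :
    ∃ C : ℝ, 1 ≤ C ∧ ∀ f : V₀ → ℝ, ∀ v, |f v| ≤ M → ∀ t, |t| ≤ 1 →
      |dz w v| ≤ C ∧ |gradientVelocity w f v| ≤ C ∧ |flowJ w h t v - 1 - t * dz w v| ≤ C * t ^ 2 ∧
      |gradientIncrement w h f t v - t * gradientVelocity w f v| ≤ C * t ^ 2 := by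
  obtain ⟨C1, h1⟩ := exists_velocity_bound hw hc M
  obtain ⟨C2, h2⟩ := H.exists_taylor hw hc
  refine ⟨max (max 1 C1) (max C2 (2 * M * C2 + M ^ 2 * C2 + C2)),
    (le_max_left _ _).trans (le_max_left _ _), fun f v hf t ht => ?_⟩
  obtain ⟨a1, a2⟩ := h1 f v hf
  obtain ⟨b1, b2, b3, b4⟩ := h2 t ht v
  have hM : 0 ≤ M := (abs_nonneg _).trans hf
  have hf2 : |f v ^ 2| ≤ M ^ 2 := by rw [abs_pow]; gcongr
  have hC1 : C1 ≤ max (max 1 C1) (max C2 (2 * M * C2 + M ^ 2 * C2 + C2)) :=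
    (le_max_right _ _).trans (le_max_left _ _)
  refine ⟨a1.trans hC1, a2.trans hC1, b1.trans ?_, ?_⟩
  · gcongr
    exact (le_max_left _ _).trans (le_max_right _ _)
  · calc |gradientIncrement w h f t v - t * gradientVelocity w f v|
        = |2 * f v * (dx (flowJ w h t) v - t * dx (dz w) v)
          - f v ^ 2 * (dz (flowJ w h t) v - t * dz (dz w) v)
          - (dx (flowK w h t) v - t * dx (dx w) v)| := by
          rw [gradientIncrement, gradientVelocity]; ring_nf
      _ ≤ 2 * M * (C2 * t ^ 2) + M ^ 2 * (C2 * t ^ 2) + C2 * t ^ 2 := by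
          refine (abs_sub _ _).trans (add_le_add ((abs_sub _ _).trans (add_le_add ?_ ?_)) b4)
          · rw [abs_mul, abs_mul, abs_two]
            gcongr
          · rw [abs_mul]
            exact mul_le_mul hf2 b2 (abs_nonneg _) (by positivity)
      _ = (2 * M * C2 + M ^ 2 * C2 + C2) * t ^ 2 := by ring
      _ ≤ _ := by
          gcongr
          exact (le_max_right _ _).trans (le_max_right _ _)

/-- After the change of variables both energies are integrals over the same set, and the pointwise
expansion is integrated. The bound B on θ only secures integrability; it does not enter D. -/
theorem exists_energy_expansion (M : ℝ) : ∃ D > 0, ∀ U : Set V₀, IsOpen U → tsupport w ⊆ U →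
    volume U ≠ ⊤ → ∀ f θ : V₀ → ℝ, IsIntrinsicGradient U f θ → Measurable θ →
    (∃ B, ∀ v, |θ v| ≤ B) → (∀ v ∈ U, |f v| ≤ M) → ∀ t : ℝ, |t| ≤ 1 →
      HasFiniteEnergy U (variation w h f t) ∧
      |energy U (variation w h f t) - energy U f -
        (∫ v in U, (gradientVelocity w f v * θ v + 3 / 2 * dz w v * θ v ^ 2)) * t|
        ≤ D * (energy U f + (volume U).toReal) * t ^ 2 := by
  obtain ⟨C, hC1, hC⟩ := H.exists_increment_bound hw hc M
  refine ⟨100 * C ^ 3, by positivity, ?_⟩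
  rintro U hU hwU hfin f θ hθ hm ⟨B, hB⟩ hf t ht
  have hgrad := H.isIntrinsicGradient_variation hw hc hU hwU hθ hm hB t
  have hmaps : MapsTo (flowMap h (-t)) U U := fun v hv => H.flowMap_mem hw hc _ hwU hv
  have hΞ := H.continuous_flowMap hw hc (-t)
  have hJ := ((H.spaceC1_flowJ hw hc).contDiff t).continuous
  have ca := H.continuousOn_gradientIncrement hw hc hθ.1 t
  have cv : ContinuousOn (gradientVelocity w f) U := by
    have h1 := (contDiff_dx (contDiff_dz hw (m := ∞) (by simp)) (m := 0) (by simp)).continuous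
    have h2 := (contDiff_dz (contDiff_dz hw (m := ∞) (by simp)) (m := 0) (by simp)).continuous
    have h3 := (contDiff_dx (contDiff_dx hw (m := ∞) (by simp)) (m := 0) (by simp)).continuous
    exact (((continuousOn_const.mul hθ.1).mul h1.continuousOn).sub
      ((hθ.1.pow 2).mul h2.continuousOn)).sub h3.continuousOn
  have hB0 : 0 ≤ B := (abs_nonneg _).trans (hB 0)
  have ht2 : t ^ 2 ≤ 1 := by rw [← sq_abs]; exact pow_le_one₀ (abs_nonneg t) ht
  have bJ : ∀ v ∈ U, |flowJ w h t v| ≤ 3 * C := by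
    intro v hv
    obtain ⟨a1, -, a3, -⟩ := hC f v (hf v hv) t ht
    have e : flowJ w h t v = (flowJ w h t v - 1 - t * dz w v) + (1 + t * dz w v) := by ring
    rw [e]
    refine (abs_add_le _ _).trans ?_
    have h1 : |1 + t * dz w v| ≤ 1 + 1 * C := by
      refine (abs_add_le _ _).trans ?_
      rw [abs_one, abs_mul]
      gcongr
    have h2 : C * t ^ 2 ≤ C * 1 := by gcongr
    linarith
  have ba : ∀ v ∈ U, |gradientIncrement w h f t v| ≤ 2 * C := by
    intro v hv
    obtain ⟨-, a2, -, a4⟩ := hC f v (hf v hv) t ht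
    have e : gradientIncrement w h f t v = (gradientIncrement w h f t v - t * gradientVelocity w f v)
      + t * gradientVelocity w f v := by ring
    rw [e]
    refine (abs_add_le _ _).trans ?_
    have h1 : |t * gradientVelocity w f v| ≤ 1 * C := by
      rw [abs_mul]
      gcongr
    have h2 : C * t ^ 2 ≤ C * 1 := by gcongr
    linarith
  have bsum : ∀ v ∈ U, |flowJ w h t v * θ v + gradientIncrement w h f t v| ≤ 3 * C * B + 2 * C := by
    intro v hv
    refine (abs_add_le _ _).trans (add_le_add ?_ (ba v hv))
    rw [abs_mul]
    exact mul_le_mul (bJ v hv) (hB v) (abs_nonneg _) (by positivity)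
  have mθ : AEStronglyMeasurable θ (volume.restrict U) := hm.aestronglyMeasurable
  have mJ : AEStronglyMeasurable (flowJ w h t) (volume.restrict U) := hJ.aestronglyMeasurable
  have ma := ca.aestronglyMeasurable hU.measurableSet (μ := volume)
  have mv := cv.aestronglyMeasurable hU.measurableSet (μ := volume)
  have mz : AEStronglyMeasurable (dz w) (volume.restrict U) :=
    (contDiff_dz hw (m := 0) (by simp)).continuous.aestronglyMeasurable
  have i1 : IntegrableOn (fun v => 1 / 2 * (flowJ w h t v *
      (flowJ w h t v * θ v + gradientIncrement w h f t v) ^ 2)) U := by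
    refine integrableOn_of_abs_le hU hfin ((mJ.mul (((mJ.mul mθ).add ma).pow 2)).const_mul _)
      (C := 1 / 2 * (3 * C * (3 * C * B + 2 * C) ^ 2)) fun v hv => ?_
    rw [abs_mul, abs_mul, abs_pow, abs_of_pos (by norm_num : (0 : ℝ) < 1 / 2)]
    have h1 := bJ v hv
    have h2 := bsum v hv
    exact mul_le_mul_of_nonneg_left (mul_le_mul h1 (pow_le_pow_left₀ (abs_nonneg _) h2 2)
      (by positivity) (by positivity)) (by norm_num)
  have i2 : IntegrableOn (fun v => θ v ^ 2) U := by
    refine integrableOn_of_abs_le hU hfin (mθ.pow 2) (C := B ^ 2) fun v hv => ?_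
    rw [abs_pow]
    have := hB v
    gcongr
  have i3 : IntegrableOn (fun v => gradientVelocity w f v * θ v + 3 / 2 * dz w v * θ v ^ 2) U := by
    refine integrableOn_of_abs_le hU hfin ((mv.mul mθ).add ((mz.const_mul _).mul (mθ.pow 2)))
      (C := C * B + 3 / 2 * C * B ^ 2) fun v hv => ?_
    obtain ⟨a1, a2, -, -⟩ := hC f v (hf v hv) t ht
    have := hB v
    refine (abs_add_le _ _).trans (add_le_add ?_ ?_)
    · rw [abs_mul]; gcongr
    · rw [abs_mul, abs_mul, abs_pow, abs_of_pos (by norm_num : (0 : ℝ) < 3 / 2)]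
      gcongr
  have i4 : IntegrableOn (fun v => variationGradient w h f θ t v ^ 2) U := by
    refine integrableOn_of_abs_le hU hfin ?_ (C := (3 * C * B + 2 * C) ^ 2) fun v hv => ?_
    · refine AEStronglyMeasurable.pow (AEStronglyMeasurable.add (AEStronglyMeasurable.mul ?_ ?_) ?_) 2
      · exact (hJ.comp hΞ).aestronglyMeasurable
      · exact (hm.comp hΞ.measurable).aestronglyMeasurable
      · exact (ca.comp hΞ.continuousOn hmaps).aestronglyMeasurable hU.measurableSet
    · rw [abs_pow]
      have h1 := bJ _ (hmaps hv)
      have h2 : |variationGradient w h f θ t v| ≤ 3 * C * B + 2 * C := by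
        refine (abs_add_le _ _).trans (add_le_add ?_ (ba _ (hmaps hv)))
        rw [abs_mul]
        exact mul_le_mul h1 (hB _) (abs_nonneg _) (by positivity)
      gcongr
  refine ⟨⟨_, hgrad, i4⟩, ?_⟩
  rw [hgrad.energy_eq hU, hθ.energy_eq hU, H.setIntegral_comp hw hc t hU hwU]
  simp only [variationGradient, H.flowMap_neg_flowMap hw hc]
  have i1' : IntegrableOn (fun v => 1 / 2 * (flowJ w h t v *
      (flowJ w h t v * θ v + gradientIncrement w h f t v) ^ 2) - 1 / 2 * θ v ^ 2) U :=
    i1.sub (i2.const_mul _)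
  have i3' : IntegrableOn (fun v => t * (gradientVelocity w f v * θ v + 3 / 2 * dz w v * θ v ^ 2)) U :=
    i3.const_mul _
  have i5 : IntegrableOn (fun v => 100 * C ^ 3 * t ^ 2 * (1 / 2 * θ v ^ 2 + 1)) U := by
    refine Integrable.const_mul (Integrable.add (i2.const_mul _) ?_) _
    exact integrableOn_const hfin
  have e1 : 1 / 2 * (∫ v in U, flowJ w h t v *
        (flowJ w h t v * θ v + gradientIncrement w h f t v) ^ 2) - 1 / 2 * (∫ v in U, θ v ^ 2) -
      (∫ v in U, (gradientVelocity w f v * θ v + 3 / 2 * dz w v * θ v ^ 2)) * t =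
      ∫ v in U, (1 / 2 * (flowJ w h t v *
        (flowJ w h t v * θ v + gradientIncrement w h f t v) ^ 2) - 1 / 2 * θ v ^ 2 -
        t * (gradientVelocity w f v * θ v + 3 / 2 * dz w v * θ v ^ 2)) := by
    rw [integral_sub i1' i3', integral_sub i1 (i2.const_mul _), integral_const_mul,
      integral_const_mul, integral_const_mul]
    ring
  have e2 : ∫ v in U, 100 * C ^ 3 * t ^ 2 * (1 / 2 * θ v ^ 2 + 1) =
      100 * C ^ 3 * (1 / 2 * (∫ v in U, θ v ^ 2) + (volume U).toReal) * t ^ 2 := by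
    have ic : IntegrableOn (fun _ : V₀ => (1 : ℝ)) U := integrableOn_const hfin
    rw [integral_const_mul, integral_add (i2.const_mul _) ic, integral_const_mul]
    simp [measureReal_def]
    ring
  rw [e1, ← e2]
  refine (abs_integral_le_integral_abs).trans ?_
  refine setIntegral_mono_on (i1'.sub i3').abs i5 hU.measurableSet fun v hv => ?_
  obtain ⟨a1, a2, a3, a4⟩ := hC f v (hf v hv) t ht
  exact energyDensity_expansion hC1 ht a1 a2 a3 a4

end IsVerticalFlow

/-! ### One side of the singular curve: the foliation and the intrinsic gradient. -/

/-- The part of `U` on the side `e = ±1` of the curve `z = γ(x)`. -/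
def region (U : Set V₀) (γ : ℝ → ℝ) (e : ℝ) : Set V₀ := {v ∈ U | 0 < e * (v.2 - γ v.1)}

/-- One side of a smooth herringbone singularity. -/
structure HalfHerringbone (U : Set V₀) (f : V₀ → ℝ) where
  isOpen : IsOpen U
  I : Set ℝ
  isOpen_I : IsOpen I
  γ : ℝ → ℝ
  measurable_γ : Measurable γ
  e : ℝ
  e_mul_e : e * e = 1
  K : ℝ
  K_nonneg : 0 ≤ K
  holder : IsIntrinsicHolder U f K
  curve_mem : ∀ t ∈ I, (t, γ t) ∈ U
  fst_mem : ∀ v ∈ U, v.1 ∈ I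
  contDiffOn_trace : ContDiffOn ℝ ∞ (fun t => f (t, γ t)) I
  hasDerivAt_γ : ∀ t ∈ I, HasDerivAt γ (-f (t, γ t)) t
  smooth : ContDiffOn ℝ ∞ f (region U γ e)
  N : Set H
  isOpen_N : IsOpen N
  curve_mem_N : ∀ t ∈ I, Psi f (t, γ t) ∈ N
  injOn : InjOn projXY (N ∩ graph U f)
  F : FoliationExtension f N (region U γ e)

namespace HalfHerringbone

variable {U : Set V₀} {f : V₀ → ℝ} (T : HalfHerringbone U f)

/-- The side of the curve. -/
def W : Set V₀ := region U T.γ T.e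

/-- The values of `f` on the curve. -/
def f0 (t : ℝ) : ℝ := f (t, T.γ t)

/-- The slope of the foliation along the curve. -/
def σ (t : ℝ) : ℝ := T.F.slope (t, T.f0 t)

/-- The signed height over the curve. -/
def s (v : V₀) : ℝ := v.2 - T.γ v.1

theorem mem_W {v : V₀} : v ∈ T.W ↔ v ∈ U ∧ 0 < T.e * T.s v := Iff.rfl

theorem W_subset : T.W ⊆ U := fun _ hv => hv.1

theorem e_cases : T.e = 1 ∨ T.e = -1 := mul_self_eq_one_iff.1 T.e_mul_e

theorem abs_e : |T.e| = 1 := by rcases T.e_cases with h | h <;> simp [h]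

theorem abs_s {v : V₀} (hv : v ∈ T.W) : |T.s v| = T.e * T.s v := by
  rw [← abs_of_pos (T.mem_W.1 hv).2, abs_mul, T.abs_e, one_mul]

theorem contDiffOn_γ : ContDiffOn ℝ ∞ T.γ T.I := by
  rw [contDiffOn_infty_iff_deriv_of_isOpen T.isOpen_I]
  refine ⟨fun t ht => (T.hasDerivAt_γ t ht).differentiableAt.differentiableWithinAt, ?_⟩
  exact T.contDiffOn_trace.neg.congr fun t ht => (T.hasDerivAt_γ t ht).deriv

include T in
theorem continuousOn_f : ContinuousOn f U :=
  IsIntrinsicHolder.continuousOn T.holder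

theorem contDiffOn_comp_fst {a : ℝ → ℝ} (ha : ContDiffOn ℝ ∞ a T.I) :
    ContDiffOn ℝ ∞ (fun v : V₀ => a v.1) U :=
  ha.comp contDiff_fst.contDiffOn T.fst_mem

theorem contDiffOn_s : ContDiffOn ℝ ∞ T.s U :=
  contDiff_snd.contDiffOn.sub (T.contDiffOn_comp_fst T.contDiffOn_γ)

theorem isOpen_W : IsOpen T.W :=
  (T.contDiffOn_s.continuousOn.const_smul T.e).isOpen_inter_preimage T.isOpen isOpen_Ioi

theorem hasFDerivAt_s {v : V₀} (hv : v ∈ U) : HasFDerivAt T.s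
    (T.f0 v.1 • ContinuousLinearMap.fst ℝ ℝ ℝ + (1 : ℝ) • ContinuousLinearMap.snd ℝ ℝ ℝ) v := by
  have h := hasFDerivAt_snd (𝕜 := ℝ) (p := v) |>.sub
    (hasFDerivAt_comp_fst (T.hasDerivAt_γ v.1 (T.fst_mem v hv)))
  refine h.congr_fderiv ?_
  ext <;> simp [f0]

theorem continuousAt_shear {t : ℝ} (ht : t ∈ T.I) :
    ContinuousAt (fun p : ℝ × ℝ => ((p.1, T.γ p.1 + p.2) : V₀)) (t, 0) := by
  have : ContinuousAt T.γ t := (T.hasDerivAt_γ t ht).continuousAt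
  have h2 : ContinuousAt (fun p : ℝ × ℝ => T.γ p.1) (t, 0) :=
    ContinuousAt.comp (f := Prod.fst) (g := T.γ) this continuousAt_fst
  exact continuousAt_fst.prodMk (h2.add continuousAt_snd)

/-- A box around a point of the curve. -/
theorem exists_box {t : ℝ} (ht : t ∈ T.I) {O : Set V₀} (hO : O ∈ 𝓝 ((t, T.γ t) : V₀)) :
    ∃ r > 0, ∀ x z : ℝ, |x - t| < r → |z - T.γ x| < r → (x, z) ∈ O := by
  have h := T.continuousAt_shear ht
  have hO' : O ∈ 𝓝 ((fun p : ℝ × ℝ => ((p.1, T.γ p.1 + p.2) : V₀)) (t, 0)) := by simpa using hO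
  obtain ⟨r, hr, h'⟩ := Metric.eventually_nhds_iff.1 (h hO')
  refine ⟨r, hr, fun x z hx hz => ?_⟩
  have := @h' (x, z - T.γ x) (by simpa [Prod.dist_eq, Real.dist_eq] using ⟨hx, hz⟩)
  simpa using this

theorem tendsto_curve {t : ℝ} (ht : t ∈ T.I) :
    Tendsto (fun s => ((t, T.γ t + T.e * s) : V₀)) (𝓝[>] 0) (𝓝[T.W] (t, T.γ t)) := by
  have h1 : Tendsto (fun s => ((t, T.γ t + T.e * s) : V₀)) (𝓝[>] 0) (𝓝 (t, T.γ t)) := by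
    have : Continuous (fun s => ((t, T.γ t + T.e * s) : V₀)) := by fun_prop
    simpa using (this.tendsto 0).mono_left nhdsWithin_le_nhds
  refine tendsto_nhdsWithin_iff.2 ⟨h1, ?_⟩
  filter_upwards [h1 (T.isOpen.mem_nhds (T.curve_mem t ht)), self_mem_nhdsWithin] with s hs hs0
  refine T.mem_W.2 ⟨hs, ?_⟩
  have : T.e * T.s (t, T.γ t + T.e * s) = s := by
    simp only [HalfHerringbone.s]
    linear_combination s * T.e_mul_e
  rw [this]
  exact hs0

include T in
theorem continuousOn_Psi : ContinuousOn (Psi f) U := by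
  have : Psi f = fun v => (v.1, f v, v.2 + v.1 * f v / 2) := funext (Psi_eq f)
  rw [this]
  have := T.continuousOn_f
  fun_prop

theorem projXY_Psi (v : V₀) : projXY (Psi f v) = (v.1, f v) := by simp [Psi_eq, projXY]

/-- A point of the curve does not lie in `T.W`, but is a limit of points of `T.W` along a vertical
segment; the domain of the foliation contains the closure. -/
theorem mem_dom {t : ℝ} (ht : t ∈ T.I) : (t, T.f0 t) ∈ T.F.dom := by
  refine T.F.closure_subset ?_
  have hU := T.isOpen.mem_nhds (T.curve_mem t ht)
  have hf : ContinuousAt (fun v : V₀ => ((v.1, f v) : ℝ × ℝ)) (t, T.γ t) :=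
    continuousAt_fst.prodMk (T.continuousOn_f.continuousAt hU)
  have hN := (T.continuousOn_Psi.continuousAt hU) (T.isOpen_N.mem_nhds (T.curve_mem_N t ht))
  have hc := T.tendsto_curve ht
  refine mem_closure_of_tendsto (hf.tendsto.comp (hc.mono_right nhdsWithin_le_nhds)) ?_
  filter_upwards [hc.eventually self_mem_nhdsWithin,
    (hc.mono_right nhdsWithin_le_nhds).eventually hN] with s h1 h2
  exact ⟨_, ⟨h2, mem_image_of_mem _ h1⟩, projXY_Psi _⟩

/-- A neighbourhood of the curve on which the foliation gives the intrinsic gradient. -/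
def collar : Set V₀ := {v ∈ U | Psi f v ∈ T.N ∧ (v.1, f v) ∈ T.F.dom}

theorem isOpen_collar : IsOpen T.collar := by
  have h := (T.continuousOn_Psi.isOpen_inter_preimage T.isOpen T.isOpen_N).inter
    ((continuous_fst.continuousOn.prodMk T.continuousOn_f).isOpen_inter_preimage T.isOpen
      T.F.isOpen_dom)
  convert h using 1
  ext v
  simp [collar]

theorem curve_mem_collar {t : ℝ} (ht : t ∈ T.I) : (t, T.γ t) ∈ T.collar :=
  ⟨T.curve_mem t ht, T.curve_mem_N t ht, T.mem_dom ht⟩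

theorem nabla_eq {v : V₀} (hv : v ∈ T.collar) (hW : v ∈ T.W) :
    nabla f f v = T.F.slope (v.1, f v) := by
  rw [← projXY_Psi, T.F.extends_horizontal v hW hv.2.1]

theorem differentiableAt_f {v : V₀} (hv : v ∈ T.W) : DifferentiableAt ℝ f v :=
  (T.smooth.contDiffAt (T.isOpen_W.mem_nhds hv)).differentiableAt (by simp)

theorem contDiffOn_dx_f : ContDiffOn ℝ ∞ (dx f) T.W := contDiffOn_dx T.isOpen_W T.smooth (by simp)

theorem contDiffOn_dz_f : ContDiffOn ℝ ∞ (dz f) T.W := contDiffOn_dz T.isOpen_W T.smooth (by simp)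

theorem contDiffOn_nabla {g : V₀ → ℝ} (hg : ContDiffOn ℝ ∞ g T.W) : ContDiffOn ℝ ∞ (nabla f g) T.W :=
  (contDiffOn_dx T.isOpen_W hg (by simp)).sub
    (T.smooth.mul (contDiffOn_dz T.isOpen_W hg (by simp)))

/-- Near the curve θ = m(x, f) with m the slope function, so the chain rule gives ∇_f θ = m_x + m_y
∇_f f = m_x + m_y m. No ∂_z f survives, which is why ∇_f² f stays bounded up to the curve. -/
theorem nabla_nabla_eq {v : V₀} (hv : v ∈ T.collar) (hW : v ∈ T.W) :
    nabla f (nabla f f) v = dx T.F.slope (v.1, f v) + dz T.F.slope (v.1, f v) * T.F.slope (v.1, f v) := by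
  have hm : DifferentiableAt ℝ T.F.slope (v.1, f v) :=
    (T.F.smooth.contDiffAt (T.F.isOpen_dom.mem_nhds hv.2.2)).differentiableAt (by simp)
  have he : nabla f f =ᶠ[𝓝 v] fun v => T.F.slope (v.1, f v) := by
    filter_upwards [T.isOpen_collar.mem_nhds hv, T.isOpen_W.mem_nhds hW] with w h1 h2
    exact T.nabla_eq h1 h2
  have hd : HasFDerivAt (fun v : V₀ => T.F.slope (v.1, f v))
      ((fderiv ℝ T.F.slope (v.1, f v)).comp
        ((ContinuousLinearMap.fst ℝ ℝ ℝ).prod (fderiv ℝ f v))) v :=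
    hm.hasFDerivAt.comp (f := fun v : V₀ => (v.1, f v)) v
      (hasFDerivAt_fst.prodMk (T.differentiableAt_f hW).hasFDerivAt)
  have e1 : dx (nabla f f) v = dx T.F.slope (v.1, f v) + dx f v * dz T.F.slope (v.1, f v) := by
    rw [dx_congr he, dx, hd.fderiv]
    simp only [ContinuousLinearMap.comp_apply, ContinuousLinearMap.prod_apply,
      ContinuousLinearMap.coe_fst']
    rw [fderiv_apply_eq]
    simp [dx]
  have e2 : dz (nabla f f) v = dz f v * dz T.F.slope (v.1, f v) := by
    rw [dz_congr he, dz, hd.fderiv]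
    simp only [ContinuousLinearMap.comp_apply, ContinuousLinearMap.prod_apply,
      ContinuousLinearMap.coe_fst']
    rw [fderiv_apply_eq]
    simp [dz]
  rw [← T.nabla_eq hv hW, nabla, e1, e2, nabla]
  ring

theorem tendsto_pair {t : ℝ} (ht : t ∈ T.I) :
    Tendsto (fun v : V₀ => ((v.1, f v) : ℝ × ℝ)) (𝓝 (t, T.γ t)) (𝓝 (t, T.f0 t)) :=
  continuousAt_fst.prodMk (T.continuousOn_f.continuousAt (T.isOpen.mem_nhds (T.curve_mem t ht)))

theorem eventually_collar {t : ℝ} (ht : t ∈ T.I) :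
    ∀ᶠ v in 𝓝[T.W] ((t, T.γ t) : V₀), v ∈ T.collar ∧ v ∈ T.W :=
  (eventually_nhdsWithin_of_eventually_nhds
    (T.isOpen_collar.mem_nhds (T.curve_mem_collar ht))).and self_mem_nhdsWithin

theorem contDiffAt_slope {t : ℝ} (ht : t ∈ T.I) : ContDiffAt ℝ ∞ T.F.slope (t, T.f0 t) :=
  T.F.smooth.contDiffAt (T.F.isOpen_dom.mem_nhds (T.mem_dom ht))

theorem tendsto_nabla {t : ℝ} (ht : t ∈ T.I) :
    Tendsto (nabla f f) (𝓝[T.W] (t, T.γ t)) (𝓝 (T.σ t)) := by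
  have h := (T.contDiffAt_slope ht).continuousAt.tendsto.comp
    ((T.tendsto_pair ht).mono_left (nhdsWithin_le_nhds (s := T.W)))
  refine h.congr' ?_
  filter_upwards [T.eventually_collar ht] with v hv
  exact (T.nabla_eq hv.1 hv.2).symm

theorem contDiffOn_σ : ContDiffOn ℝ ∞ T.σ T.I :=
  T.F.smooth.comp (contDiff_id.contDiffOn.prodMk T.contDiffOn_trace) fun _ ht => T.mem_dom ht

theorem abs_nabla_le {v : V₀} (hv : v ∈ T.W) : |nabla f f v| ≤ T.K :=
  IsIntrinsicHolder.abs_nabla_le T.isOpen T.K_nonneg T.holder (T.W_subset hv)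

theorem abs_sub_trace_le {v : V₀} (hv : v ∈ U) : |f v - T.f0 v.1| ≤ T.K * √|T.s v| :=
  IsIntrinsicHolder.abs_sub_le T.holder (T.curve_mem _ (T.fst_mem v hv)) hv

end HalfHerringbone

/-! ### Estimates up to the singular curve. -/

/-- Lebesgue's theorem on monotone functions: the derivative exists almost everywhere and its
integral is at most the increment, without absolute continuity. -/
theorem integral_abs_deriv_le {h : ℝ → ℝ} {a b : ℝ} (hab : a ≤ b)
    (hm : MonotoneOn h (Icc a b) ∨ AntitoneOn h (Icc a b)) :
    IntegrableOn (deriv h) (Ioo a b) ∧ ∫ x in Ioo a b, |deriv h x| ≤ |h b - h a| := by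
  have key : ∀ {h : ℝ → ℝ}, MonotoneOn h (Icc a b) →
      IntegrableOn (deriv h) (Ioo a b) ∧ ∫ x in Ioo a b, |deriv h x| ≤ |h b - h a| := by
    intro h hm
    have hm' : MonotoneOn h (uIcc a b) := by rwa [uIcc_of_le hab]
    have h1 := hm'.intervalIntegrable_deriv
    have h2 := hm'.intervalIntegral_deriv_mem_uIcc
    have h3 : h a ≤ h b := hm (left_mem_Icc.2 hab) (right_mem_Icc.2 hab) hab
    rw [uIcc_of_le (by linarith), intervalIntegral.integral_of_le hab,
      ← integral_Icc_eq_integral_Ioc, integral_Icc_eq_integral_Ioo] at h2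
    refine ⟨((intervalIntegrable_iff_integrableOn_Ioo_of_le hab).1 h1), ?_⟩
    rw [abs_of_nonneg (by linarith : 0 ≤ h b - h a)]
    refine le_trans (le_of_eq (setIntegral_congr_fun measurableSet_Ioo fun x hx => ?_)) h2.2
    refine abs_of_nonneg ?_
    rw [← derivWithin_of_mem_nhds (Icc_mem_nhds hx.1 hx.2)]
    exact hm.derivWithin_nonneg
  rcases hm with hm | hm
  · exact key hm
  · have := key hm.neg
    simp only [deriv.fun_neg', abs_neg] at this
    refine ⟨by simpa using this.1.neg, this.2.trans (le_of_eq ?_)⟩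
    rw [← abs_neg]
    congr 1
    ring

namespace HalfHerringbone

variable {U : Set V₀} {f : V₀ → ℝ} (T : HalfHerringbone U f)

/-- A point of Q lies in `T.W`, on the curve, or strictly on the other side. In the last case a
neighbourhood misses `T.W`, so only the first two need an argument. -/
theorem induction_on_compact {Q : Set V₀} (hQ : IsCompact Q) (hQU : Q ⊆ U) {p : Set V₀ → Prop}
    (h0 : p ∅) (hmono : ∀ s t, s ⊆ t → p t → p s) (hunion : ∀ s t, p s → p t → p (s ∪ t))
    (hW : ∀ v ∈ T.W, ∃ o ∈ 𝓝 v, p (o ∩ T.W))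
    (hc : ∀ t ∈ T.I, ∃ o ∈ 𝓝 ((t, T.γ t) : V₀), p (o ∩ T.W)) : p (Q ∩ T.W) := by
  refine hQ.induction_on (p := fun s => p (s ∩ T.W)) (by simpa using h0)
    (fun s t hst => hmono _ _ (inter_subset_inter_left _ hst))
    (fun s t hs ht => by rw [union_inter_distrib_right]; exact hunion _ _ hs ht) fun v hv => ?_
  have hvU := hQU hv
  rcases lt_trichotomy 0 (T.e * T.s v) with h | h | h
  · obtain ⟨o, ho, hp⟩ := hW v ⟨hvU, h⟩
    exact ⟨o, mem_nhdsWithin_of_mem_nhds ho, hp⟩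
  · have he : T.e ≠ 0 := fun h => by simpa [h] using T.e_mul_e
    have hs : v.2 - T.γ v.1 = 0 := by
      rcases mul_eq_zero.1 h.symm with h | h
      exacts [absurd h he, h]
    obtain ⟨o, ho, hp⟩ := hc v.1 (T.fst_mem v hvU)
    rw [show (v.1, T.γ v.1) = v from Prod.ext rfl (by simp; linarith)] at ho
    exact ⟨o, mem_nhdsWithin_of_mem_nhds ho, hp⟩
  · have hopen : IsOpen (U ∩ (fun v => T.e * T.s v) ⁻¹' Iio 0) :=
      (T.contDiffOn_s.continuousOn.const_smul T.e).isOpen_inter_preimage T.isOpen isOpen_Iio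
    refine ⟨_, mem_nhdsWithin_of_mem_nhds (hopen.mem_nhds ⟨hvU, h⟩), ?_⟩
    convert h0
    rw [← disjoint_iff_inter_eq_empty, Set.disjoint_left]
    rintro w ⟨-, h1⟩ h2
    have h1' : T.e * T.s w < 0 := h1
    linarith [(T.mem_W.1 h2).2]

/-- Inside `T.W` the quotient |G| / k is continuous, hence locally bounded; compactness reduces the
estimate to neighbourhoods of curve points. -/
theorem exists_bound_of_locally {Q : Set V₀} (hQ : IsCompact Q) (hQU : Q ⊆ U) {G k : V₀ → ℝ}
    (hG : ContinuousOn G T.W) (hk : ContinuousOn k T.W) (hk0 : ∀ v ∈ T.W, 0 < k v)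
    (hc : ∀ t ∈ T.I, ∃ C, ∀ᶠ v in 𝓝[T.W] ((t, T.γ t) : V₀), |G v| ≤ C * k v) :
    ∃ C, 0 ≤ C ∧ ∀ v ∈ Q ∩ T.W, |G v| ≤ C * k v := by
  have hev : ∀ v : V₀, (∃ C, ∀ᶠ w in 𝓝[T.W] v, |G w| ≤ C * k w) →
      ∃ o ∈ 𝓝 v, ∃ C, 0 ≤ C ∧ ∀ w ∈ o ∩ T.W, w ∈ T.W → |G w| ≤ C * k w := by
    rintro v ⟨C, hC⟩
    obtain ⟨o, ho, h⟩ := mem_nhdsWithin_iff_exists_mem_nhds_inter.1 hC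
    exact ⟨o, ho, max C 0, le_max_right _ _, fun w hw _ => (h hw : |G w| ≤ C * k w).trans
      (mul_le_mul_of_nonneg_right (le_max_left _ _) (hk0 w hw.2).le)⟩
  -- Membership in `T.W` is repeated inside the predicate because the induction passes through
  -- arbitrary sets, while enlarging the constant requires k > 0.
  suffices h : ∃ C, 0 ≤ C ∧ ∀ v ∈ Q ∩ T.W, v ∈ T.W → |G v| ≤ C * k v by
    obtain ⟨C, hC0, hC⟩ := h
    exact ⟨C, hC0, fun v hv => hC v hv hv.2⟩
  refine T.induction_on_compact hQ hQU
    (p := fun s => ∃ C, 0 ≤ C ∧ ∀ v ∈ s, v ∈ T.W → |G v| ≤ C * k v) ⟨0, le_rfl, by simp⟩ ?_ ?_ ?_ ?_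
  · rintro s t hst ⟨C, hC0, hC⟩
    exact ⟨C, hC0, fun v hv => hC v (hst hv)⟩
  · intro s t hs ht
    obtain ⟨C, hC0, hC⟩ := hs
    obtain ⟨C', hC0', hC'⟩ := ht
    refine ⟨max C C', le_max_of_le_left hC0, fun v hv hW => ?_⟩
    rcases hv with hv | hv
    · exact (hC v hv hW).trans (mul_le_mul_of_nonneg_right (le_max_left _ _) (hk0 v hW).le)
    · exact (hC' v hv hW).trans (mul_le_mul_of_nonneg_right (le_max_right _ _) (hk0 v hW).le)
  · intro v hv
    refine hev v ?_
    have h1 : ContinuousAt (fun w => |G w| / k w) v :=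
      (hG.abs.continuousAt (T.isOpen_W.mem_nhds hv)).div (hk.continuousAt (T.isOpen_W.mem_nhds hv))
        (hk0 v hv).ne'
    refine ⟨|G v| / k v + 1, ?_⟩
    filter_upwards [nhdsWithin_le_nhds (h1.eventually (gt_mem_nhds (lt_add_one _))),
      self_mem_nhdsWithin] with w hw hwW
    exact ((div_lt_iff₀ (hk0 w hwW)).1 hw).le
  · exact fun t ht => hev _ (hc t ht)

theorem exists_nabla_nabla_bound {Q : Set V₀} (hQ : IsCompact Q) (hQU : Q ⊆ U) :
    ∃ C, 0 ≤ C ∧ ∀ v ∈ Q ∩ T.W, |nabla f (nabla f f) v| ≤ C := by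
  have := T.exists_bound_of_locally hQ hQU (G := nabla f (nabla f f)) (k := fun _ => 1)
    (T.contDiffOn_nabla (T.contDiffOn_nabla T.smooth)).continuousOn continuousOn_const
    (fun _ _ => one_pos) fun t ht => ?_
  · simpa using this
  · have hm := T.F.smooth
    have hO := T.F.isOpen_dom
    have hmem := hO.mem_nhds (T.mem_dom ht)
    have h1 : ContinuousAt (fun p => dx T.F.slope p + dz T.F.slope p * T.F.slope p) (t, T.f0 t) :=
      ((contDiffOn_dx hO hm (m := 0) (by simp)).continuousOn.continuousAt hmem).add
        (((contDiffOn_dz hO hm (m := 0) (by simp)).continuousOn.continuousAt hmem).mul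
          (hm.continuousOn.continuousAt hmem))
    have h2 := (h1.tendsto.comp (T.tendsto_pair ht)).abs.mono_left
      (nhdsWithin_le_nhds (s := T.W))
    refine ⟨|dx T.F.slope (t, T.f0 t) + dz T.F.slope (t, T.f0 t) * T.F.slope (t, T.f0 t)| + 1, ?_⟩
    filter_upwards [h2.eventually (gt_mem_nhds (lt_add_one _)), T.eventually_collar ht] with v h3 h4
    rw [T.nabla_nabla_eq h4.1 h4.2, mul_one]
    exact h3.le

/-- The oscillation of the gradient near the curve. -/
theorem exists_gradient_bound {Q : Set V₀} (hQ : IsCompact Q) (hQU : Q ⊆ U) :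
    ∃ C, 0 ≤ C ∧ ∀ v ∈ Q ∩ T.W,
      |(nabla f f v - T.σ v.1) * (f v - T.f0 v.1)| ≤ C * |T.s v| := by
  have hσ := (T.contDiffOn_comp_fst T.contDiffOn_σ).mono T.W_subset
  have hf0 := (T.contDiffOn_comp_fst T.contDiffOn_trace).mono T.W_subset
  refine T.exists_bound_of_locally hQ hQU
    (((T.contDiffOn_nabla T.smooth).sub hσ).mul (T.smooth.sub hf0)).continuousOn
    (T.contDiffOn_s.continuousOn.mono T.W_subset).abs
    (fun v hv => by rw [T.abs_s hv]; exact (T.mem_W.1 hv).2) fun t ht => ?_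
  obtain ⟨C, O, hO, hC⟩ := ((T.contDiffAt_slope ht).of_le
    (by decide : (1 : WithTop ℕ∞) ≤ ∞)).exists_lipschitzOnWith
  have h1 := (T.tendsto_pair ht).eventually hO
  have h2 : Tendsto (fun v : V₀ => ((v.1, T.f0 v.1) : ℝ × ℝ)) (𝓝 (t, T.γ t)) (𝓝 (t, T.f0 t)) := by
    have h3 : ContinuousAt T.f0 t :=
      T.contDiffOn_trace.continuousOn.continuousAt (T.isOpen_I.mem_nhds ht)
    exact continuousAt_fst.prodMk (ContinuousAt.comp (f := Prod.fst) (g := T.f0)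
      (x := ((t, T.γ t) : V₀)) h3 continuousAt_fst)
  refine ⟨C * T.K ^ 2, ?_⟩
  filter_upwards [eventually_nhdsWithin_of_eventually_nhds h1,
    eventually_nhdsWithin_of_eventually_nhds (h2.eventually hO), T.eventually_collar ht]
    with v ha hb hv
  have hu := T.abs_sub_trace_le (T.W_subset hv.2)
  -- θ and σ are values of the same smooth slope function at (x, f) and (x, f₀). With the Hölder
  -- bound the product becomes O(|f - f₀|²) = O(|s|).
  have hl : |nabla f f v - T.σ v.1| ≤ C * |f v - T.f0 v.1| := by
    have := hC.dist_le_mul _ ha _ hb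
    rw [T.nabla_eq hv.1 hv.2, σ]
    simpa [Prod.dist_eq, Real.dist_eq] using this
  have hs : (T.K * √|T.s v|) ^ 2 = T.K ^ 2 * |T.s v| := by
    rw [mul_pow, Real.sq_sqrt (abs_nonneg _)]
  rw [abs_mul]
  calc |nabla f f v - T.σ v.1| * |f v - T.f0 v.1|
      ≤ C * |f v - T.f0 v.1| * |f v - T.f0 v.1| := by gcongr
    _ = C * |f v - T.f0 v.1| ^ 2 := by ring
    _ ≤ C * (T.K * √|T.s v|) ^ 2 := by gcongr
    _ = C * T.K ^ 2 * |T.s v| := by rw [hs]; ring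

/-- Near the curve the graph is monotone along vertical lines. -/
theorem exists_monotone_box {t : ℝ} (ht : t ∈ T.I) : ∃ r > 0,
    (∀ x z : ℝ, |x - t| < r → |z - T.γ x| ≤ r → (x, z) ∈ U) ∧
    ∀ x, |x - t| < r → MonotoneOn (fun z => f (x, z)) (Icc (T.γ x - r) (T.γ x + r)) ∨
      AntitoneOn (fun z => f (x, z)) (Icc (T.γ x - r) (T.γ x + r)) := by
  have hO : U ∩ Psi f ⁻¹' T.N ∈ 𝓝 ((t, T.γ t) : V₀) :=
    (T.continuousOn_Psi.isOpen_inter_preimage T.isOpen T.isOpen_N).mem_nhds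
      ⟨T.curve_mem t ht, T.curve_mem_N t ht⟩
  obtain ⟨r, hr, hbox⟩ := T.exists_box ht hO
  refine ⟨r / 2, by positivity, fun x z hx hz => (hbox x z (by linarith) (by linarith)).1,
    fun x hx => ?_⟩
  have hmem : ∀ z ∈ Icc (T.γ x - r / 2) (T.γ x + r / 2), (x, z) ∈ U ∩ Psi f ⁻¹' T.N :=
    fun z hz => hbox x z (by linarith) (by rw [abs_lt]; constructor <;> linarith [hz.1, hz.2])
  -- Points of the graph over a vertical line share the coordinate x, so injectivity of π forces z ↦
  -- f(x, z) to be injective; a continuous injective function on an interval is strictly monotone.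
  have hinj : InjOn (fun z => f (x, z)) (Icc (T.γ x - r / 2) (T.γ x + r / 2)) := by
    intro z hz z' hz' h
    have h1 := T.injOn ⟨(hmem z hz).2, mem_image_of_mem _ (hmem z hz).1⟩
      ⟨(hmem z' hz').2, mem_image_of_mem _ (hmem z' hz').1⟩
      (by rw [projXY_Psi, projXY_Psi]; exact Prod.ext rfl h)
    have h2 := congrArg proj₀ h1
    rw [proj₀_Psi, proj₀_Psi] at h2
    exact (Prod.ext_iff.1 h2).2
  have hcont : ContinuousOn (fun z => f (x, z)) (Icc (T.γ x - r / 2) (T.γ x + r / 2)) :=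
    T.continuousOn_f.comp (by fun_prop) fun z hz => (hmem z hz).1
  exact (hcont.strictMonoOn_of_injOn_Icc' (by linarith) hinj).imp StrictMonoOn.monotoneOn
    StrictAntiOn.antitoneOn

theorem hasDerivAt_slice {v : V₀} (hv : v ∈ T.W) :
    HasDerivAt (fun z => f (v.1, z)) (dz f v) v.2 := by
  have h := (T.differentiableAt_f hv).hasFDerivAt.comp_hasDerivAt (f := fun z : ℝ => (v.1, z)) v.2
    ((hasDerivAt_const v.2 v.1).prodMk (hasDerivAt_id v.2))
  exact h

/-- Near the curve `f` moves away from its value on the curve. -/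
theorem eventually_mul_dz_nonneg {t : ℝ} (ht : t ∈ T.I) :
    ∀ᶠ v in 𝓝[T.W] ((t, T.γ t) : V₀), 0 ≤ T.e * (f v - T.f0 v.1) * dz f v := by
  obtain ⟨r, hr, -, hm⟩ := T.exists_monotone_box ht
  have h1 : ∀ᶠ v in 𝓝 ((t, T.γ t) : V₀), |v.1 - t| < r := by
    have : ContinuousAt (fun v : V₀ => |v.1 - t|) (t, T.γ t) := by fun_prop
    exact this.eventually (gt_mem_nhds (by simpa))
  have h2 : ∀ᶠ v in 𝓝 ((t, T.γ t) : V₀), |T.s v| < r := by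
    have : ContinuousAt (fun v : V₀ => |T.s v|) (t, T.γ t) :=
      (T.contDiffOn_s.continuousOn.continuousAt (T.isOpen.mem_nhds (T.curve_mem t ht))).abs
    exact this.eventually (gt_mem_nhds (by simpa [s]))
  filter_upwards [eventually_nhdsWithin_of_eventually_nhds h1,
    eventually_nhdsWithin_of_eventually_nhds h2, self_mem_nhdsWithin] with v hv1 hv2 hW
  have hs := (T.mem_W.1 hW).2
  rw [abs_lt] at hv2
  rw [s] at hs hv2
  have hnear : Icc (T.γ v.1 - r) (T.γ v.1 + r) ∈ 𝓝 v.2 :=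
    Icc_mem_nhds (by linarith) (by linarith)
  have hz : v.2 ∈ Icc (T.γ v.1 - r) (T.γ v.1 + r) := mem_of_mem_nhds hnear
  have hγ : T.γ v.1 ∈ Icc (T.γ v.1 - r) (T.γ v.1 + r) := ⟨by linarith, by linarith⟩
  have hder := T.hasDerivAt_slice hW
  rw [← hder.deriv, ← derivWithin_of_mem_nhds hnear]
  have hside : (T.e = 1 ∧ T.γ v.1 ≤ v.2) ∨ (T.e = -1 ∧ v.2 ≤ T.γ v.1) := by
    rcases T.e_cases with h | h <;> rw [h] at hs
    · exact Or.inl ⟨h, by linarith⟩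
    · exact Or.inr ⟨h, by linarith⟩
  rcases hm v.1 hv1 with hm | hm
  · refine mul_nonneg ?_ hm.derivWithin_nonneg
    rcases hside with ⟨h, hle⟩ | ⟨h, hle⟩ <;> rw [h]
    · have : T.f0 v.1 ≤ f v := hm hγ hz hle
      linarith
    · have : f v ≤ T.f0 v.1 := hm hz hγ hle
      linarith
  · refine mul_nonneg_of_nonpos_of_nonpos ?_ hm.derivWithin_nonpos
    rcases hside with ⟨h, hle⟩ | ⟨h, hle⟩ <;> rw [h]
    · have : f v ≤ T.f0 v.1 := hm hγ hz hle
      linarith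
    · have : T.f0 v.1 ≤ f v := hm hz hγ hle
      linarith

/-- On each vertical segment f is monotone, so the integral of |∂_z f| is at most an oscillation,
bounded by 2K√r uniformly in x; Tonelli concludes. -/
theorem integrableOn_dz_near {t : ℝ} (ht : t ∈ T.I) :
    ∃ o ∈ 𝓝 ((t, T.γ t) : V₀), IntegrableOn (dz f) (o ∩ T.W) := by
  obtain ⟨r, hr, hbox, hm⟩ := T.exists_monotone_box ht
  set O : Set V₀ := U ∩ {v | |v.1 - t| < r ∧ |T.s v| < r} with hOdef
  have hO : IsOpen O := by
    have h := T.contDiffOn_s.continuousOn.abs.isOpen_inter_preimage T.isOpen (isOpen_Iio (a := r))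
    have h' : IsOpen {v : V₀ | |v.1 - t| < r} := isOpen_lt (by fun_prop) continuous_const
    have he : O = U ∩ (fun x => |T.s x|) ⁻¹' Iio r ∩ {v | |v.1 - t| < r} := by
      ext v
      simp only [hOdef, mem_inter_iff, mem_ofPred_eq, mem_preimage, mem_Iio]
      tauto
    rw [he]
    exact h.inter h'
  refine ⟨O, hO.mem_nhds ⟨T.curve_mem t ht, by simpa using hr, by simpa [s] using hr⟩, ?_⟩
  have hOW := hO.inter T.isOpen_W
  rw [← integrable_indicator_iff hOW.measurableSet]
  have hmeas : Measurable ((O ∩ T.W).indicator (dz f)) :=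
    (measurable_fderiv_apply_const ℝ f ((0, 1) : V₀)).indicator hOW.measurableSet
  have hdom : ∀ x z, ‖(O ∩ T.W).indicator (dz f) (x, z)‖ ≤
      (Ioo (T.γ x - r) (T.γ x + r)).indicator (fun z => |deriv (fun z => f (x, z)) z|) z := by
    intro x z
    by_cases hv : (x, z) ∈ O ∩ T.W
    · have hz : z ∈ Ioo (T.γ x - r) (T.γ x + r) := by
        have := abs_lt.1 hv.1.2.2
        simp only [s] at this
        exact ⟨by linarith, by linarith⟩
      rw [indicator_of_mem hv, indicator_of_mem hz, (T.hasDerivAt_slice hv.2).deriv]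
      exact le_rfl
    · rw [indicator_of_notMem hv, norm_zero]
      exact indicator_nonneg (fun _ _ => abs_nonneg _) _
  have hslice : ∀ x, |x - t| < r →
      Integrable (fun z => (O ∩ T.W).indicator (dz f) (x, z)) ∧
      ∫ z, ‖(O ∩ T.W).indicator (dz f) (x, z)‖ ≤ 2 * (T.K * √r) := by
    intro x hx
    obtain ⟨h1, h2⟩ := integral_abs_deriv_le (by linarith) (hm x hx)
    have hI : Integrable ((Ioo (T.γ x - r) (T.γ x + r)).indicator
        (fun z => |deriv (fun z => f (x, z)) z|)) :=
      (integrable_indicator_iff measurableSet_Ioo).2 h1.abs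
    have hi : Integrable (fun z => (O ∩ T.W).indicator (dz f) (x, z)) :=
      hI.mono' (hmeas.comp measurable_prodMk_left).aestronglyMeasurable
        (Eventually.of_forall (hdom x))
    refine ⟨hi, (integral_mono hi.norm hI (hdom x)).trans ?_⟩
    rw [integral_indicator measurableSet_Ioo]
    refine h2.trans ?_
    have hb : ∀ y, |y| ≤ r → |f (x, T.γ x + y) - T.f0 x| ≤ T.K * √r := by
      intro y hy
      have hU := hbox x (T.γ x + y) hx (by simpa using hy)
      refine (T.abs_sub_trace_le hU).trans ?_
      have := T.K_nonneg
      simp only [s, add_sub_cancel_left]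
      gcongr
    have b1 := hb r (abs_of_pos hr).le
    have b2 := hb (-r) (by rw [abs_neg]; exact (abs_of_pos hr).le)
    rw [← sub_eq_add_neg] at b2
    rw [abs_le] at *
    constructor <;> linarith [b1.1, b1.2, b2.1, b2.2]
  have hout : ∀ x, ¬ |x - t| < r → ∀ z, (O ∩ T.W).indicator (dz f) (x, z) = 0 :=
    fun x hx z => indicator_of_notMem (fun h => hx h.1.2.1) _
  refine (integrable_prod_iff hmeas.aestronglyMeasurable).2 ⟨Eventually.of_forall fun x => ?_, ?_⟩
  · by_cases hx : |x - t| < r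
    · exact (hslice x hx).1
    · simp [hout x hx]
  · have hIoo : Integrable ((Ioo (t - r) (t + r)).indicator (fun _ => 2 * (T.K * √r))) :=
      (integrable_indicator_iff measurableSet_Ioo).2 (integrableOn_const (by simp))
    refine hIoo.mono' (hmeas.aestronglyMeasurable.norm.integral_prod_right') ?_
    refine Eventually.of_forall fun x => ?_
    rw [Real.norm_eq_abs, abs_of_nonneg (integral_nonneg fun _ => norm_nonneg _)]
    by_cases hx : |x - t| < r
    · rw [indicator_of_mem]
      · exact (hslice x hx).2
      · have := abs_lt.1 hx
        exact ⟨by linarith, by linarith⟩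
    · simp only [hout x hx, norm_zero, integral_zero]
      have := T.K_nonneg
      exact indicator_nonneg (fun _ _ => by positivity) _

/-- `∂_z f` is integrable up to the curve. -/
theorem integrableOn_dz {Q : Set V₀} (hQ : IsCompact Q) (hQU : Q ⊆ U) :
    IntegrableOn (dz f) (Q ∩ T.W) := by
  refine T.induction_on_compact hQ hQU (p := fun s => IntegrableOn (dz f) s volume) integrableOn_empty
    (fun s t hst h => h.mono_set hst) (fun s t hs ht => hs.union ht) (fun v hv => ?_)
    fun t ht => T.integrableOn_dz_near ht
  obtain ⟨o, ho, h⟩ := T.contDiffOn_dz_f.continuousOn.locallyIntegrableOn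
    (μ := volume) T.isOpen_W.measurableSet v hv
  obtain ⟨o', ho', h'⟩ := mem_nhdsWithin_iff_exists_mem_nhds_inter.1 ho
  exact ⟨o', ho', h.mono_set h'⟩

end HalfHerringbone

/-! ### Cutoffs and the divergence theorem up to the curve. -/

/-- A smooth step from `0` on `(-∞, 1]` to `1` on `[2, ∞)`. -/
noncomputable def step (τ : ℝ) : ℝ := Real.smoothTransition (τ - 1)

theorem contDiff_step : ContDiff ℝ ∞ step :=
  Real.smoothTransition.contDiff.comp (contDiff_id.sub contDiff_const)

theorem step_of_le {τ : ℝ} (h : τ ≤ 1) : step τ = 0 :=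
  Real.smoothTransition.zero_of_nonpos (by linarith)

theorem step_of_ge {τ : ℝ} (h : 2 ≤ τ) : step τ = 1 :=
  Real.smoothTransition.one_of_one_le (by linarith)

theorem abs_step_le (τ : ℝ) : |step τ| ≤ 1 := by
  rw [step, abs_of_nonneg (Real.smoothTransition.nonneg _)]
  exact Real.smoothTransition.le_one _

theorem hasDerivAt_step (τ : ℝ) : HasDerivAt step (deriv step τ) τ :=
  (contDiff_step.differentiable (by simp) τ).hasDerivAt

theorem continuous_deriv_step : Continuous (deriv step) :=
  contDiff_step.continuous_deriv (by decide)

theorem deriv_step_of_notMem {τ : ℝ} (h : τ ∉ Icc (1 : ℝ) 2) : deriv step τ = 0 := by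
  rw [mem_Icc, not_and_or, not_le, not_le] at h
  rcases h with h | h
  · have : step =ᶠ[𝓝 τ] fun _ => 0 := by
      filter_upwards [gt_mem_nhds h] with y hy using step_of_le hy.le
    rw [this.deriv_eq, deriv_const]
  · have : step =ᶠ[𝓝 τ] fun _ => 1 := by
      filter_upwards [lt_mem_nhds h] with y hy using step_of_ge hy.le
    rw [this.deriv_eq, deriv_const]

theorem hasCompactSupport_deriv_step : HasCompactSupport (deriv step) :=
  HasCompactSupport.intro isCompact_Icc fun _ => deriv_step_of_notMem

theorem integral_deriv_step : ∫ τ, deriv step τ = 1 := by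
  have h : ∫ τ in (1 : ℝ)..2, deriv step τ = step 2 - step 1 :=
    intervalIntegral.integral_eq_sub_of_hasDerivAt (fun τ _ => hasDerivAt_step τ)
      (continuous_deriv_step.intervalIntegrable _ _)
  rw [step_of_ge le_rfl, step_of_le le_rfl, sub_zero, intervalIntegral.integral_of_le (by norm_num),
    ← integral_Icc_eq_integral_Ioc] at h
  rw [← h, setIntegral_eq_integral_of_forall_compl_eq_zero]
  exact fun _ => deriv_step_of_notMem

namespace HalfHerringbone

variable {U : Set V₀} {f : V₀ → ℝ} (T : HalfHerringbone U f)

theorem measurable_s : Measurable T.s := measurable_snd.sub (T.measurable_γ.comp measurable_fst)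

theorem hasFDerivAt_comp_s {a : ℝ → ℝ} {a' : ℝ} {v : V₀} (hv : v ∈ U)
    (ha : HasDerivAt a a' (T.s v)) : HasFDerivAt (fun v => a (T.s v))
      ((a' * T.f0 v.1) • ContinuousLinearMap.fst ℝ ℝ ℝ + a' • ContinuousLinearMap.snd ℝ ℝ ℝ) v := by
  refine (ha.comp_hasFDerivAt v (T.hasFDerivAt_s hv)).congr_fderiv ?_
  ext <;> simp

/-- Concentration of mass along one side of the curve. -/
theorem tendsto_integral_layer {k : ℝ → ℝ} (hk : Continuous k)
    (hk0 : ∀ τ, τ ∉ Icc (1 : ℝ) 2 → k τ = 0) {B : V₀ → ℝ} (hBm : Measurable B) {C : ℝ}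
    (hC : ∀ v, |B v| ≤ C) {Q : Set V₀} (hQ : IsCompact Q) (h0 : ∀ v, v ∉ Q → B v = 0) {b : ℝ → ℝ}
    (hb : ∀ x, Tendsto (fun s => B (x, T.γ x + T.e * s)) (𝓝[>] 0) (𝓝 (b x))) :
    (∀ ε, Integrable (fun v => ε⁻¹ * k (T.e * T.s v / ε) * B v)) ∧
    Tendsto (fun ε => ∫ v, ε⁻¹ * k (T.e * T.s v / ε) * B v) (𝓝[>] 0)
      (𝓝 ((∫ τ, k τ) * ∫ x, b x)) := by
  have hkc : HasCompactSupport k := HasCompactSupport.intro isCompact_Icc hk0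
  obtain ⟨Ck, hCk⟩ := hkc.exists_bound_of_continuous hk
  have hki : Integrable k := hk.integrable_of_hasCompactSupport hkc
  have hC0 : 0 ≤ C := (abs_nonneg _).trans (hC 0)
  have hCk0 : 0 ≤ Ck := (norm_nonneg _).trans (hCk 0)
  have hint : ∀ ε, Integrable (fun v => ε⁻¹ * k (T.e * T.s v / ε) * B v) := by
    intro ε
    have hQi : Integrable (Q.indicator fun _ => |ε⁻¹| * Ck * C) :=
      (integrable_indicator_iff hQ.measurableSet).2 (integrableOn_const hQ.measure_lt_top.ne)
    refine hQi.mono' (((hk.measurable.comp ((T.measurable_s.const_mul _).div_const _)).const_mul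
      _).mul hBm).aestronglyMeasurable (Eventually.of_forall fun v => ?_)
    by_cases hv : v ∈ Q
    · rw [indicator_of_mem hv, Real.norm_eq_abs, abs_mul, abs_mul]
      have h1 := hCk (T.e * T.s v / ε)
      rw [Real.norm_eq_abs] at h1
      have h2 := hC v
      gcongr
    · rw [indicator_of_notMem hv, h0 v hv, mul_zero, norm_zero]
  refine ⟨hint, ?_⟩
  -- The substitution z = γ(x) + e ε τ absorbs the factor ε⁻¹ and freezes the profile k; dominated
  -- convergence applies in τ and then in x.
  have hsub : ∀ ε > 0, ∀ x, ∫ z, ε⁻¹ * k (T.e * T.s (x, z) / ε) * B (x, z) =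
      ∫ τ, k τ * B (x, T.γ x + T.e * (ε * τ)) := by
    intro ε hε x
    have ha : |(T.e * ε)⁻¹| = ε⁻¹ := by rw [abs_inv, abs_mul, T.abs_e, one_mul, abs_of_pos hε]
    have h1 := Measure.integral_comp_mul_left
      (fun y => k (T.e * T.s (x, T.γ x + y) / ε) * B (x, T.γ x + y)) (T.e * ε)
    rw [integral_add_left_eq_self (fun z => k (T.e * T.s (x, z) / ε) * B (x, z)) (T.γ x),
      ha, smul_eq_mul, ← integral_const_mul] at h1
    simp only [mul_assoc] at h1 ⊢
    rw [← h1]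
    refine integral_congr_ae (Eventually.of_forall fun τ => ?_)
    have h2 : T.e * T.s (x, T.γ x + T.e * (ε * τ)) / ε = τ := by
      rw [s]
      field_simp
      linear_combination ε * τ * T.e_mul_e
    simp only [h2]
  have hfub : ∀ ε > 0, ∫ v, ε⁻¹ * k (T.e * T.s v / ε) * B v =
      ∫ x, ∫ τ, k τ * B (x, T.γ x + T.e * (ε * τ)) := by
    intro ε hε
    rw [Measure.volume_eq_prod, integral_prod _ (hint ε)]
    exact integral_congr_ae (Eventually.of_forall (hsub ε hε))
  have hlim : ∀ x, Tendsto (fun ε => ∫ τ, k τ * B (x, T.γ x + T.e * (ε * τ))) (𝓝[>] 0)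
      (𝓝 ((∫ τ, k τ) * b x)) := by
    intro x
    rw [← integral_mul_const]
    refine tendsto_integral_filter_of_dominated_convergence (fun τ => |k τ| * C) ?_ ?_
      (hki.abs.mul_const C) ?_
    · refine Eventually.of_forall fun ε => ?_
      exact (hk.measurable.mul (hBm.comp (by fun_prop))).aestronglyMeasurable
    · refine Eventually.of_forall fun ε => Eventually.of_forall fun τ => ?_
      rw [Real.norm_eq_abs, abs_mul]
      have := hC (x, T.γ x + T.e * (ε * τ))
      gcongr
    · refine Eventually.of_forall fun τ => ?_
      by_cases hτ : τ ∈ Icc (1 : ℝ) 2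
      · have hτ0 : 0 < τ := by linarith [hτ.1]
        have hm : Tendsto (fun ε : ℝ => ε * τ) (𝓝[>] 0) (𝓝[>] 0) := by
          refine tendsto_nhdsWithin_iff.2 ⟨?_, ?_⟩
          · have : Continuous fun ε : ℝ => ε * τ := by fun_prop
            simpa using (this.tendsto 0).mono_left nhdsWithin_le_nhds
          · filter_upwards [self_mem_nhdsWithin] with ε hε using mul_pos hε hτ0
        exact ((hb x).comp hm).const_mul _
      · simp only [hk0 τ hτ, zero_mul]
        exact tendsto_const_nhds
  have hQ1 : IsCompact (Prod.fst '' Q) := hQ.image continuous_fst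
  have hout : Tendsto (fun ε => ∫ x, ∫ τ, k τ * B (x, T.γ x + T.e * (ε * τ))) (𝓝[>] 0)
      (𝓝 (∫ x, (∫ τ, k τ) * b x)) := by
    refine tendsto_integral_filter_of_dominated_convergence
      ((Prod.fst '' Q).indicator fun _ => (∫ τ, |k τ|) * C) ?_ ?_ ?_
      (Eventually.of_forall hlim)
    · filter_upwards [self_mem_nhdsWithin] with ε hε
      have := (hint ε).aestronglyMeasurable
      rw [Measure.volume_eq_prod] at this
      exact this.integral_prod_right'.congr (Eventually.of_forall (hsub ε hε))
    · refine Eventually.of_forall fun ε => Eventually.of_forall fun x => ?_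
      by_cases hx : x ∈ Prod.fst '' Q
      · rw [indicator_of_mem hx, ← integral_mul_const]
        refine (norm_integral_le_integral_norm _).trans ?_
        refine integral_mono_of_nonneg (Eventually.of_forall fun _ => norm_nonneg _)
          (hki.abs.mul_const C) (Eventually.of_forall fun τ => ?_)
        simp only [Real.norm_eq_abs, abs_mul]
        have := hC (x, T.γ x + T.e * (ε * τ))
        gcongr
      · have : ∀ z, B (x, z) = 0 := fun z => h0 _ fun h => hx ⟨_, h, rfl⟩
        simp [this, indicator_of_notMem hx]
    · exact (integrable_indicator_iff hQ1.measurableSet).2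
        (integrableOn_const hQ1.measure_lt_top.ne)
  rw [integral_const_mul] at hout
  refine hout.congr' ?_
  filter_upwards [self_mem_nhdsWithin] with ε hε
  exact (hfub ε hε).symm

theorem tendsto_div_atTop {v : V₀} (hv : v ∈ T.W) :
    Tendsto (fun ε => T.e * T.s v / ε) (𝓝[>] 0) atTop := by
  simp only [div_eq_mul_inv]
  exact tendsto_inv_nhdsGT_zero.const_mul_atTop (T.mem_W.1 hv).2

/-- `step` vanishes up to 1 rather than up to 0, so the cutoff is zero in a full neighbourhood of
each curve point, and P may be singular there. -/
theorem contDiff_step_mul {P : V₀ → ℝ} (hP : ContDiffOn ℝ 1 P T.W) {Q : Set V₀} (hQ : IsCompact Q)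
    (hQU : Q ⊆ U) (h0 : ∀ v, v ∉ Q → P v = 0) {ε : ℝ} (hε : 0 < ε) :
    ContDiff ℝ 1 (fun v => step (T.e * T.s v / ε) * P v) ∧
      ∀ v, v ∉ T.W → (fun v => step (T.e * T.s v / ε) * P v) =ᶠ[𝓝 v] fun _ => 0 := by
  have hz : ∀ v, v ∉ T.W → (fun v => step (T.e * T.s v / ε) * P v) =ᶠ[𝓝 v] fun _ => 0 := by
    intro v hv
    by_cases hvU : v ∈ U
    · have hle : T.e * T.s v ≤ 0 := not_lt.1 fun h => hv ⟨hvU, h⟩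
      have hc : ContinuousAt (fun v => T.e * T.s v / ε) v :=
        ((T.contDiffOn_s.continuousOn.continuousAt (T.isOpen.mem_nhds hvU)).const_mul _).div_const _
      have h1 : T.e * T.s v / ε < 1 :=
        (div_nonpos_of_nonpos_of_nonneg hle hε.le).trans_lt one_pos
      filter_upwards [hc.eventually (gt_mem_nhds h1)] with w hw
      rw [step_of_le hw.le, zero_mul]
    · filter_upwards [hQ.isClosed.isOpen_compl.mem_nhds fun h => hvU (hQU h)] with w hw
      rw [h0 w hw, mul_zero]
  refine ⟨contDiff_iff_contDiffAt.2 fun v => ?_, hz⟩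
  by_cases hv : v ∈ T.W
  · have hs := (T.contDiffOn_s.contDiffAt (T.isOpen.mem_nhds (T.W_subset hv))).of_le
      (by decide : (1 : WithTop ℕ∞) ≤ ∞)
    exact ((contDiff_step.of_le (by decide)).contDiffAt.comp v
      ((contDiffAt_const.mul hs).div_const _)).mul (hP.contDiffAt (T.isOpen_W.mem_nhds hv))
  · exact contDiffAt_const.congr_of_eventuallyEq (hz v hv)

/-- The divergence theorem on one side of the curve. -/
theorem integral_div {P₁ P₂ : V₀ → ℝ} (h1 : ContDiffOn ℝ 1 P₁ T.W) (h2 : ContDiffOn ℝ 1 P₂ T.W)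
    {Q : Set V₀} (hQ : IsCompact Q) (hQU : Q ⊆ U) (h01 : ∀ v, v ∉ Q → P₁ v = 0)
    (h02 : ∀ v, v ∉ Q → P₂ v = 0) (hdiv : IntegrableOn (fun v => dx P₁ v + dz P₂ v) T.W)
    {B : V₀ → ℝ} (hBm : Measurable B) {C : ℝ} (hC : ∀ v, |B v| ≤ C) (h0 : ∀ v, v ∉ Q → B v = 0)
    {G : V₀ → ℝ} (hG : IntegrableOn G T.W)
    (hBG : ∀ v ∈ T.W, |P₂ v + T.f0 v.1 * P₁ v - B v| ≤ |T.s v| * G v) {b : ℝ → ℝ}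
    (hb : ∀ x, Tendsto (fun s => B (x, T.γ x + T.e * s)) (𝓝[>] 0) (𝓝 (b x))) :
    ∫ v in T.W, (dx P₁ v + dz P₂ v) = -T.e * ∫ x, b x := by
  obtain ⟨hBi, hBlim⟩ := T.tendsto_integral_layer continuous_deriv_step
    (fun _ => deriv_step_of_notMem) hBm hC hQ h0 hb
  rw [integral_deriv_step, one_mul] at hBlim
  have hWm := T.isOpen_W.measurableSet
  -- The gradient of s is (f₀, 1), so the derivative of the cutoff meets exactly the normal flux P₂
  -- + f₀ P₁.
  have hderiv : ∀ ε > 0, ∀ v ∈ T.W,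
      dx (fun v => step (T.e * T.s v / ε) * P₁ v) v + dz (fun v => step (T.e * T.s v / ε) * P₂ v) v =
      step (T.e * T.s v / ε) * (dx P₁ v + dz P₂ v) +
        T.e * (ε⁻¹ * deriv step (T.e * T.s v / ε) * (P₂ v + T.f0 v.1 * P₁ v)) := by
    intro ε hε v hv
    have hs : HasDerivAt (fun y => step (T.e * y / ε)) (deriv step (T.e * T.s v / ε) * (T.e / ε))
        (T.s v) := by
      have hl : HasDerivAt (fun y => T.e * y / ε) (T.e / ε) (T.s v) := by
        simpa using ((hasDerivAt_id (T.s v)).const_mul T.e).div_const ε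
      exact HasDerivAt.comp (h₂ := step) (h := fun y => T.e * y / ε) (T.s v)
        (hasDerivAt_step (T.e * T.s v / ε)) hl
    have hf := T.hasFDerivAt_comp_s (T.W_subset hv) hs
    have d1 := (h1.contDiffAt (T.isOpen_W.mem_nhds hv)).differentiableAt (by simp)
    have d2 := (h2.contDiffAt (T.isOpen_W.mem_nhds hv)).differentiableAt (by simp)
    rw [dx_mul hf.differentiableAt d1, dz_mul hf.differentiableAt d2, dx_eq_of_hasFDerivAt hf,
      dz_eq_of_hasFDerivAt hf]
    ring
  have hzero : ∀ ε > 0, Integrable (fun v => dx (fun v => step (T.e * T.s v / ε) * P₁ v) v +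
      dz (fun v => step (T.e * T.s v / ε) * P₂ v) v) ∧
      ∫ v in T.W, (dx (fun v => step (T.e * T.s v / ε) * P₁ v) v +
        dz (fun v => step (T.e * T.s v / ε) * P₂ v) v) = 0 := by
    intro ε hε
    obtain ⟨c1, z1⟩ := T.contDiff_step_mul h1 hQ hQU h01 hε
    obtain ⟨c2, z2⟩ := T.contDiff_step_mul h2 hQ hQU h02 hε
    have s1 : HasCompactSupport (fun v => step (T.e * T.s v / ε) * P₁ v) :=
      HasCompactSupport.intro hQ fun v hv => by rw [h01 v hv, mul_zero]
    have s2 : HasCompactSupport (fun v => step (T.e * T.s v / ε) * P₂ v) :=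
      HasCompactSupport.intro hQ fun v hv => by rw [h02 v hv, mul_zero]
    have i1 := (contDiff_dx c1 (m := 0) (by simp)).continuous.integrable_of_hasCompactSupport
      (μ := volume) (hasCompactSupport_dx s1)
    have i2 := (contDiff_dz c2 (m := 0) (by simp)).continuous.integrable_of_hasCompactSupport
      (μ := volume) (hasCompactSupport_dz s2)
    refine ⟨i1.add i2, ?_⟩
    rw [setIntegral_eq_integral_of_forall_compl_eq_zero, integral_add i1 i2,
      integral_dx_eq_zero c1 s1, integral_dz_eq_zero c2 s2, add_zero]
    intro v hv
    rw [dx_congr (z1 v hv), dz_congr (z2 v hv), dx_const, dz_const, add_zero]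
  have hm : ∀ ε, Measurable fun v => step (T.e * T.s v / ε) := fun ε =>
    contDiff_step.continuous.measurable.comp ((T.measurable_s.const_mul _).div_const _)
  have hL1 : Tendsto (fun ε => ∫ v in T.W, step (T.e * T.s v / ε) * (dx P₁ v + dz P₂ v)) (𝓝[>] 0)
      (𝓝 (∫ v in T.W, (dx P₁ v + dz P₂ v))) := by
    refine tendsto_integral_filter_of_dominated_convergence (fun v => |dx P₁ v + dz P₂ v|) ?_ ?_
      hdiv.abs ?_
    · exact Eventually.of_forall fun ε => (hm ε).aestronglyMeasurable.mul hdiv.aestronglyMeasurable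
    · refine Eventually.of_forall fun ε => Eventually.of_forall fun v => ?_
      rw [Real.norm_eq_abs, abs_mul]
      exact mul_le_of_le_one_left (abs_nonneg _) (abs_step_le _)
    · rw [ae_restrict_iff' hWm]
      refine Eventually.of_forall fun v hv => tendsto_const_nhds.congr' ?_
      filter_upwards [(T.tendsto_div_atTop hv).eventually_ge_atTop 2] with ε hε
      rw [step_of_ge hε, one_mul]
  have i1 : ∀ ε, IntegrableOn (fun v => step (T.e * T.s v / ε) * (dx P₁ v + dz P₂ v)) T.W := by
    intro ε
    exact hdiv.bdd_mul (c := 1) (hm ε).aestronglyMeasurable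
      (Eventually.of_forall fun v => abs_step_le _)
  have iB : ∀ ε, IntegrableOn (fun v => T.e * (ε⁻¹ * deriv step (T.e * T.s v / ε) * B v)) T.W :=
    fun ε => ((hBi ε).const_mul _).integrableOn
  obtain ⟨Ck, hCk⟩ := hasCompactSupport_deriv_step.exists_bound_of_continuous continuous_deriv_step
  have iR : ∀ ε > 0, IntegrableOn (fun v => T.e * (ε⁻¹ * deriv step (T.e * T.s v / ε) *
      (P₂ v + T.f0 v.1 * P₁ v - B v))) T.W := by
    intro ε hε
    refine (((hzero ε hε).1.integrableOn.sub (i1 ε)).sub (iB ε)).congr_fun (fun v hv => ?_) hWm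
    simp only [Pi.sub_apply]
    rw [hderiv ε hε v hv]
    ring
  -- On the support of the derivative of the cutoff |s| ≤ 2ε, so the factor |s| in the bound
  -- compensates ε⁻¹ and leaves the integrable majorant |G|. Each fixed point leaves the layer as ε
  -- → 0, hence the limit 0.
  have hL3 : Tendsto (fun ε => ∫ v in T.W, T.e * (ε⁻¹ * deriv step (T.e * T.s v / ε) *
      (P₂ v + T.f0 v.1 * P₁ v - B v))) (𝓝[>] 0) (𝓝 (∫ v in T.W, (0 : ℝ))) := by
    refine tendsto_integral_filter_of_dominated_convergence (fun v => 2 * Ck * |G v|) ?_ ?_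
      (hG.abs.const_mul _) ?_
    · filter_upwards [self_mem_nhdsWithin] with ε hε using (iR ε hε).aestronglyMeasurable
    · filter_upwards [self_mem_nhdsWithin] with ε (hε : 0 < ε)
      rw [ae_restrict_iff' hWm]
      refine Eventually.of_forall fun v hv => ?_
      have hk := hCk (T.e * T.s v / ε)
      have hCk0 : 0 ≤ Ck := (norm_nonneg _).trans hk
      rw [Real.norm_eq_abs] at hk
      by_cases hmem : T.e * T.s v / ε ∈ Icc (1 : ℝ) 2
      · have hs : ε⁻¹ * |T.s v| ≤ 2 := by
          rw [T.abs_s hv, inv_mul_eq_div]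
          exact hmem.2
        have hb1 := (hBG v hv).trans
          (mul_le_mul_of_nonneg_left (le_abs_self (G v)) (abs_nonneg (T.s v)))
        rw [Real.norm_eq_abs, abs_mul, abs_mul, abs_mul, T.abs_e, one_mul, abs_of_pos (inv_pos.2 hε)]
        calc ε⁻¹ * |deriv step (T.e * T.s v / ε)| * |P₂ v + T.f0 v.1 * P₁ v - B v|
            ≤ ε⁻¹ * Ck * (|T.s v| * |G v|) := by gcongr
          _ = (ε⁻¹ * |T.s v|) * Ck * |G v| := by ring
          _ ≤ 2 * Ck * |G v| := by gcongr
      · rw [deriv_step_of_notMem hmem]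
        simp only [mul_zero, zero_mul, norm_zero]
        positivity
    · rw [ae_restrict_iff' hWm]
      refine Eventually.of_forall fun v hv => tendsto_const_nhds.congr' ?_
      filter_upwards [(T.tendsto_div_atTop hv).eventually_gt_atTop 2] with ε hε
      rw [deriv_step_of_notMem fun h => absurd h.2 (not_le.2 hε)]
      simp
  have hL2 : Tendsto (fun ε => ∫ v in T.W, T.e * (ε⁻¹ * deriv step (T.e * T.s v / ε) * B v))
      (𝓝[>] 0) (𝓝 (T.e * ∫ x, b x)) := by
    refine (hBlim.const_mul T.e).congr' ?_
    filter_upwards [self_mem_nhdsWithin] with ε (hε : 0 < ε)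
    rw [← integral_const_mul, setIntegral_eq_integral_of_forall_compl_eq_zero]
    intro v hv
    by_cases hvQ : v ∈ Q
    · have hle : T.e * T.s v ≤ 0 := not_lt.1 fun h => hv ⟨hQU hvQ, h⟩
      rw [deriv_step_of_notMem fun h => ?_]
      · simp
      · have := div_nonpos_of_nonpos_of_nonneg hle hε.le
        linarith [h.1]
    · rw [h0 v hvQ]
      simp
  have hsum := (hL1.add hL2).add hL3
  have hev : (fun ε => (∫ v in T.W, step (T.e * T.s v / ε) * (dx P₁ v + dz P₂ v)) +
      (∫ v in T.W, T.e * (ε⁻¹ * deriv step (T.e * T.s v / ε) * B v)) +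
      ∫ v in T.W, T.e * (ε⁻¹ * deriv step (T.e * T.s v / ε) * (P₂ v + T.f0 v.1 * P₁ v - B v)))
      =ᶠ[𝓝[>] 0] fun _ => 0 := by
    filter_upwards [self_mem_nhdsWithin] with ε hε
    rw [← (hzero ε hε).2, ← integral_add (i1 ε) (iB ε)]
    have i12 : IntegrableOn (fun v => step (T.e * T.s v / ε) * (dx P₁ v + dz P₂ v) +
      T.e * (ε⁻¹ * deriv step (T.e * T.s v / ε) * B v)) T.W := (i1 ε).add (iB ε)
    rw [← integral_add i12 (iR ε hε)]
    refine setIntegral_congr_fun hWm fun v hv => ?_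
    rw [hderiv ε hε v hv]
    ring
  have := tendsto_nhds_unique (hsum.congr' hev) tendsto_const_nhds
  rw [integral_zero, add_zero] at this
  linarith

end HalfHerringbone

/-! ### The first variation formula on one side of the curve. -/

theorem exists_bound_of_continuousOn {U Q : Set V₀} (hQ : IsCompact Q) (hQU : Q ⊆ U) {F : V₀ → ℝ}
    (hF : ContinuousOn F U) (h0 : ∀ v, v ∉ Q → F v = 0) : ∃ C, 0 ≤ C ∧ ∀ v, |F v| ≤ C := by
  obtain ⟨C, hC⟩ := hQ.exists_bound_of_continuousOn (hF.mono hQU)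
  refine ⟨max C 0, le_max_right _ _, fun v => ?_⟩
  by_cases hv : v ∈ Q
  · exact (hC v hv).trans (le_max_left _ _)
  · rw [h0 v hv, abs_zero]
    exact le_max_right _ _

/-- S enters through the rotated gradient (∂_z S, -∂_x S), which is divergence free: it changes the
flux but not the divergence. -/
theorem dx_add_dz_eq {f w θ A S : V₀ → ℝ} {v : V₀} (hf : DifferentiableAt ℝ f v)
    (hw : DifferentiableAt ℝ w v) (hθ : DifferentiableAt ℝ θ v) (hA : DifferentiableAt ℝ A v)
    (hSx : DifferentiableAt ℝ (dx S) v) (hSz : DifferentiableAt ℝ (dz S) v)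
    (hS : dx (dz S) v = dz (dx S) v) :
    dx (fun p => dz S p - θ p * A p) v +
      dz (fun p => f p * (θ p * A p) + 1 / 2 * (θ p ^ 2 * w p) - dx S p) v =
    -(nabla f θ v * A v) - θ v * nabla f A v + dz f v * θ v * A v + θ v * dz θ v * w v
      + 1 / 2 * θ v ^ 2 * dz w v := by
  have d0 : DifferentiableAt ℝ (fun p => θ p ^ 2) v := hθ.pow 2
  have d1 : DifferentiableAt ℝ (fun p => θ p * A p) v := hθ.mul hA
  have d2 : DifferentiableAt ℝ (fun p => θ p ^ 2 * w p) v := d0.mul hw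
  have d3 : DifferentiableAt ℝ (fun p => 1 / 2 * (θ p ^ 2 * w p)) v := d2.const_mul _
  have d4 : DifferentiableAt ℝ (fun p => f p * (θ p * A p)) v := hf.mul d1
  have d5 : DifferentiableAt ℝ (fun p => f p * (θ p * A p) + 1 / 2 * (θ p ^ 2 * w p)) v := d4.add d3
  rw [dx_sub hSz d1, dz_sub d5 hSx, dz_add d4 d3, dz_mul hf d1, dz_mul (differentiableAt_const _) d2,
    dz_mul d0 hw, dx_mul hθ hA, dz_mul hθ hA, dz_pow_two hθ, dz_const, hS, nabla, nabla]
  ring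

theorem nabla_nabla_eq {f w : V₀ → ℝ} {v : V₀} (hf : DifferentiableAt ℝ f v)
    (hx : DifferentiableAt ℝ (dx w) v) (hz : DifferentiableAt ℝ (dz w) v)
    (hw : dx (dz w) v = dz (dx w) v) :
    nabla f (nabla f w) v =
      dx (dx w) v - 2 * f v * dx (dz w) v + f v ^ 2 * dz (dz w) v - nabla f f v * dz w v := by
  have d : DifferentiableAt ℝ (fun p => f p * dz w p) v := hf.mul hz
  have e : nabla f w = fun p => dx w p - f p * dz w p := rfl
  rw [nabla, e, dx_sub hx d, dz_sub hx d, dx_mul hf hz, dz_mul hf hz, nabla, hw]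
  ring

/-- Expanding ∇_f² w produces -θ ∂_z w, which raises the coefficient of θ² ∂_z w from 1/2 to 3/2.
This identifies A₂ with the linear term of the energy expansion. -/
theorem variationIntegrand_eq {f w : V₀ → ℝ} {v : V₀} (hf : DifferentiableAt ℝ f v)
    (hw : ContDiff ℝ ∞ w) :
    variationIntegrand f w v =
      gradientVelocity w f v * nabla f f v + 3 / 2 * dz w v * nabla f f v ^ 2 := by
  rw [variationIntegrand, nabla_nabla_eq hf
    ((contDiff_dx hw (m := ∞) (by simp)).differentiable (by simp) v)
    ((contDiff_dz hw (m := ∞) (by simp)).differentiable (by simp) v)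
    (dx_dz_comm isOpen_univ (hw.contDiffOn.of_le (by decide)) (mem_univ v)), gradientVelocity]
  ring

namespace HalfHerringbone

variable {U : Set V₀} {f : V₀ → ℝ} (T : HalfHerringbone U f)

theorem integrableOn_W {F h : V₀ → ℝ} (hF : ContinuousOn F T.W) {Q : Set V₀} (hQ : IsCompact Q)
    (h0 : ∀ v, v ∉ Q → F v = 0) (hh : IntegrableOn h (Q ∩ T.W)) (hC : ∀ v ∈ Q ∩ T.W, |F v| ≤ h v) :
    IntegrableOn F T.W := by
  have hm := T.isOpen_W.measurableSet
  have hQm := hQ.measurableSet.inter hm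
  have : IntegrableOn F (Q ∩ T.W) := by
    refine Integrable.mono' hh ((hF.mono inter_subset_right).aestronglyMeasurable hQm) ?_
    rw [ae_restrict_iff' hQm]
    exact Eventually.of_forall hC
  exact this.of_forall_sdiff_eq_zero hm fun v hv => h0 v fun h => hv.2 ⟨h, hv.1⟩

theorem integrableOn_W_of_bound {F : V₀ → ℝ} (hF : ContinuousOn F T.W) {Q : Set V₀}
    (hQ : IsCompact Q) (h0 : ∀ v, v ∉ Q → F v = 0) {C : ℝ} (hC : ∀ v ∈ Q ∩ T.W, |F v| ≤ C) :
    IntegrableOn F T.W :=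
  T.integrableOn_W hF hQ h0 (h := fun _ => C)
    (integrableOn_const ((measure_mono inter_subset_left).trans_lt hQ.measure_lt_top).ne) hC

open Classical in
/-- The divergence theorem on one side of the curve, in terms of the flux up to the curve. -/
theorem integral_div_of_tendsto {P₁ P₂ : V₀ → ℝ} (h1 : ContDiffOn ℝ 1 P₁ T.W)
    (h2 : ContDiffOn ℝ 1 P₂ T.W)
    {Q : Set V₀} (hQ : IsCompact Q) (hQU : Q ⊆ U) (h01 : ∀ v, v ∉ Q → P₁ v = 0)
    (h02 : ∀ v, v ∉ Q → P₂ v = 0) (hdiv : IntegrableOn (fun v => dx P₁ v + dz P₂ v) T.W)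
    {g : V₀ → ℝ} (hg : ContinuousOn g T.W) {C : ℝ} (hC : ∀ v ∈ T.W, |g v| ≤ C)
    (h0 : ∀ v, v ∉ Q → g v = 0) {G : V₀ → ℝ} (hG : IntegrableOn G T.W)
    (hBG : ∀ v ∈ T.W, |P₂ v + T.f0 v.1 * P₁ v - g v| ≤ |T.s v| * G v) {b : ℝ → ℝ}
    (hb : ∀ x ∈ T.I, Tendsto g (𝓝[T.W] (x, T.γ x)) (𝓝 (b x))) (hb0 : ∀ x, x ∉ T.I → b x = 0) :
    ∫ v in T.W, (dx P₁ v + dz P₂ v) = -T.e * ∫ x, b x := by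
  refine T.integral_div h1 h2 hQ hQU h01 h02 hdiv (B := T.W.indicator g) (C := max C 0) ?_ ?_ ?_ hG ?_ ?_
  · have := hg.measurable_piecewise (continuousOn_const (c := (0 : ℝ))) T.isOpen_W.measurableSet
    convert this using 1
    ext v
    simp [indicator, piecewise]
  · intro v
    by_cases hv : v ∈ T.W
    · rw [indicator_of_mem hv]
      exact (hC v hv).trans (le_max_left _ _)
    · rw [indicator_of_notMem hv, abs_zero]
      exact le_max_right _ _
  · intro v hv
    simp [indicator, h0 v hv]
  · intro v hv
    rw [indicator_of_mem hv]
    exact hBG v hv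
  · intro x
    by_cases hx : x ∈ T.I
    · have hc := T.tendsto_curve hx
      refine ((hb x hx).comp hc).congr' ?_
      filter_upwards [hc.eventually self_mem_nhdsWithin] with s hs
      exact (indicator_of_mem (show _ ∈ T.W from hs) g).symm
    · rw [hb0 x hx]
      have : ∀ s, T.W.indicator g (x, T.γ x + T.e * s) = 0 := fun s =>
        indicator_of_notMem (fun h => hx (T.fst_mem _ (T.W_subset h))) _
      simp only [this]
      exact tendsto_const_nhds

theorem notMem_of_notMem_I {x z : ℝ} (hx : x ∉ T.I) : (x, z) ∉ U := fun h => hx (T.fst_mem _ h)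

theorem tendsto_of_continuousOn {a : V₀ → ℝ} (ha : ContinuousOn a U) {x : ℝ} (hx : x ∈ T.I) :
    Tendsto a (𝓝[T.W] (x, T.γ x)) (𝓝 (a (x, T.γ x))) :=
  (ha.continuousAt (T.isOpen.mem_nhds (T.curve_mem x hx))).tendsto.mono_left nhdsWithin_le_nhds

/-- The defect of the weak equation for the intrinsic gradient on one side of the curve. -/
theorem weak_gradient {η : V₀ → ℝ} (hη : ContDiff ℝ 1 η) (hc : HasCompactSupport η)
    (hU : tsupport η ⊆ U) :
    IntegrableOn (fun v => nabla f f v * η v - (-f v * dx η v + f v ^ 2 / 2 * dz η v)) T.W ∧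
    ∫ v in T.W, (nabla f f v * η v - (-f v * dx η v + f v ^ 2 / 2 * dz η v)) =
      -T.e * ∫ x, 1 / 2 * T.f0 x ^ 2 * η (x, T.γ x) := by
  have hf1 : ContDiffOn ℝ 1 f T.W := ContDiffOn.of_le (n := ∞) T.smooth (by decide)
  have hη0 : ∀ v, v ∉ tsupport η → η v = 0 := fun v hv => image_eq_zero_of_notMem_tsupport hv
  have hf0 := (T.contDiffOn_comp_fst T.contDiffOn_trace).continuousOn
  have hfc := T.continuousOn_f
  have hηx := (contDiff_dx hη (m := 0) (by simp)).continuous.continuousOn (s := U)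
  have hηz := (contDiff_dz hη (m := 0) (by simp)).continuous.continuousOn (s := U)
  have hηc := hη.continuous.continuousOn (s := U)
  have hθc := (T.contDiffOn_nabla T.smooth).continuousOn
  -- The defect is the divergence of (f η, -½ f² η). Its flux tends to ½ f₀² η, which depends only
  -- on the trace of f.
  have hdiv : ∀ v ∈ T.W, dx (fun v => f v * η v) v + dz (fun v => -(1 / 2) * (f v ^ 2 * η v)) v =
      nabla f f v * η v - (-f v * dx η v + f v ^ 2 / 2 * dz η v) := by
    intro v hv
    have d1 := T.differentiableAt_f hv
    have d2 := hη.differentiable (by simp) v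
    have d3 : DifferentiableAt ℝ (fun v => f v ^ 2) v := d1.pow 2
    have d4 : DifferentiableAt ℝ (fun v => f v ^ 2 * η v) v := d3.mul d2
    rw [dx_mul d1 d2, dz_mul (differentiableAt_const _) d4, dz_mul d3 d2,
      dz_pow_two d1, dz_const, nabla]
    ring
  have cη : ContinuousOn (fun v => -f v * dx η v + f v ^ 2 / 2 * dz η v) U :=
    (hfc.neg.mul hηx).add (((hfc.pow 2).div_const _).mul hηz)
  obtain ⟨C1, hC10, hC1⟩ := exists_bound_of_continuousOn hc hU cη fun v hv => by
    rw [dx_eq_zero_of_notMem hv, dz_eq_zero_of_notMem hv]; ring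
  obtain ⟨C2, hC20, hC2⟩ := exists_bound_of_continuousOn hc hU hηc hη0
  have hint : IntegrableOn (fun v => nabla f f v * η v - (-f v * dx η v + f v ^ 2 / 2 * dz η v))
      T.W := by
    refine T.integrableOn_W_of_bound ((hθc.mul (hηc.mono T.W_subset)).sub (cη.mono T.W_subset)) hc
      (fun v hv => ?_) (C := T.K * C2 + C1) fun v hv => ?_
    · rw [hη0 v hv, dx_eq_zero_of_notMem hv, dz_eq_zero_of_notMem hv]
      ring
    · refine (abs_sub _ _).trans (add_le_add ?_ (hC1 v))
      rw [abs_mul]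
      exact mul_le_mul (T.abs_nabla_le hv.2) (hC2 v) (abs_nonneg _) T.K_nonneg
  refine ⟨hint, ?_⟩
  have cg : ContinuousOn (fun v => -(1 / 2) * (f v ^ 2 * η v) + T.f0 v.1 * (f v * η v)) U :=
    (continuousOn_const.mul ((hfc.pow 2).mul hηc)).add (hf0.mul (hfc.mul hηc))
  have g0 : ∀ v, v ∉ tsupport η → -(1 / 2) * (f v ^ 2 * η v) + T.f0 v.1 * (f v * η v) = 0 :=
    fun v hv => by rw [hη0 v hv]; ring
  obtain ⟨C3, -, hC3⟩ := exists_bound_of_continuousOn hc hU cg g0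
  rw [← setIntegral_congr_fun T.isOpen_W.measurableSet hdiv]
  refine T.integral_div_of_tendsto (hf1.mul hη.contDiffOn)
    (contDiffOn_const.mul ((hf1.pow 2).mul hη.contDiffOn)) hc hU (fun v hv => by simp [hη0 v hv])
    (fun v hv => by simp [hη0 v hv])
    (hint.congr_fun (fun v hv => (hdiv v hv).symm) T.isOpen_W.measurableSet)
    (cg.mono T.W_subset) (fun v _ => hC3 v) g0 (G := fun _ => 0) integrableOn_zero
    (fun v _ => by simp) (fun x hx => ?_) fun x hx => ?_
  · have := T.tendsto_of_continuousOn cg hx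
    have e : 1 / 2 * T.f0 x ^ 2 * η (x, T.γ x) = -(1 / 2) * (f (x, T.γ x) ^ 2 * η (x, T.γ x)) +
        T.f0 x * (f (x, T.γ x) * η (x, T.γ x)) := by
      simp only [f0]
      ring
    rwa [← e] at this
  · rw [hη0 _ fun h => T.notMem_of_notMem_I hx (hU h), mul_zero]

end HalfHerringbone

theorem nabla_mul {f g h : V₀ → ℝ} {v : V₀} (hg : DifferentiableAt ℝ g v)
    (hh : DifferentiableAt ℝ h v) :
    nabla f (fun p => g p * h p) v = g v * nabla f h v + h v * nabla f g v := by
  rw [nabla, dx_mul hg hh, dz_mul hg hh, nabla, nabla]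
  ring

theorem nabla_add {f g h : V₀ → ℝ} {v : V₀} (hg : DifferentiableAt ℝ g v)
    (hh : DifferentiableAt ℝ h v) :
    nabla f (fun p => g p + h p) v = nabla f g v + nabla f h v := by
  rw [nabla, dx_add hg hh, dz_add hg hh, nabla, nabla]
  ring

namespace HalfHerringbone

variable {U : Set V₀} {f : V₀ → ℝ} (T : HalfHerringbone U f)
variable {w : V₀ → ℝ}

/-- ∇_f² f is bounded up to the curve, while ∂_z f is only integrable, so a bound affine in |∂_z f|
is the right one. -/
theorem interiorIntegrand_bound (hw : ContDiff ℝ ∞ w) (hc : HasCompactSupport w)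
    (hU : tsupport w ⊆ U) : ∃ C, 0 ≤ C ∧
      ∀ v ∈ tsupport w ∩ T.W, |w v| ≤ C ∧ |nabla f w v| ≤ C ∧
        |interiorIntegrand f w v| ≤ C * |dz f v| + C := by
  have hwc := hw.continuous.continuousOn (s := U)
  have hwx := (contDiff_dx hw (m := 0) (by simp)).continuous.continuousOn (s := U)
  have hwz := (contDiff_dz hw (m := 0) (by simp)).continuous.continuousOn (s := U)
  obtain ⟨C1, hC10, hC1⟩ := exists_bound_of_continuousOn hc hU hwc
    fun v hv => image_eq_zero_of_notMem_tsupport hv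
  obtain ⟨C2, hC20, hC2⟩ := exists_bound_of_continuousOn hc hU (F := nabla f w)
    (hwx.sub (T.continuousOn_f.mul hwz)) fun v hv => by
      rw [nabla, dx_eq_zero_of_notMem hv, dz_eq_zero_of_notMem hv]; ring
  obtain ⟨C3, hC30, hC3⟩ := T.exists_nabla_nabla_bound hc hU
  refine ⟨C1 + C2 + C1 * C3 + C2 * C3, by positivity, fun v hv => ⟨?_, ?_, ?_⟩⟩
  · have : 0 ≤ C2 + C1 * C3 + C2 * C3 := by positivity
    linarith [hC1 v]
  · have : 0 ≤ C1 + C1 * C3 + C2 * C3 := by positivity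
    linarith [hC2 v]
  · rw [interiorIntegrand, abs_mul]
    have h1 := hC1 v
    have h2 := hC2 v
    have h3 := hC3 v hv
    calc |w v * dz f v + nabla f w v| * |nabla f (nabla f f) v|
        ≤ (C1 * |dz f v| + C2) * C3 := by
          gcongr
          refine (abs_add_le _ _).trans ?_
          rw [abs_mul]
          gcongr
      _ ≤ _ := by
          have : 0 ≤ (C1 + C2 + C2 * C3) * |dz f v| + (C1 + C2 + C1 * C3) := by positivity
          linarith

theorem continuousOn_interiorIntegrand (hw : ContDiff ℝ ∞ w) :
    ContinuousOn (interiorIntegrand f w) T.W :=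
  ((hw.continuous.continuousOn.mul T.contDiffOn_dz_f.continuousOn).add
    (T.contDiffOn_nabla hw.contDiffOn).continuousOn).mul
    (T.contDiffOn_nabla (T.contDiffOn_nabla T.smooth)).continuousOn

theorem integrableOn_interiorIntegrand (hw : ContDiff ℝ ∞ w) (hc : HasCompactSupport w)
    (hU : tsupport w ⊆ U) : IntegrableOn (interiorIntegrand f w) T.W := by
  obtain ⟨C, hC0, hC⟩ := T.interiorIntegrand_bound hw hc hU
  refine T.integrableOn_W (T.continuousOn_interiorIntegrand hw) hc (fun v hv => ?_)
    (((T.integrableOn_dz hc hU).abs.const_mul C).add (integrableOn_const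
      ((measure_mono inter_subset_left).trans_lt hc.measure_lt_top).ne)) fun v hv => (hC v hv).2.2
  rw [interiorIntegrand, nabla, image_eq_zero_of_notMem_tsupport hv, dx_eq_zero_of_notMem hv,
    dz_eq_zero_of_notMem hv]
  ring

theorem integrableOn_variationIntegrand (hw : ContDiff ℝ ∞ w) (hc : HasCompactSupport w)
    (hU : tsupport w ⊆ U) : IntegrableOn (variationIntegrand f w) T.W := by
  have hx := contDiff_dx hw (m := ∞) (by simp)
  have hz := contDiff_dz hw (m := ∞) (by simp)
  have h1 := (contDiff_dx hz (m := 0) (by simp)).continuous.continuousOn (s := U)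
  have h2 := (contDiff_dz hz (m := 0) (by simp)).continuous.continuousOn (s := U)
  have h3 := (contDiff_dx hx (m := 0) (by simp)).continuous.continuousOn (s := U)
  have hfc := T.continuousOn_f
  have hvel : ContinuousOn (gradientVelocity w f) U :=
    (((continuousOn_const.mul hfc).mul h1).sub ((hfc.pow 2).mul h2)).sub h3
  have hx0 : ∀ v, v ∉ tsupport w → v ∉ tsupport (dx w) := fun v hv h => hv (tsupport_dx_subset w h)
  have hz0 : ∀ v, v ∉ tsupport w → v ∉ tsupport (dz w) := fun v hv h => hv (tsupport_dz_subset w h)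
  have hvel0 : ∀ v, v ∉ tsupport w → gradientVelocity w f v = 0 := fun v hv => by
    rw [gradientVelocity, dx_eq_zero_of_notMem (hz0 v hv), dz_eq_zero_of_notMem (hz0 v hv),
      dx_eq_zero_of_notMem (hx0 v hv)]
    ring
  obtain ⟨C1, hC10, hC1⟩ := exists_bound_of_continuousOn hc hU hvel hvel0
  obtain ⟨C2, hC20, hC2⟩ := exists_bound_of_continuousOn hc hU hz.continuous.continuousOn
    fun v hv => dz_eq_zero_of_notMem hv
  have hθ := (T.contDiffOn_nabla T.smooth).continuousOn
  have hK := T.K_nonneg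
  have : IntegrableOn (fun v => gradientVelocity w f v * nabla f f v +
      3 / 2 * dz w v * nabla f f v ^ 2) T.W := by
    refine T.integrableOn_W_of_bound (((hvel.mono T.W_subset).mul hθ).add
      ((continuousOn_const.mul hz.continuous.continuousOn).mul (hθ.pow 2))) hc (fun v hv => ?_)
      (C := C1 * T.K + 3 / 2 * C2 * T.K ^ 2) fun v hv => ?_
    · rw [hvel0 v hv, dz_eq_zero_of_notMem hv]
      ring
    · have h4 := hC1 v
      have h5 := hC2 v
      have h6 := T.abs_nabla_le hv.2
      refine (abs_add_le _ _).trans (add_le_add ?_ ?_)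
      · rw [abs_mul]
        gcongr
      · rw [abs_mul, abs_mul, abs_pow, abs_of_pos (by norm_num : (0 : ℝ) < 3 / 2)]
        gcongr
  exact this.congr_fun (fun v hv => (variationIntegrand_eq (T.differentiableAt_f hv) hw).symm)
    T.isOpen_W.measurableSet

theorem dx_dz_smooth {g : V₀ → ℝ} (hg : ContDiffOn ℝ ∞ g T.W) {v : V₀} (hv : v ∈ T.W) :
    dx (dz g) v = dz (dx g) v :=
  dx_dz_comm T.isOpen_W (hg.of_le (by decide)) hv

theorem differentiableAt_of_contDiffOn {g : V₀ → ℝ} (hg : ContDiffOn ℝ ∞ g T.W) {v : V₀}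
    (hv : v ∈ T.W) : DifferentiableAt ℝ g v :=
  (hg.contDiffAt (T.isOpen_W.mem_nhds hv)).differentiableAt (by simp)

/-- The difference of the two integrands is a divergence. -/
theorem divergence_eq (hw : ContDiff ℝ ∞ w) {S : V₀ → ℝ} (hS : ContDiffOn ℝ ∞ S T.W) {v : V₀}
    (hv : v ∈ T.W) :
    dx (fun p => dz S p - nabla f f p * (nabla f w p + w p * dz f p)) v +
      dz (fun p => f p * (nabla f f p * (nabla f w p + w p * dz f p)) +
        1 / 2 * (nabla f f p ^ 2 * w p) - dx S p) v =
    variationIntegrand f w v - interiorIntegrand f w v := by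
  have hwW : ContDiffOn ℝ ∞ w T.W := hw.contDiffOn
  have dw := T.differentiableAt_of_contDiffOn hwW hv
  have df := T.differentiableAt_f hv
  have dfz := T.differentiableAt_of_contDiffOn T.contDiffOn_dz_f hv
  have dfx := T.differentiableAt_of_contDiffOn T.contDiffOn_dx_f hv
  have dnw := T.differentiableAt_of_contDiffOn (T.contDiffOn_nabla hwW) hv
  have dθ := T.differentiableAt_of_contDiffOn (T.contDiffOn_nabla T.smooth) hv
  have dwf : DifferentiableAt ℝ (fun p => w p * dz f p) v := dw.mul dfz
  have dA : DifferentiableAt ℝ (fun p => nabla f w p + w p * dz f p) v := dnw.add dwf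
  rw [dx_add_dz_eq df dw dθ dA
    (T.differentiableAt_of_contDiffOn (contDiffOn_dx T.isOpen_W hS (m := ∞) (by simp)) hv)
    (T.differentiableAt_of_contDiffOn (contDiffOn_dz T.isOpen_W hS (m := ∞) (by simp)) hv)
    (T.dx_dz_smooth hS hv), nabla_add dnw dwf, nabla_mul dw dfz]
  have e : nabla f f = fun p => dx f p - f p * dz f p := rfl
  have d3 : DifferentiableAt ℝ (fun p => f p * dz f p) v := df.mul dfz
  -- The commutator of ∂_z with ∇_f contributes -(∂_z f)², which cancels the term quadratic in ∂_z f
  -- coming from the field.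
  have hθz : dz (nabla f f) v = nabla f (dz f) v - dz f v ^ 2 := by
    rw [e, dz_sub dfx d3, dz_mul df dfz, nabla, T.dx_dz_smooth T.smooth hv]
    ring
  rw [hθz, variationIntegrand, interiorIntegrand]
  ring

/-- The defect of the first variation formula on one side of the curve. -/
theorem first_variation (hw : ContDiff ℝ ∞ w) (hc : HasCompactSupport w) (hU : tsupport w ⊆ U) :
    (∫ v in T.W, variationIntegrand f w v) - ∫ v in T.W, interiorIntegrand f w v =
      -T.e * ∫ x, w (x, T.γ x) * (T.σ x * deriv T.f0 x - 1 / 2 * T.σ x ^ 2) := by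
  have hvar := T.integrableOn_variationIntegrand hw hc hU
  have hint := T.integrableOn_interiorIntegrand hw hc hU
  have hwm := T.isOpen_W.measurableSet
  have hfc := T.continuousOn_f
  have hw0 : ∀ v, v ∉ tsupport w → w v = 0 := fun v hv => image_eq_zero_of_notMem_tsupport hv
  have hwx0 : ∀ v, v ∉ tsupport w → dx w v = 0 := fun v hv => dx_eq_zero_of_notMem hv
  have hwz0 : ∀ v, v ∉ tsupport w → dz w v = 0 := fun v hv => dz_eq_zero_of_notMem hv
  have hwc := hw.continuous.continuousOn (s := U)
  have hwx := (contDiff_dx hw (m := 0) (by simp)).continuous.continuousOn (s := U)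
  have hwz := (contDiff_dz hw (m := 0) (by simp)).continuous.continuousOn (s := U)
  have cσ := T.contDiffOn_comp_fst T.contDiffOn_σ
  have cf0 : ContDiffOn ℝ ∞ (fun v : V₀ => T.f0 v.1) U := T.contDiffOn_comp_fst T.contDiffOn_trace
  have dσ : ContDiffOn ℝ ∞ (deriv T.σ) T.I := T.contDiffOn_σ.deriv_of_isOpen T.isOpen_I (by simp)
  have df0 : ContDiffOn ℝ ∞ (deriv T.f0) T.I :=
    T.contDiffOn_trace.deriv_of_isOpen T.isOpen_I (by simp)
  have cdσ := (T.contDiffOn_comp_fst dσ).continuousOn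
  have cdf0 := (T.contDiffOn_comp_fst df0).continuousOn
  have cu : ContDiffOn ℝ ∞ (fun v => f v - T.f0 v.1) T.W := T.smooth.sub (cf0.mono T.W_subset)
  have cuc : ContinuousOn (fun v => f v - T.f0 v.1) U := hfc.sub cf0.continuousOn
  -- Since ∂_x f - f₀ ∂_z f = θ + (f - f₀) ∂_z f, the flux of the rotated gradient of S contains -w
  -- σ (f - f₀) ∂_z f. This replaces the coefficient θ of the unbounded flux term by θ - σ.
  set S : V₀ → ℝ := fun v => w v * T.σ v.1 * (f v - T.f0 v.1) with hSdef
  have hS : ContDiffOn ℝ ∞ S T.W := (hw.contDiffOn.mul (cσ.mono T.W_subset)).mul cu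
  have hSt : tsupport S ⊆ tsupport w :=
    closure_mono fun v hv h => hv (by simp [hSdef, h])
  have hSx0 : ∀ v, v ∉ tsupport w → dx S v = 0 := fun v hv =>
    dx_eq_zero_of_notMem fun h => hv (hSt h)
  have hSz0 : ∀ v, v ∉ tsupport w → dz S v = 0 := fun v hv =>
    dz_eq_zero_of_notMem fun h => hv (hSt h)
  have hSd : ∀ v ∈ T.W,
      dx S v = w v * T.σ v.1 * (dx f v - deriv T.f0 v.1) +
        (f v - T.f0 v.1) * (w v * deriv T.σ v.1 + T.σ v.1 * dx w v) ∧
      dz S v = w v * T.σ v.1 * dz f v + (f v - T.f0 v.1) * (T.σ v.1 * dz w v) := by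
    intro v hv
    have hI := T.fst_mem v (T.W_subset hv)
    have hσ' : HasDerivAt T.σ (deriv T.σ v.1) v.1 :=
      ((T.contDiffOn_σ.contDiffAt (T.isOpen_I.mem_nhds hI)).differentiableAt (by simp)).hasDerivAt
    have hf' : HasDerivAt T.f0 (deriv T.f0 v.1) v.1 :=
      ((T.contDiffOn_trace.contDiffAt (T.isOpen_I.mem_nhds hI)).differentiableAt
        (by simp)).hasDerivAt
    have d1 := hw.differentiable (by simp) v
    have d2 : DifferentiableAt ℝ (fun v : V₀ => T.σ v.1) v := (hasFDerivAt_comp_fst hσ').differentiableAt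
    have d3 : DifferentiableAt ℝ (fun v : V₀ => T.f0 v.1) v := (hasFDerivAt_comp_fst hf').differentiableAt
    have d4 := T.differentiableAt_f hv
    have d5 : DifferentiableAt ℝ (fun v : V₀ => w v * T.σ v.1) v := d1.mul d2
    have d6 : DifferentiableAt ℝ (fun v : V₀ => f v - T.f0 v.1) v := d4.sub d3
    rw [hSdef, dx_mul d5 d6, dz_mul d5 d6, dx_mul d1 d2, dz_mul d1 d2, dx_sub d4 d3, dz_sub d4 d3,
      dx_comp_fst hσ', dz_comp_fst hσ', dx_comp_fst hf', dz_comp_fst hf']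
    constructor <;> ring
  -- The flux without the unbounded term is ½ θ² w + θ a1 + a0 with a1 and a0 continuous up to the
  -- curve. On the curve a1 = -wσ and a0 = w σ f₀', so the limit is w (σ f₀' - ½ σ²).
  set a1 : V₀ → ℝ := fun v => (f v - T.f0 v.1) * nabla f w v - w v * T.σ v.1 with ha1
  set a0 : V₀ → ℝ := fun v => w v * T.σ v.1 * deriv T.f0 v.1 - (f v - T.f0 v.1) *
    ((dx w v - T.f0 v.1 * dz w v) * T.σ v.1 + w v * deriv T.σ v.1) with ha0
  have c1 : ContinuousOn a1 U :=
    (cuc.mul (hwx.sub (hfc.mul hwz))).sub (hwc.mul cσ.continuousOn)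
  have c0 : ContinuousOn a0 U := ((hwc.mul cσ.continuousOn).mul cdf0).sub
    (cuc.mul (((hwx.sub (cf0.continuousOn.mul hwz)).mul cσ.continuousOn).add (hwc.mul cdσ)))
  have z1 : ∀ v, v ∉ tsupport w → a1 v = 0 := fun v hv => by
    simp only [ha1, nabla, hw0 v hv, hwx0 v hv, hwz0 v hv]
    ring
  have z0 : ∀ v, v ∉ tsupport w → a0 v = 0 := fun v hv => by
    simp only [ha0, hw0 v hv, hwx0 v hv, hwz0 v hv]
    ring
  obtain ⟨Cw, hCw0, hCw⟩ := exists_bound_of_continuousOn hc hU hwc hw0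
  obtain ⟨C1, hC10, hC1⟩ := exists_bound_of_continuousOn hc hU c1 z1
  obtain ⟨C0, hC00, hC0⟩ := exists_bound_of_continuousOn hc hU c0 z0
  obtain ⟨Cu, hCu0, hCu⟩ := T.exists_gradient_bound hc hU
  have hθ := T.contDiffOn_nabla T.smooth
  have hA : ContDiffOn ℝ ∞ (fun p => nabla f f p * (nabla f w p + w p * dz f p)) T.W :=
    hθ.mul ((T.contDiffOn_nabla hw.contDiffOn).add (hw.contDiffOn.mul T.contDiffOn_dz_f))
  have hSx : ContDiffOn ℝ ∞ (dx S) T.W := contDiffOn_dx T.isOpen_W hS (by simp)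
  have hSz : ContDiffOn ℝ ∞ (dz S) T.W := contDiffOn_dz T.isOpen_W hS (by simp)
  have hdiv : ∀ v ∈ T.W, dx (fun p => dz S p - nabla f f p * (nabla f w p + w p * dz f p)) v +
      dz (fun p => f p * (nabla f f p * (nabla f w p + w p * dz f p)) +
        1 / 2 * (nabla f f p ^ 2 * w p) - dx S p) v =
      variationIntegrand f w v - interiorIntegrand f w v := fun v hv => T.divergence_eq hw hS hv
  rw [← integral_sub hvar hint, ← setIntegral_congr_fun hwm hdiv]
  refine T.integral_div_of_tendsto ((hSz.sub hA).of_le (by decide))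
    ((((T.smooth.mul hA).add (contDiffOn_const.mul ((hθ.pow 2).mul hw.contDiffOn))).sub hSx).of_le
      (by decide)) hc hU (fun v hv => ?_) (fun v hv => ?_)
    ((hvar.sub hint).congr_fun (fun v hv => (hdiv v hv).symm) hwm)
    (g := fun v => 1 / 2 * nabla f f v ^ 2 * w v + nabla f f v * a1 v + a0 v)
    (C := 1 / 2 * T.K ^ 2 * Cw + T.K * C1 + C0) ?_ (fun v hv => ?_) (fun v hv => ?_)
    (G := fun v => Cu * |w v * dz f v|) ?_ (fun v hv => ?_) (fun x hx => ?_) fun x hx => ?_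
  · simp only [nabla, hw0 v hv, hwx0 v hv, hwz0 v hv, hSz0 v hv]
    ring
  · simp only [nabla, hw0 v hv, hwx0 v hv, hwz0 v hv, hSx0 v hv]
    ring
  · have := hθ.continuousOn
    have := c1.mono T.W_subset
    have := c0.mono T.W_subset
    have := hw.continuous.continuousOn (s := T.W)
    fun_prop
  · have h1 := hCw v
    have h2 := hC1 v
    have h3 := hC0 v
    have h4 := T.abs_nabla_le hv
    have h5 := T.K_nonneg
    refine (abs_add_le _ _).trans (add_le_add ((abs_add_le _ _).trans (add_le_add ?_ ?_)) h3)
    · rw [abs_mul, abs_mul, abs_pow, abs_of_pos (by norm_num : (0 : ℝ) < 1 / 2)]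
      gcongr
    · rw [abs_mul]
      gcongr
  · rw [hw0 v hv, z1 v hv, z0 v hv]
    ring
  · refine Integrable.const_mul (Integrable.abs ?_) _
    refine T.integrableOn_W (h := fun v => Cw * |dz f v|) (hwc.mono T.W_subset |>.mul
      T.contDiffOn_dz_f.continuousOn) hc (fun v hv => by rw [hw0 v hv, zero_mul])
      ((T.integrableOn_dz hc hU).abs.const_mul _) fun v _ => ?_
    rw [abs_mul]
    have := hCw v
    gcongr
  · obtain ⟨e1, e2⟩ := hSd v hv
    have e : f v * (nabla f f v * (nabla f w v + w v * dz f v)) + 1 / 2 * (nabla f f v ^ 2 * w v) -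
        dx S v + T.f0 v.1 * (dz S v - nabla f f v * (nabla f w v + w v * dz f v)) -
        (1 / 2 * nabla f f v ^ 2 * w v + nabla f f v * a1 v + a0 v) =
        (nabla f f v - T.σ v.1) * (f v - T.f0 v.1) * (w v * dz f v) := by
      rw [e1, e2, ha1, ha0]
      simp only [nabla]
      ring
    rw [e, abs_mul]
    by_cases hvQ : v ∈ tsupport w
    · have := hCu v ⟨hvQ, hv⟩
      calc _ ≤ Cu * |T.s v| * |w v * dz f v| := by gcongr
        _ = _ := by ring
    · rw [hw0 v hvQ]
      simp
  · have tθ := T.tendsto_nabla hx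
    have tw := T.tendsto_of_continuousOn hwc hx
    have t1 := T.tendsto_of_continuousOn c1 hx
    have t0 := T.tendsto_of_continuousOn c0 hx
    have := (((tθ.pow 2).const_mul (1 / 2)).mul tw).add (tθ.mul t1) |>.add t0
    have e : w (x, T.γ x) * (T.σ x * deriv T.f0 x - 1 / 2 * T.σ x ^ 2) =
        1 / 2 * T.σ x ^ 2 * w (x, T.γ x) + T.σ x * a1 (x, T.γ x) + a0 (x, T.γ x) := by
      have hu : f (x, T.γ x) - T.f0 x = 0 := sub_self _
      simp only [ha1, ha0, hu]
      ring
    rwa [← e] at this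
  · rw [hw0 _ fun h => T.notMem_of_notMem_I hx (hU h), zero_mul]

end HalfHerringbone

/-! ### Traces on the curve and the inequality between slopes. -/

namespace HalfHerringbone

variable {U : Set V₀} {f : V₀ → ℝ} (T : HalfHerringbone U f)

theorem integrable_trace {w : V₀ → ℝ} (hw : Continuous w) (hc : HasCompactSupport w)
    (hU : tsupport w ⊆ U) {c : ℝ → ℝ} (hcc : ContinuousOn c T.I) :
    Integrable fun x => w (x, T.γ x) * c x := by
  have hQ := hc.image continuous_fst
  have hQI : Prod.fst '' tsupport w ⊆ T.I := by
    rintro _ ⟨v, hv, rfl⟩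
    exact T.fst_mem v (hU hv)
  have hcont : ContinuousOn (fun x => w (x, T.γ x) * c x) T.I :=
    (hw.comp_continuousOn (continuousOn_id.prodMk T.contDiffOn_γ.continuousOn)).mul hcc
  refine (integrableOn_iff_integrable_of_support_subset fun x hx => ?_).1
    ((hcont.mono hQI).integrableOn_compact hQ)
  by_contra h
  refine hx ?_
  simp only
  rw [image_eq_zero_of_notMem_tsupport (f := w) fun h' => h ⟨_, h', rfl⟩, zero_mul]

/-- On its side of the curve, the foliation is flatter than the curve. -/
theorem mul_σ_le {t : ℝ} (ht : t ∈ T.I) : T.e * T.σ t ≤ T.e * deriv T.f0 t := by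
  refine le_of_forall_pos_le_add fun η hη => ?_
  have h1 : ∀ᶠ v in 𝓝[T.W] ((t, T.γ t) : V₀), T.e * T.σ t - η < T.e * nabla f f v :=
    ((T.tendsto_nabla ht).const_mul T.e).eventually (lt_mem_nhds (by linarith))
  obtain ⟨O, hO, hOW⟩ := mem_nhdsWithin_iff_exists_mem_nhds_inter.1
    (h1.and (T.eventually_mul_dz_nonneg ht))
  obtain ⟨r, hr, hbox⟩ := T.exists_box ht
    (inter_mem hO (T.isOpen.mem_nhds (T.curve_mem t ht)))
  have hI : ∀ x, |x - t| < r → x ∈ T.I := fun x hx =>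
    T.fst_mem _ (hbox x (T.γ x) hx (by simpa using hr)).2
  have hmem : ∀ x y : ℝ, |x - t| < r → 0 < y → y < r → (x, T.γ x + T.e * y) ∈ T.W ∧
      (x, T.γ x + T.e * y) ∈ O := by
    intro x y hx hy hyr
    have hb := hbox x (T.γ x + T.e * y) hx
      (by rw [add_sub_cancel_left, abs_mul, T.abs_e, one_mul, abs_of_pos hy]; exact hyr)
    refine ⟨T.mem_W.2 ⟨hb.2, ?_⟩, hb.1⟩
    have : T.e * T.s (x, T.γ x + T.e * y) = y := by
      rw [s]
      linear_combination y * T.e_mul_e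
    rw [this]
    exact hy
  -- Along the vertical translate of the curve f has derivative θ + (f - f₀) ∂_z f. Times e, the
  -- last term is nonnegative because f is monotone in z, so e f grows at a rate of at least eσ - η.
  have hder : ∀ y, 0 < y → y < r → ∀ x, |x - t| < r →
      HasDerivAt (fun x => T.e * f (x, T.γ x + T.e * y))
        (T.e * (nabla f f (x, T.γ x + T.e * y) +
          (f (x, T.γ x + T.e * y) - T.f0 x) * dz f (x, T.γ x + T.e * y))) x := by
    intro y hy hyr x hx
    have hd := (T.differentiableAt_f (hmem x y hx hy hyr).1).hasFDerivAt.comp_hasDerivAt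
      (f := fun x => ((x, T.γ x + T.e * y) : V₀)) x
      ((hasDerivAt_id x).prodMk ((T.hasDerivAt_γ x (hI x hx)).add_const (T.e * y)))
    refine (hd.const_mul T.e).congr_deriv ?_
    rw [fderiv_apply_eq, nabla, f0]
    simp only [dx, dz]
    ring
  have hmono : ∀ y, 0 < y → y < r → ∀ x, t < x → x < t + r →
      (T.e * T.σ t - η) * (x - t) ≤ T.e * f (x, T.γ x + T.e * y) - T.e * f (t, T.γ t + T.e * y) := by
    intro y hy hyr x hx hxr
    have hD : ∀ x ∈ Ioo (t - r) (t + r), |x - t| < r := fun x hx => by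
      rw [abs_lt]; constructor <;> linarith [hx.1, hx.2]
    refine Convex.mul_sub_le_image_sub_of_le_deriv (convex_Ioo (t - r) (t + r))
      (f := fun x => T.e * f (x, T.γ x + T.e * y))
      (fun x hx => (hder y hy hyr x (hD x hx)).continuousAt.continuousWithinAt)
      (fun x hx => (hder y hy hyr x (hD x (interior_subset hx))).differentiableAt.differentiableWithinAt)
      (fun x hx => ?_) t ⟨by linarith, by linarith⟩ x ⟨by linarith, hxr⟩ hx.le
    have hx' := hD x (interior_subset hx)
    rw [(hder y hy hyr x hx').deriv]
    have h2 : T.e * T.σ t - η < T.e * nabla f f (x, T.γ x + T.e * y) ∧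
        0 ≤ T.e * (f (x, T.γ x + T.e * y) - T.f0 x) * dz f (x, T.γ x + T.e * y) :=
      hOW ⟨(hmem x y hx' hy hyr).2, (hmem x y hx' hy hyr).1⟩
    linarith [h2.1, h2.2]
  have hlim : ∀ x ∈ T.I, Tendsto (fun y => f (x, T.γ x + T.e * y)) (𝓝[>] 0) (𝓝 (T.f0 x)) :=
    fun x hx => (T.tendsto_of_continuousOn T.continuousOn_f hx).comp (T.tendsto_curve hx)
  -- Letting the translate tend to the curve passes the growth bound to f₀; dividing by x - t then
  -- bounds the derivative of f₀.
  have hslope : ∀ᶠ x in 𝓝[>] t, T.e * T.σ t - η ≤ slope (fun x => T.e * T.f0 x) t x := by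
    filter_upwards [Ioo_mem_nhdsGT (by linarith : t < t + r)] with x hx
    have h3 : (T.e * T.σ t - η) * (x - t) ≤ T.e * T.f0 x - T.e * T.f0 t := by
      have hxt : |x - t| < r := by rw [abs_lt]; constructor <;> linarith [hx.1, hx.2]
      refine ge_of_tendsto (((hlim x (hI x hxt)).const_mul T.e).sub ((hlim t ht).const_mul T.e)) ?_
      filter_upwards [Ioo_mem_nhdsGT hr] with y hy using hmono y hy.1 hy.2 x hx.1 hx.2
    rw [slope_def_field, le_div_iff₀ (by linarith [hx.1])]
    exact h3
  have hd : HasDerivAt T.f0 (deriv T.f0 t) t :=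
    ((T.contDiffOn_trace.contDiffAt (T.isOpen_I.mem_nhds ht)).differentiableAt (by simp)).hasDerivAt
  have h4 := (hasDerivWithinAt_iff_tendsto_slope' (self_notMem_Ioi)).1
    ((hd.const_mul T.e).hasDerivWithinAt (s := Ioi t))
  have := ge_of_tendsto h4 hslope
  linarith

end HalfHerringbone

/-! ### Gluing the two sides of the herringbone. -/

/-- A foliation extension only depends on the set over which the graph is foliated. -/
def FoliationExtension.congr {f : V₀ → ℝ} {N : Set Heis.H} {W W' : Set V₀} (h : W = W')
    (F : FoliationExtension f N W) : FoliationExtension f N W' where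
  dom := F.dom
  slope := F.slope
  isOpen_dom := F.isOpen_dom
  closure_subset := h ▸ F.closure_subset
  smooth := F.smooth
  bounded := F.bounded
  extends_horizontal := h ▸ F.extends_horizontal

namespace SmoothHerringbone

variable {U : Set V₀} {f : V₀ → ℝ} (S : SmoothHerringbone U f)

theorem isOpen_I (hU : IsOpen U) : IsOpen S.I := by
  have : S.I = Prod.fst '' U := by
    ext t
    refine ⟨fun ht => ⟨_, S.curve_mem t ht, rfl⟩, ?_⟩
    rintro ⟨v, hv, rfl⟩
    exact S.fst_mem v hv
  rw [this]
  exact isOpenMap_fst U hU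

theorem contDiffOn_trace : ContDiffOn ℝ ∞ (fun t => f (t, S.γ t)) S.I := by
  have h := contDiff_fst.comp_contDiffOn (contDiff_snd.comp_contDiffOn S.curve_smooth)
  exact h.congr fun t _ => by simp [Psi_eq]

/-- The first coordinate has speed 1, so the coefficient of X is 1. Comparing vertical components of
the horizontality condition at height γ + t f/2 leaves γ' = -f: the projected curve is an integral
curve of ∂_x - f ∂_z. -/
theorem hasDerivAt_γ (hU : IsOpen U) {t : ℝ} (ht : t ∈ S.I) :
    HasDerivAt S.γ (-f (t, S.γ t)) t := by
  obtain ⟨a, b, h⟩ := S.curve_horizontal t ht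
  have hf : HasDerivAt (fun t => f (t, S.γ t)) (deriv (fun t => f (t, S.γ t)) t) t :=
    ((S.contDiffOn_trace.contDiffAt ((S.isOpen_I hU).mem_nhds ht)).differentiableAt
      (by simp)).hasDerivAt
  have e1 : a = 1 := by
    have h1 : HasDerivAt (fun s => (Psi f (s, S.γ s)).1)
        (a • X (Psi f (t, S.γ t)) + b • Y (Psi f (t, S.γ t))).1 t := h.fst
    simp only [Psi_eq] at h1
    have := h1.unique (hasDerivAt_id t)
    simpa [X, Y] using this
  have h2 : HasDerivAt (fun s => (Psi f (s, S.γ s)).2.1)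
      (a • X (Psi f (t, S.γ t)) + b • Y (Psi f (t, S.γ t))).2.1 t := h.snd.fst
  have h3 : HasDerivAt (fun s => (Psi f (s, S.γ s)).2.2)
      (a • X (Psi f (t, S.γ t)) + b • Y (Psi f (t, S.γ t))).2.2 t := h.snd.snd
  simp only [Psi_eq] at h2 h3
  have h4 := h3.sub (((hasDerivAt_id t).mul h2).div_const 2)
  have h5 : HasDerivAt S.γ ((a • X (t, f (t, S.γ t), S.γ t + t * f (t, S.γ t) / 2) +
      b • Y (t, f (t, S.γ t), S.γ t + t * f (t, S.γ t) / 2)).2.2 - (1 * f (t, S.γ t) + t *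
      (a • X (t, f (t, S.γ t), S.γ t + t * f (t, S.γ t) / 2) +
      b • Y (t, f (t, S.γ t), S.γ t + t * f (t, S.γ t) / 2)).2.1) / 2) t := by
    refine HasDerivAt.congr_of_eventuallyEq h4 (Eventually.of_forall fun s => ?_)
    simp
  refine h5.congr_deriv ?_
  simp [X, Y, e1]
  ring

/-- The curve, extended by zero. -/
noncomputable def γ₀ : ℝ → ℝ := S.I.indicator S.γ

theorem γ₀_eq {t : ℝ} (ht : t ∈ S.I) : S.γ₀ t = S.γ t := indicator_of_mem ht _

theorem above_eq : above U S.γ = region U S.γ₀ 1 := by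
  ext v
  refine and_congr_right fun hv => ?_
  rw [S.γ₀_eq (S.fst_mem v hv)]
  constructor <;> intro h <;> linarith

theorem below_eq : below U S.γ = region U S.γ₀ (-1) := by
  ext v
  refine and_congr_right fun hv => ?_
  rw [S.γ₀_eq (S.fst_mem v hv)]
  constructor <;> intro h <;> linarith

/-- One side of a smooth herringbone singularity. -/
noncomputable def half (hU : IsOpen U) (e : ℝ) (he : e * e = 1)
    (hf : ContDiffOn ℝ ∞ f (region U S.γ₀ e)) (F : FoliationExtension f S.N (region U S.γ₀ e)) :
    HalfHerringbone U f where
  isOpen := hU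
  I := S.I
  isOpen_I := S.isOpen_I hU
  γ := S.γ₀
  measurable_γ := by
    classical
    have hc : ContinuousOn S.γ S.I := fun t ht => (S.hasDerivAt_γ hU ht).continuousAt.continuousWithinAt
    have := hc.measurable_piecewise (continuousOn_const (c := (0 : ℝ))) (S.isOpen_I hU).measurableSet
    convert this using 1
    ext v
    simp [γ₀, indicator, piecewise]
  e := e
  e_mul_e := he
  K := S.lipschitz.exists_holder.choose
  K_nonneg := S.lipschitz.exists_holder.choose_spec.1.le
  holder := S.lipschitz.exists_holder.choose_spec.2
  curve_mem t ht := by rw [S.γ₀_eq ht]; exact S.curve_mem t ht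
  fst_mem := S.fst_mem
  contDiffOn_trace := S.contDiffOn_trace.congr fun t ht => by rw [S.γ₀_eq ht]
  hasDerivAt_γ t ht := by
    rw [S.γ₀_eq ht]
    refine (S.hasDerivAt_γ hU ht).congr_of_eventuallyEq ?_
    filter_upwards [(S.isOpen_I hU).mem_nhds ht] with s hs using S.γ₀_eq hs
  smooth := hf
  N := S.N
  isOpen_N := S.isOpen_N
  curve_mem_N t ht := by rw [S.γ₀_eq ht]; exact S.curve_mem_N t ht
  injOn p hp q hq h := by
    have := S.isEmbedding.injective (a₁ := ⟨p, hp⟩) (a₂ := ⟨q, hq⟩) h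
    exact congrArg Subtype.val this
  F := F

noncomputable def upper (hU : IsOpen U) : HalfHerringbone U f :=
  S.half hU 1 (by norm_num) (S.above_eq ▸ S.smooth_above) (S.Fplus.congr S.above_eq)

noncomputable def lower (hU : IsOpen U) : HalfHerringbone U f :=
  S.half hU (-1) (by norm_num) (S.below_eq ▸ S.smooth_below) (S.Fminus.congr S.below_eq)

theorem upper_σ (hU : IsOpen U) {t : ℝ} (ht : t ∈ S.I) : (S.upper hU).σ t = S.σplus t := by
  have : (S.upper hU).σ t = S.Fplus.slope (t, f (t, S.γ₀ t)) := rfl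
  rw [this, σplus, curve, S.γ₀_eq ht]
  simp [Psi_eq, projXY]

theorem lower_σ (hU : IsOpen U) {t : ℝ} (ht : t ∈ S.I) : (S.lower hU).σ t = S.σminus t := by
  have : (S.lower hU).σ t = S.Fminus.slope (t, f (t, S.γ₀ t)) := rfl
  rw [this, σminus, curve, S.γ₀_eq ht]
  simp [Psi_eq, projXY]

theorem deriv_trace (hU : IsOpen U) {t : ℝ} (ht : t ∈ S.I) :
    deriv (fun t => f (t, S.γ₀ t)) t = S.σ0 t := by
  rw [σ0]
  refine EventuallyEq.deriv_eq ?_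
  filter_upwards [(S.isOpen_I hU).mem_nhds ht] with s hs
  simp [curve, Psi_eq, S.γ₀_eq hs]

theorem σplus_le (hU : IsOpen U) {t : ℝ} (ht : t ∈ S.I) : S.σplus t ≤ S.σ0 t := by
  have := (S.upper hU).mul_σ_le ht
  rw [S.upper_σ hU ht, show deriv (S.upper hU).f0 t = S.σ0 t from S.deriv_trace hU ht,
    show (S.upper hU).e = 1 from rfl] at this
  linarith

theorem le_σminus (hU : IsOpen U) {t : ℝ} (ht : t ∈ S.I) : S.σ0 t ≤ S.σminus t := by
  have := (S.lower hU).mul_σ_le ht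
  rw [S.lower_σ hU ht, show deriv (S.lower hU).f0 t = S.σ0 t from S.deriv_trace hU ht,
    show (S.lower hU).e = -1 from rfl] at this
  linarith

/-- The curve meets every vertical line in at most one point of U, hence is a null set by Fubini. -/
theorem setIntegral_eq (hU : IsOpen U) {F : V₀ → ℝ} (h1 : IntegrableOn F (S.upper hU).W)
    (h2 : IntegrableOn F (S.lower hU).W) :
    IntegrableOn F U ∧ ∫ v in U, F v = (∫ v in (S.upper hU).W, F v) + ∫ v in (S.lower hU).W, F v := by
  have hdisj : Disjoint (S.upper hU).W (S.lower hU).W := by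
    rw [Set.disjoint_left]
    rintro v ⟨-, h1⟩ ⟨-, h2⟩
    have h1' : 0 < 1 * (v.2 - S.γ₀ v.1) := h1
    have h2' : 0 < -1 * (v.2 - S.γ₀ v.1) := h2
    linarith
  have hnull : volume {v : V₀ | v.2 = S.γ₀ v.1} = 0 := by
    have hm : MeasurableSet {v : V₀ | v.2 = S.γ₀ v.1} :=
      measurableSet_eq_fun measurable_snd ((S.upper hU).measurable_γ.comp measurable_fst)
    rw [Measure.volume_eq_prod, Measure.measure_prod_null hm]
    refine Eventually.of_forall fun x => ?_
    have : Prod.mk x ⁻¹' {v : V₀ | v.2 = S.γ₀ v.1} = {S.γ₀ x} := by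
      ext z
      simp
    simp [this]
  have hae : (U : Set V₀) =ᵐ[volume] ((S.upper hU).W ∪ (S.lower hU).W : Set V₀) := by
    have : ∀ᵐ v : V₀, ¬ v.2 = S.γ₀ v.1 := by
      rw [ae_iff]
      simpa using hnull
    filter_upwards [this] with v hv
    refine propext ⟨fun h => ?_, fun h => ?_⟩
    · rcases lt_or_gt_of_ne hv with h' | h'
      · refine Or.inr ⟨h, ?_⟩
        change 0 < -1 * (v.2 - S.γ₀ v.1)
        linarith
      · refine Or.inl ⟨h, ?_⟩
        change 0 < 1 * (v.2 - S.γ₀ v.1)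
        linarith
    · rcases h with h | h
      · exact (S.upper hU).W_subset h
      · exact (S.lower hU).W_subset h
  refine ⟨(h1.union h2).congr_set_ae hae, ?_⟩
  rw [setIntegral_congr_set hae,
    setIntegral_union hdisj (S.lower hU).isOpen_W.measurableSet h1 h2]

end SmoothHerringbone

namespace SmoothHerringbone

variable {U : Set V₀} {f : V₀ → ℝ} (S : SmoothHerringbone U f)

/-- A Hölder constant of the graph. -/
noncomputable def holderConst : ℝ := S.lipschitz.exists_holder.choose

theorem holderConst_nonneg : 0 ≤ S.holderConst := S.lipschitz.exists_holder.choose_spec.1.le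

theorem isIntrinsicHolder : IsIntrinsicHolder U f S.holderConst :=
  S.lipschitz.exists_holder.choose_spec.2

include S in
theorem continuousOn : ContinuousOn f U := S.isIntrinsicHolder.continuousOn

theorem abs_nabla_le (hU : IsOpen U) {v : V₀} (hv : v ∈ U) : |nabla f f v| ≤ S.holderConst :=
  S.isIntrinsicHolder.abs_nabla_le hU S.holderConst_nonneg hv

/-- The pointwise ∇_f f, cut off outside U, already serves: `fderiv` of any function is measurable,
and the Hölder bound covers its default values as well. -/
theorem exists_measurable_gradient (hU : IsOpen U) :
    ∃ θ : V₀ → ℝ, Measurable θ ∧ (∀ v, |θ v| ≤ S.holderConst) ∧ ∀ v ∈ U, θ v = nabla f f v := by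
  classical
  have hf : Measurable (U.indicator f) := by
    have := S.continuousOn.measurable_piecewise (continuousOn_const (c := (0 : ℝ))) hU.measurableSet
    convert this using 1
    ext v
    simp [indicator, piecewise]
  have hθ : ∀ v ∈ U, U.indicator (fun v => dx f v - U.indicator f v * dz f v) v = nabla f f v := by
    intro v hv
    rw [indicator_of_mem hv, indicator_of_mem hv, nabla]
  refine ⟨U.indicator fun v => dx f v - U.indicator f v * dz f v, ?_, fun v => ?_, hθ⟩
  · exact ((measurable_fderiv_apply_const ℝ f ((1, 0) : V₀)).sub
      (hf.mul (measurable_fderiv_apply_const ℝ f ((0, 1) : V₀)))).indicator hU.measurableSet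
  · by_cases hv : v ∈ U
    · rw [hθ v hv]
      exact S.abs_nabla_le hU hv
    · rw [indicator_of_notMem hv, abs_zero]
      exact S.holderConst_nonneg

/-- The one-sided defects are ∓∫ ½ f₀² η. As f is continuous across the curve, both sides have the
same trace and the defects cancel, so the pointwise gradient is the distributional one. -/
theorem isIntrinsicGradient (hU : IsOpen U) {θ : V₀ → ℝ} (hm : Measurable θ)
    (hb : ∀ v, |θ v| ≤ S.holderConst) (hθ : ∀ v ∈ U, θ v = nabla f f v) :
    IsIntrinsicGradient U f θ := by
  refine ⟨S.continuousOn, fun K _ hK => ?_, fun η hη hc hηU => ?_⟩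
  · exact memLp_top_of_bound hm.aestronglyMeasurable S.holderConst (Eventually.of_forall hb)
  · obtain ⟨i1, e1⟩ := (S.upper hU).weak_gradient hη hc hηU
    obtain ⟨i2, e2⟩ := (S.lower hU).weak_gradient hη hc hηU
    obtain ⟨i, e⟩ := S.setIntegral_eq hU i1 i2
    have hη1 : IntegrableOn (fun v => -f v * dx η v + f v ^ 2 / 2 * dz η v) U := by
      refine integrableOn_of_continuousOn hU hc hηU ((S.continuousOn.neg.mul
        (contDiff_dx hη (m := 0) (by simp)).continuous.continuousOn).add
        (((S.continuousOn.pow 2).div_const _).mul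
        (contDiff_dz hη (m := 0) (by simp)).continuous.continuousOn)) fun v _ hv => ?_
      rw [dx_eq_zero_of_notMem hv, dz_eq_zero_of_notMem hv]
      ring
    have e3 : ∫ v in U, θ v * η v = ∫ v in U, ((nabla f f v * η v -
        (-f v * dx η v + f v ^ 2 / 2 * dz η v)) + (-f v * dx η v + f v ^ 2 / 2 * dz η v)) :=
      setIntegral_congr_fun hU.measurableSet fun v hv => by
        simp only [hθ v hv]
        ring
    rw [e3, integral_add i hη1, e, e1, e2, show (S.upper hU).e = 1 from rfl,
      show (S.lower hU).e = -1 from rfl, show (S.upper hU).f0 = (S.lower hU).f0 from rfl,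
      show (S.upper hU).γ = (S.lower hU).γ from rfl]
    ring

section Formula

variable {w : V₀ → ℝ} (hw : ContDiff ℝ ∞ w) (hc : HasCompactSupport w) (hwU : tsupport w ⊆ U)

include S hw hc hwU

theorem integrableOn_variationIntegrand (hU : IsOpen U) : IntegrableOn (variationIntegrand f w) U :=
  (S.setIntegral_eq hU ((S.upper hU).integrableOn_variationIntegrand hw hc hwU)
    ((S.lower hU).integrableOn_variationIntegrand hw hc hwU)).1

theorem integrableOn_interiorIntegrand (hU : IsOpen U) : IntegrableOn (interiorIntegrand f w) U :=
  (S.setIntegral_eq hU ((S.upper hU).integrableOn_interiorIntegrand hw hc hwU)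
    ((S.lower hU).integrableOn_interiorIntegrand hw hc hwU)).1

theorem integrable_mul_δ (hU : IsOpen U) :
    Integrable (fun x => w (x, S.γ₀ x) * ((S.upper hU).σ x * deriv (S.upper hU).f0 x -
      1 / 2 * (S.upper hU).σ x ^ 2)) ∧
    Integrable (fun x => w (x, S.γ₀ x) * ((S.lower hU).σ x * deriv (S.lower hU).f0 x -
      1 / 2 * (S.lower hU).σ x ^ 2)) := by
  have key : ∀ T : HalfHerringbone U f, Integrable (fun x => w (x, T.γ x) * (T.σ x * deriv T.f0 x -
      1 / 2 * T.σ x ^ 2)) := fun T =>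
    T.integrable_trace hw.continuous hc hwU ((T.contDiffOn_σ.continuousOn.mul
      (T.contDiffOn_trace.deriv_of_isOpen (m := ∞) T.isOpen_I (by simp)).continuousOn).sub
      (continuousOn_const.mul (T.contDiffOn_σ.continuousOn.pow 2)))
  exact ⟨key (S.upper hU), key (S.lower hU)⟩

/-- The one-sided defects enter with opposite signs, and (σ⁻σ⁰ - ½(σ⁻)²) - (σ⁺σ⁰ - ½(σ⁺)²) = ½ δ. -/
theorem first_variation (hU : IsOpen U) :
    IntegrableOn (fun s => w (s, S.γ s) * S.δ s) S.I ∧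
    A₂ U f w = 1 / 2 * (∫ s in S.I, w (s, S.γ s) * S.δ s) + ∫ v in U, interiorIntegrand f w v := by
  obtain ⟨j1, j2⟩ := S.integrable_mul_δ hw hc hwU hU
  have hIm := (S.isOpen_I hU).measurableSet
  have hδ : ∀ s ∈ S.I, 2 * ((w (s, S.γ₀ s) * ((S.lower hU).σ s * deriv (S.lower hU).f0 s -
      1 / 2 * (S.lower hU).σ s ^ 2)) - (w (s, S.γ₀ s) * ((S.upper hU).σ s *
      deriv (S.upper hU).f0 s - 1 / 2 * (S.upper hU).σ s ^ 2))) = w (s, S.γ s) * S.δ s := by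
    intro s hs
    rw [S.upper_σ hU hs, S.lower_σ hU hs, S.γ₀_eq hs, δ,
      show deriv (S.upper hU).f0 s = S.σ0 s from S.deriv_trace hU hs,
      show deriv (S.lower hU).f0 s = S.σ0 s from S.deriv_trace hU hs]
    ring
  have hint : IntegrableOn (fun s => w (s, S.γ s) * S.δ s) S.I :=
    (((j2.sub j1).const_mul 2).integrableOn (s := S.I)).congr_fun hδ hIm
  refine ⟨hint, ?_⟩
  have e3 : ∫ s in S.I, w (s, S.γ s) * S.δ s = 2 * ((∫ s, w (s, S.γ₀ s) * ((S.lower hU).σ s *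
      deriv (S.lower hU).f0 s - 1 / 2 * (S.lower hU).σ s ^ 2)) - ∫ s, w (s, S.γ₀ s) *
      ((S.upper hU).σ s * deriv (S.upper hU).f0 s - 1 / 2 * (S.upper hU).σ s ^ 2)) := by
    rw [← integral_sub j2 j1, ← integral_const_mul, ← setIntegral_congr_fun hIm hδ,
      setIntegral_eq_integral_of_forall_compl_eq_zero]
    intro s hs
    have : w (s, S.γ₀ s) = 0 := image_eq_zero_of_notMem_tsupport fun h => hs (S.fst_mem _ (hwU h))
    rw [this]
    ring
  have f1 := (S.upper hU).first_variation hw hc hwU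
  have f2 := (S.lower hU).first_variation hw hc hwU
  rw [show (S.upper hU).e = 1 from rfl, show (S.upper hU).γ = S.γ₀ from rfl] at f1
  rw [show (S.lower hU).e = -1 from rfl, show (S.lower hU).γ = S.γ₀ from rfl] at f2
  rw [e3, A₂, (S.setIntegral_eq hU ((S.upper hU).integrableOn_variationIntegrand hw hc hwU)
    ((S.lower hU).integrableOn_variationIntegrand hw hc hwU)).2,
    (S.setIntegral_eq hU ((S.upper hU).integrableOn_interiorIntegrand hw hc hwU)
    ((S.lower hU).integrableOn_interiorIntegrand hw hc hwU)).2]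
  linarith

theorem A₂_eq (hU : IsOpen U) {θ : V₀ → ℝ} (hθ : ∀ v ∈ U, θ v = nabla f f v) :
    A₂ U f w = ∫ v in U, (gradientVelocity w f v * θ v + 3 / 2 * dz w v * θ v ^ 2) := by
  have h : ∀ T : HalfHerringbone U f, EqOn (variationIntegrand f w)
      (fun v => gradientVelocity w f v * θ v + 3 / 2 * dz w v * θ v ^ 2) T.W := fun T v hv => by
    simp only [variationIntegrand_eq (T.differentiableAt_f hv) hw, hθ v (T.W_subset hv)]
  have i : ∀ T : HalfHerringbone U f, IntegrableOn
      (fun v => gradientVelocity w f v * θ v + 3 / 2 * dz w v * θ v ^ 2) T.W := fun T =>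
    (T.integrableOn_variationIntegrand hw hc hwU).congr_fun (h T) T.isOpen_W.measurableSet
  rw [A₂, (S.setIntegral_eq hU ((S.upper hU).integrableOn_variationIntegrand hw hc hwU)
    ((S.lower hU).integrableOn_variationIntegrand hw hc hwU)).2,
    (S.setIntegral_eq hU (i _) (i _)).2,
    setIntegral_congr_fun (S.upper hU).isOpen_W.measurableSet (h _),
    setIntegral_congr_fun (S.lower hU).isOpen_W.measurableSet (h _)]

end Formula

include S in
theorem hasFiniteEnergy (hU : IsOpen U) (hfin : volume U ≠ ⊤) : HasFiniteEnergy U f := by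
  obtain ⟨θ, hm, hb, hθ⟩ := S.exists_measurable_gradient hU
  refine ⟨θ, S.isIntrinsicGradient hU hm hb hθ, ?_⟩
  refine integrableOn_of_abs_le hU hfin (hm.pow_const 2).aestronglyMeasurable
    (C := S.holderConst ^ 2) fun v _ => ?_
  rw [abs_pow]
  exact pow_le_pow_left₀ (abs_nonneg _) (hb v) 2

end SmoothHerringbone

theorem exists_energy_expansion {U : Set V₀} (hU : IsOpen U) {w : V₀ → ℝ} (hw : ContDiff ℝ ∞ w)
    (hc : HasCompactSupport w) (hwU : tsupport w ⊆ U) (hfin : volume U ≠ ⊤) (M : ℝ) :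
    ∃ ε₀ > 0, ∃ D > 0, ∀ f : V₀ → ℝ, Nonempty (SmoothHerringbone U f) → (∀ v ∈ U, |f v| ≤ M) →
      HasFiniteEnergy U f ∧
      ∀ (ε : ℝ) (φ : ℝ → H → H), 0 < ε →
        IsFlowOn (contactField (w ∘ proj₀)) univ ε φ →
        ∀ t : ℝ, |t| ≤ ε₀ → |t| < ε →
          ∃ f_t : V₀ → ℝ, graph U f_t = φ t '' graph U f ∧
            HasFiniteEnergy U f_t ∧
            |energy U f_t - energy U f - A₂ U f w * t|
              ≤ D * (energy U f + (volume U).toReal) * t ^ 2 := by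
  obtain ⟨h, H⟩ := exists_isVerticalFlow hw hc
  obtain ⟨D, hD, hexp⟩ := H.exists_energy_expansion hw hc M
  -- The flow estimates are uniform for |t| ≤ 1, so ε₀ = 1 works for every f.
  refine ⟨1, one_pos, D, hD, ?_⟩
  rintro f ⟨S⟩ hf
  refine ⟨S.hasFiniteEnergy hU hfin, fun ε φ _ hφ t ht htε => ?_⟩
  obtain ⟨θ, hm, hb, hθ⟩ := S.exists_measurable_gradient hU
  obtain ⟨h1, h2⟩ := hexp U hU hwU hfin f θ (S.isIntrinsicGradient hU hm hb hθ) hm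
    ⟨_, hb⟩ hf t ht
  rw [← S.A₂_eq hw hc hwU hU hθ] at h2
  refine ⟨variation w h f t, ?_, h1, h2⟩
  rw [H.graph_variation hw hc f t hwU, H.eq_contactFlow hw hc hφ htε]

/-! ### Test functions concentrating on the curve. -/

/-- A smooth even bump, equal to `1` on `[-1, 1]` and to `0` off `[-2, 2]`. -/
noncomputable def bump (τ : ℝ) : ℝ := 1 - step τ - step (-τ)

theorem contDiff_bump : ContDiff ℝ ∞ bump :=
  (contDiff_const.sub contDiff_step).sub (contDiff_step.comp contDiff_neg)

theorem bump_zero : bump 0 = 1 := by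
  simp [bump, step_of_le (zero_le_one)]

theorem bump_eq_zero {τ : ℝ} (h : 2 ≤ |τ|) : bump τ = 0 := by
  rcases le_abs.1 h with h | h
  · rw [bump, step_of_ge h, step_of_le (by linarith)]
    ring
  · rw [bump, step_of_ge h, step_of_le (by linarith)]
    ring

/-- A test function concentrated near the curve `z = γ(x)`. -/
noncomputable def curveBump (φ γ : ℝ → ℝ) (ε : ℝ) (v : V₀) : ℝ := φ v.1 * bump ((v.2 - γ v.1) / ε)

namespace HalfHerringbone

variable {U : Set V₀} {f : V₀ → ℝ} (T : HalfHerringbone U f)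

/-- On one side only one of the two steps in the bump is active. Since ∇_f s = f₀ - f, the large
factor ε⁻¹ appears multiplied by f - f₀. -/
theorem interiorIntegrand_curveBump {φ : ℝ → ℝ} (hφ : ContDiff ℝ ∞ φ) {ε : ℝ} (hε : 0 < ε)
    {v : V₀} (hv : v ∈ T.W) :
    interiorIntegrand f (curveBump φ T.γ ε) v =
      (1 - step (T.e * T.s v / ε)) * ((φ v.1 * dz f v + deriv φ v.1) * nabla f (nabla f f) v) +
      T.e * (ε⁻¹ * deriv step (T.e * T.s v / ε) *
        (φ v.1 * (f v - T.f0 v.1) * nabla f (nabla f f) v)) := by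
  have hs := (T.mem_W.1 hv).2
  have he : curveBump φ T.γ ε =ᶠ[𝓝 v] fun v => φ v.1 * (1 - step (T.e * T.s v / ε)) := by
    filter_upwards [T.isOpen_W.mem_nhds hv] with p hp
    have hp' := (T.mem_W.1 hp).2
    rw [curveBump, bump]
    congr 1
    rcases T.e_cases with h | h <;> rw [h] at hp' ⊢
    · rw [step_of_le (τ := -((p.2 - T.γ p.1) / ε))]
      · simp [s]
      · have : 0 ≤ (p.2 - T.γ p.1) / ε := div_nonneg (by rw [s] at hp'; linarith) hε.le
        linarith
    · rw [step_of_le (τ := (p.2 - T.γ p.1) / ε)]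
      · rw [s, sub_zero, show -((p.2 - T.γ p.1) / ε) = -1 * (p.2 - T.γ p.1) / ε by ring]
      · have : (p.2 - T.γ p.1) / ε ≤ 0 :=
          div_nonpos_of_nonpos_of_nonneg (by rw [s] at hp'; linarith) hε.le
        linarith
  have hsd : HasDerivAt (fun y => 1 - step (T.e * y / ε))
      (-(deriv step (T.e * T.s v / ε) * (T.e / ε))) (T.s v) := by
    have hl : HasDerivAt (fun y => T.e * y / ε) (T.e / ε) (T.s v) := by
      simpa using ((hasDerivAt_id (T.s v)).const_mul T.e).div_const ε
    exact (HasDerivAt.comp (h₂ := step) (h := fun y => T.e * y / ε) (T.s v)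
      (hasDerivAt_step (T.e * T.s v / ε)) hl).const_sub 1
  have hf := T.hasFDerivAt_comp_s (T.W_subset hv) hsd
  have hφ' : HasDerivAt φ (deriv φ v.1) v.1 := (hφ.differentiable (by simp) v.1).hasDerivAt
  have d1 : DifferentiableAt ℝ (fun v : V₀ => φ v.1) v := (hasFDerivAt_comp_fst hφ').differentiableAt
  have e1 : dx (curveBump φ T.γ ε) v = φ v.1 * (-(deriv step (T.e * T.s v / ε) * (T.e / ε)) *
      T.f0 v.1) + (1 - step (T.e * T.s v / ε)) * deriv φ v.1 := by
    rw [dx_congr he, dx_mul d1 hf.differentiableAt, dx_comp_fst hφ', dx_eq_of_hasFDerivAt hf]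
  have e2 : dz (curveBump φ T.γ ε) v = φ v.1 * (-(deriv step (T.e * T.s v / ε) * (T.e / ε))) := by
    rw [dz_congr he, dz_mul d1 hf.differentiableAt, dz_comp_fst hφ', dz_eq_of_hasFDerivAt hf]
    ring
  have e3 := he.eq_of_nhds
  rw [interiorIntegrand, e3]
  rw [show nabla f (curveBump φ T.γ ε) v = dx (curveBump φ T.γ ε) v -
    f v * dz (curveBump φ T.γ ε) v from rfl, e1, e2]
  ring

/-- The part with the undifferentiated cutoff tends to zero by dominated convergence, its support
shrinking to the curve. The part with ε⁻¹ is a layer integral whose density f - f₀ vanishes on the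
curve while ∇_f² f stays bounded. -/
theorem tendsto_interior {φ : ℝ → ℝ} (hφ : ContDiff ℝ ∞ φ) (hφc : HasCompactSupport φ)
    {Q : Set V₀} (hQ : IsCompact Q) (hQU : Q ⊆ U) :
    Tendsto (fun ε => ∫ v in Q ∩ T.W, interiorIntegrand f (curveBump φ T.γ ε) v) (𝓝[>] 0)
      (𝓝 0) := by
  classical
  have hWm := T.isOpen_W.measurableSet
  have hQW := hQ.measurableSet.inter hWm
  obtain ⟨C1, h1⟩ := hφc.exists_bound_of_continuous hφ.continuous
  obtain ⟨C2, h2⟩ := hφc.deriv.exists_bound_of_continuous (hφ.continuous_deriv (by decide))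
  obtain ⟨C3, hC30, h3⟩ := T.exists_nabla_nabla_bound hQ hQU
  have hC1 : 0 ≤ C1 := (norm_nonneg _).trans (h1 0)
  have hC2 : 0 ≤ C2 := (norm_nonneg _).trans (h2 0)
  simp only [Real.norm_eq_abs] at h1 h2
  have hgc := (T.contDiffOn_nabla (T.contDiffOn_nabla T.smooth)).continuousOn
  have hdzc := T.contDiffOn_dz_f.continuousOn
  have hφ1 : Continuous fun v : V₀ => φ v.1 := hφ.continuous.comp continuous_fst
  have hφ2 : Continuous fun v : V₀ => deriv φ v.1 :=
    (hφ.continuous_deriv (by decide)).comp continuous_fst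
  have hm : ∀ ε, Measurable fun v => 1 - step (T.e * T.s v / ε) := fun ε =>
    measurable_const.sub
      (contDiff_step.continuous.measurable.comp ((T.measurable_s.const_mul _).div_const _))
  set A : V₀ → ℝ := fun v => (φ v.1 * dz f v + deriv φ v.1) * nabla f (nabla f f) v with hA
  have hAc : ContinuousOn A T.W :=
    ((hφ1.continuousOn.mul hdzc).add hφ2.continuousOn).mul hgc
  have hAm : AEStronglyMeasurable A (volume.restrict (Q ∩ T.W)) :=
    (hAc.mono inter_subset_right).aestronglyMeasurable hQW
  have hAi : IntegrableOn A (Q ∩ T.W) := by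
    have hd : IntegrableOn (fun v => (C1 * |dz f v| + C2) * C3) (Q ∩ T.W) :=
      (((T.integrableOn_dz hQ hQU).abs.const_mul C1).add (integrableOn_const
        ((measure_mono inter_subset_left).trans_lt hQ.measure_lt_top).ne)).mul_const _
    refine Integrable.mono' hd hAm ?_
    rw [ae_restrict_iff' hQW]
    refine Eventually.of_forall fun v hv => ?_
    have a1 := h1 v.1
    have a2 := h2 v.1
    have a3 := h3 v hv
    rw [Real.norm_eq_abs, hA, abs_mul]
    gcongr
    refine (abs_add_le _ _).trans ?_
    rw [abs_mul]
    gcongr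
  have hL1 : Tendsto (fun ε => ∫ v in Q ∩ T.W, (1 - step (T.e * T.s v / ε)) * A v) (𝓝[>] 0)
      (𝓝 (∫ v in Q ∩ T.W, (0 : ℝ))) := by
    refine tendsto_integral_filter_of_dominated_convergence (fun v => 2 * |A v|) ?_ ?_
      (hAi.abs.const_mul 2) ?_
    · exact Eventually.of_forall fun ε => (hm ε).aestronglyMeasurable.mul hAm
    · refine Eventually.of_forall fun ε => Eventually.of_forall fun v => ?_
      rw [Real.norm_eq_abs, abs_mul]
      gcongr
      refine (abs_sub _ _).trans ?_
      rw [abs_one]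
      linarith [abs_step_le (T.e * T.s v / ε)]
    · rw [ae_restrict_iff' hQW]
      refine Eventually.of_forall fun v hv => tendsto_const_nhds.congr' ?_
      filter_upwards [(T.tendsto_div_atTop hv.2).eventually_ge_atTop 2] with ε hε
      rw [step_of_ge hε, sub_self, zero_mul]
  have hi1 : ∀ ε, IntegrableOn (fun v => (1 - step (T.e * T.s v / ε)) * A v) (Q ∩ T.W) := by
    intro ε
    refine Integrable.bdd_mul hAi (c := 2) (hm ε).aestronglyMeasurable
      (Eventually.of_forall fun v => ?_)
    refine (abs_sub _ _).trans ?_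
    rw [abs_one]
    linarith [abs_step_le (T.e * T.s v / ε)]
  set B0 : V₀ → ℝ := fun v => φ v.1 * (f v - T.f0 v.1) * nabla f (nabla f f) v with hB0
  have hf0 : ContinuousOn (fun v : V₀ => T.f0 v.1) U :=
    (T.contDiffOn_comp_fst T.contDiffOn_trace).continuousOn
  have hB0c : ContinuousOn B0 T.W := (hφ1.continuousOn.mul (T.smooth.continuousOn.sub
    (hf0.mono T.W_subset))).mul hgc
  have hBm : Measurable (Q.indicator (T.W.indicator B0)) := by
    refine Measurable.indicator ?_ hQ.measurableSet
    have := hB0c.measurable_piecewise (continuousOn_const (c := (0 : ℝ))) hWm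
    convert this using 1
    ext v
    simp [indicator, piecewise]
  have hB : ∀ v, |Q.indicator (T.W.indicator B0) v| ≤ C1 * C3 * T.K * √|T.s v| := by
    intro v
    have hK := T.K_nonneg
    by_cases hv : v ∈ Q ∩ T.W
    · rw [indicator_of_mem hv.1, indicator_of_mem hv.2, hB0, abs_mul, abs_mul]
      have a1 := h1 v.1
      have a2 := T.abs_sub_trace_le (hQU hv.1)
      have a3 := h3 v hv
      calc |φ v.1| * |f v - T.f0 v.1| * |nabla f (nabla f f) v| ≤ C1 * (T.K * √|T.s v|) * C3 := by
            gcongr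
        _ = _ := by ring
    · have : Q.indicator (T.W.indicator B0) v = 0 := by
        by_cases hvQ : v ∈ Q
        · rw [indicator_of_mem hvQ, indicator_of_notMem fun h => hv ⟨hvQ, h⟩]
        · rw [indicator_of_notMem hvQ]
      rw [this, abs_zero]
      positivity
  obtain ⟨C4, h4⟩ := hQ.exists_bound_of_continuousOn
    (f := fun v => C1 * C3 * T.K * √|T.s v|)
    (continuousOn_const.mul (T.contDiffOn_s.continuousOn.mono hQU).abs.sqrt)
  have hBC : ∀ v, |Q.indicator (T.W.indicator B0) v| ≤ max C4 0 := by
    intro v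
    by_cases hv : v ∈ Q
    · exact (hB v).trans ((le_abs_self _).trans ((h4 v hv).trans (le_max_left _ _)))
    · rw [indicator_of_notMem hv, abs_zero]
      exact le_max_right _ _
  have hBl : ∀ x, Tendsto (fun y => Q.indicator (T.W.indicator B0) (x, T.γ x + T.e * y)) (𝓝[>] 0)
      (𝓝 0) := by
    intro x
    have hlim : Tendsto (fun y : ℝ => C1 * C3 * T.K * √|y|) (𝓝[>] 0) (𝓝 0) := by
      have : Continuous fun y : ℝ => C1 * C3 * T.K * √|y| := by fun_prop
      simpa using (this.tendsto 0).mono_left nhdsWithin_le_nhds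
    refine squeeze_zero_norm (fun y => ?_) hlim
    refine (hB _).trans (le_of_eq ?_)
    rw [s, add_sub_cancel_left, abs_mul, T.abs_e, one_mul]
  obtain ⟨hBi, hBlim⟩ := T.tendsto_integral_layer continuous_deriv_step
    (fun _ => deriv_step_of_notMem) hBm hBC hQ (fun v hv => indicator_of_notMem hv _) hBl
  rw [integral_zero, mul_zero] at hBlim
  have hsum := hL1.add (hBlim.const_mul T.e)
  rw [integral_zero, mul_zero, add_zero] at hsum
  refine hsum.congr' ?_
  filter_upwards [self_mem_nhdsWithin] with ε (hε : 0 < ε)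
  have hBi' : IntegrableOn (fun v => T.e * (ε⁻¹ * deriv step (T.e * T.s v / ε) *
      Q.indicator (T.W.indicator B0) v)) (Q ∩ T.W) := ((hBi ε).const_mul _).integrableOn
  have hz : ∀ v, v ∉ Q ∩ T.W → T.e * (ε⁻¹ * deriv step (T.e * T.s v / ε) *
      Q.indicator (T.W.indicator B0) v) = 0 := by
    intro v hv
    have : Q.indicator (T.W.indicator B0) v = 0 := by
      by_cases hvQ : v ∈ Q
      · rw [indicator_of_mem hvQ, indicator_of_notMem fun h => hv ⟨hvQ, h⟩]
      · rw [indicator_of_notMem hvQ]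
    rw [this, mul_zero, mul_zero]
  rw [← integral_const_mul, ← setIntegral_eq_integral_of_forall_compl_eq_zero hz,
    ← integral_add (hi1 ε) hBi']
  refine setIntegral_congr_fun hQW fun v hv => ?_
  rw [T.interiorIntegrand_curveBump hφ hε hv.2, indicator_of_mem hv.1, indicator_of_mem hv.2]

/-- The test functions concentrated near the curve are admissible. -/
theorem curveBump_admissible {φ : ℝ → ℝ} (hφ : ContDiff ℝ ∞ φ) (hφc : HasCompactSupport φ) {r : ℝ}
    (hr : 0 < r) (hbox : ∀ x ∈ tsupport φ, ∀ z, |z - T.γ x| < r → (x, z) ∈ U) :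
    ∃ Q : Set V₀, IsCompact Q ∧ Q ⊆ U ∧ ∀ ε, 0 < ε → ε ≤ r / 4 →
      ContDiff ℝ ∞ (curveBump φ T.γ ε) ∧ tsupport (curveBump φ T.γ ε) ⊆ Q := by
  have hI : tsupport φ ⊆ T.I := fun x hx =>
    T.fst_mem _ (hbox x hx (T.γ x) (by simpa using hr))
  have hQ : IsCompact ((fun p : ℝ × ℝ => ((p.1, T.γ p.1 + p.2) : V₀)) ''
      (tsupport φ ×ˢ Icc (-(r / 2)) (r / 2))) := by
    refine (hφc.isCompact.prod isCompact_Icc).image_of_continuousOn ?_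
    refine continuousOn_fst.prodMk (ContinuousOn.add ?_ continuousOn_snd)
    exact T.contDiffOn_γ.continuousOn.comp continuousOn_fst fun p hp => hI hp.1
  refine ⟨_, hQ, ?_, fun ε hε hεr => ⟨?_, ?_⟩⟩
  · rintro _ ⟨p, ⟨hp1, hp2⟩, rfl⟩
    refine hbox p.1 hp1 _ ?_
    rw [add_sub_cancel_left, abs_lt]
    constructor <;> linarith [hp2.1, hp2.2]
  · refine contDiff_iff_contDiffAt.2 fun v => ?_
    by_cases hv : v.1 ∈ tsupport φ
    · have hγ : ContDiffAt ℝ ∞ (fun v : V₀ => T.γ v.1) v :=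
        ContDiffAt.comp (g := T.γ) (f := Prod.fst) v
          (T.contDiffOn_γ.contDiffAt (T.isOpen_I.mem_nhds (hI hv))) contDiffAt_fst
      exact (hφ.contDiffAt.comp v contDiffAt_fst).mul
        (contDiff_bump.contDiffAt.comp v ((contDiffAt_snd.sub hγ).div_const ε))
    · have : curveBump φ T.γ ε =ᶠ[𝓝 v] fun _ => 0 := by
        have ho : {p : V₀ | p.1 ∉ tsupport φ} ∈ 𝓝 v :=
          ((isClosed_tsupport φ).isOpen_compl.preimage continuous_fst).mem_nhds hv
        filter_upwards [ho] with p hp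
        rw [curveBump, image_eq_zero_of_notMem_tsupport hp, zero_mul]
      exact contDiffAt_const.congr_of_eventuallyEq this
  · refine closure_minimal (fun v hv => ?_) hQ.isClosed
    have h1 : φ v.1 ≠ 0 := left_ne_zero_of_mul hv
    have h2 : bump ((v.2 - T.γ v.1) / ε) ≠ 0 := right_ne_zero_of_mul hv
    -- The bump vanishes from |τ| = 2 on, so ε ≤ r/4 keeps the support inside the strip of
    -- half-width r/2.
    have h3 : |(v.2 - T.γ v.1) / ε| < 2 := not_le.1 fun h => h2 (bump_eq_zero h)
    rw [abs_div, abs_of_pos hε, div_lt_iff₀ hε, abs_lt] at h3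
    refine ⟨(v.1, v.2 - T.γ v.1), ⟨subset_tsupport _ h1, ?_⟩, by simp⟩
    constructor <;> simp only <;> linarith [h3.1, h3.2]

end HalfHerringbone

/-! ### Contact harmonic graphs. -/

/-- The estimate at t = 0 forces E 0 = a, so the energy of the variation at time 0 need not be
identified separately. -/
theorem hasDerivAt_of_abs_sub_le {E : ℝ → ℝ} {a A D : ℝ}
    (h : ∀ t, |t| ≤ 1 → |E t - a - A * t| ≤ D * t ^ 2) : HasDerivAt E A 0 := by
  have h0 : E 0 = a := by
    have := h 0 (by simp)
    simp only [mul_zero, sub_zero, ne_eq, OfNat.ofNat_ne_zero, not_false_eq_true, zero_pow] at this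
    exact sub_eq_zero.1 (abs_nonpos_iff.1 this)
  rw [hasDerivAt_iff_isLittleO_nhds_zero]
  refine (Asymptotics.IsBigO.of_bound D ?_).trans_isLittleO
    (Asymptotics.isLittleO_pow_id (𝕜 := ℝ) one_lt_two)
  have : ∀ᶠ t : ℝ in 𝓝 0, |t| < 1 := by
    have hc : ContinuousAt (fun t : ℝ => |t|) 0 := by fun_prop
    exact hc.eventually (gt_mem_nhds (by simp))
  filter_upwards [this] with t ht
  have := h t ht.le
  rw [zero_add, h0, Real.norm_eq_abs, Real.norm_eq_abs, abs_of_nonneg (sq_nonneg t), smul_eq_mul,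
    mul_comm t]
  exact this

namespace SmoothHerringbone

variable {U : Set V₀} {f : V₀ → ℝ} (S : SmoothHerringbone U f)

include S in
/-- The first variation of a contact harmonic graph vanishes. -/
theorem A₂_eq_zero (hU : IsOpen U) (hharm : ContactHarmonic U f) {w : V₀ → ℝ}
    (hw : ContDiff ℝ ∞ w) (hc : HasCompactSupport w) (hwU : tsupport w ⊆ U) : A₂ U f w = 0 := by
  -- Criticality is tested on bounded sets, and the expansion needs finite area and bounded f. The
  -- interior of a compact set between the support of w and U provides all of this without changing
  -- A₂.
  obtain ⟨Q, hQ, hwQ, hQU⟩ := exists_compact_between hc.isCompact hU hwU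
  set U' := interior Q with hU'
  have hU'o : IsOpen U' := isOpen_interior
  have hU'U : U' ⊆ U := interior_subset.trans hQU
  have hfin : volume U' ≠ ⊤ := ((measure_mono interior_subset).trans_lt hQ.measure_lt_top).ne
  obtain ⟨M, hM⟩ := hQ.exists_bound_of_continuousOn (S.continuousOn.mono hQU)
  obtain ⟨h, H⟩ := exists_isVerticalFlow hw hc
  obtain ⟨D, hD, hexp⟩ := H.exists_energy_expansion hw hc M
  obtain ⟨θ, hm, hb, hθ⟩ := S.exists_measurable_gradient hU
  have hgrad := (S.isIntrinsicGradient hU hm hb hθ).mono hU'U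
  have hexp' := fun t ht => (hexp U' hU'o hwQ hfin f θ hgrad hm ⟨_, hb⟩
    (fun v hv => hM v (interior_subset hv)) t ht).2
  have hz : ∀ v, v ∉ tsupport w →
      gradientVelocity w f v * θ v + 3 / 2 * dz w v * θ v ^ 2 = 0 := by
    intro v hv
    rw [gradientVelocity, dx_eq_zero_of_notMem fun h => hv (tsupport_dz_subset w h),
      dz_eq_zero_of_notMem fun h => hv (tsupport_dz_subset w h),
      dx_eq_zero_of_notMem fun h => hv (tsupport_dx_subset w h), dz_eq_zero_of_notMem hv]
    ring
  have hA : ∫ v in U', (gradientVelocity w f v * θ v + 3 / 2 * dz w v * θ v ^ 2) = A₂ U f w := by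
    rw [S.A₂_eq hw hc hwU hU hθ,
      setIntegral_eq_integral_of_forall_compl_eq_zero fun v hv => hz v fun h => hv (hwQ h),
      setIntegral_eq_integral_of_forall_compl_eq_zero fun v hv => hz v fun h => hv (hwU h)]
  rw [hA] at hexp'
  have hd := hasDerivAt_of_abs_sub_le hexp'
  refine hd.unique (hharm U' hU'U hU'o (hQ.isBounded.subset interior_subset) (w ∘ proj₀)
    (hw.comp contDiff_proj₀) (fun p => ?_) ?_ 1 (contactFlow w h) (variation w h f) one_pos
    (H.isFlowOn_contactFlow hw hc _ _) fun t _ => H.graph_variation hw hc f t hwQ)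
  · have : derivY (w ∘ proj₀) = fun _ => 0 :=
      funext fun p => derivY_comp_proj₀ (hw.differentiable (by simp)) p
    rw [this]
    simp [derivY]
  · exact (tsupport_comp_subset_preimage w contDiff_proj₀.continuous).trans (preimage_mono hwQ)

theorem continuousOn_δ (hU : IsOpen U) : ContinuousOn S.δ S.I := by
  have h1 := (S.upper hU).contDiffOn_σ.continuousOn
  have h2 := (S.lower hU).contDiffOn_σ.continuousOn
  have h3 := ((S.upper hU).contDiffOn_trace.deriv_of_isOpen (m := ∞) (S.upper hU).isOpen_I
    (by simp)).continuousOn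
  refine (((h1.sub h3).pow 2).sub ((h3.sub h2).pow 2)).congr fun t ht => ?_
  simp only [δ, Pi.sub_apply, Pi.pow_apply]
  rw [S.upper_σ hU ht, S.lower_σ hU ht]
  have : deriv (fun t => f (t, (S.upper hU).γ t)) t = S.σ0 t := S.deriv_trace hU ht
  rw [this]

/-- With w the bump of width ε, A₂ = 0 equates minus half the curve integral with the interior
integral. The former is independent of ε, as the bump equals 1 on the curve; the latter tends to 0.
-/
theorem integral_mul_δ_eq_zero (hU : IsOpen U) (hharm : ContactHarmonic U f) {φ : ℝ → ℝ}
    (hφ : ContDiff ℝ ∞ φ) (hφc : HasCompactSupport φ) {r : ℝ} (hr : 0 < r)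
    (hbox : ∀ x ∈ tsupport φ, ∀ z, |z - S.γ₀ x| < r → (x, z) ∈ U) :
    ∫ x in S.I, φ x * S.δ x = 0 := by
  obtain ⟨Q, hQ, hQU, hadm⟩ := (S.upper hU).curveBump_admissible hφ hφc hr hbox
  have hz : ∀ (T : HalfHerringbone U f), T.γ = S.γ₀ → ∀ ε, 0 < ε → ε ≤ r / 4 →
      ∫ v in Q ∩ T.W, interiorIntegrand f (curveBump φ T.γ ε) v =
        ∫ v in T.W, interiorIntegrand f (curveBump φ S.γ₀ ε) v := by
    intro T hT ε hε hεr
    rw [hT]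
    refine (setIntegral_eq_of_subset_of_forall_sdiff_eq_zero T.isOpen_W.measurableSet
      inter_subset_right fun v hv => ?_).symm
    have hv' : v ∉ tsupport (curveBump φ S.γ₀ ε) := fun h => hv.2 ⟨(hadm ε hε hεr).2 h, hv.1⟩
    rw [interiorIntegrand, nabla, image_eq_zero_of_notMem_tsupport hv', dx_eq_zero_of_notMem hv',
      dz_eq_zero_of_notMem hv']
    ring
  have hlim := ((S.upper hU).tendsto_interior hφ hφc hQ hQU).add
    ((S.lower hU).tendsto_interior hφ hφc hQ hQU)
  rw [add_zero] at hlim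
  have hconst : (fun ε => (∫ v in Q ∩ (S.upper hU).W,
      interiorIntegrand f (curveBump φ (S.upper hU).γ ε) v) + ∫ v in Q ∩ (S.lower hU).W,
      interiorIntegrand f (curveBump φ (S.lower hU).γ ε) v) =ᶠ[𝓝[>] 0]
      fun _ => -(1 / 2 * ∫ x in S.I, φ x * S.δ x) := by
    filter_upwards [Ioo_mem_nhdsGT (by linarith : 0 < r / 4)] with ε hε
    obtain ⟨hw, hwQ⟩ := hadm ε hε.1 hε.2.le
    change ContDiff ℝ ∞ (curveBump φ S.γ₀ ε) at hw
    change tsupport (curveBump φ S.γ₀ ε) ⊆ Q at hwQ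
    have hc : HasCompactSupport (curveBump φ S.γ₀ ε) := hQ.of_isClosed_subset (isClosed_tsupport _) hwQ
    have hwU := hwQ.trans hQU
    rw [hz _ rfl ε hε.1 hε.2.le, hz _ rfl ε hε.1 hε.2.le,
      ← (S.setIntegral_eq hU ((S.upper hU).integrableOn_interiorIntegrand hw hc hwU)
      ((S.lower hU).integrableOn_interiorIntegrand hw hc hwU)).2]
    have h1 := (S.first_variation hw hc hwU hU).2
    rw [S.A₂_eq_zero hU hharm hw hc hwU] at h1
    have h2 : ∫ s in S.I, curveBump φ S.γ₀ ε (s, S.γ s) * S.δ s = ∫ x in S.I, φ x * S.δ x :=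
      setIntegral_congr_fun (S.isOpen_I hU).measurableSet fun s hs => by
        simp [curveBump, S.γ₀_eq hs, bump_zero]
    rw [h2] at h1
    linarith
  have := tendsto_nhds_unique (hlim.congr' hconst) tendsto_const_nhds
  linarith

/-- Near t a strip of fixed width around the curve lies in U, so every smooth φ supported there is
admissible. The fundamental lemma gives δ = 0 almost everywhere, and continuity gives it everywhere.
-/
theorem δ_eq_zero (hU : IsOpen U) (hharm : ContactHarmonic U f) {t : ℝ} (ht : t ∈ S.I) :
    S.δ t = 0 := by
  obtain ⟨r, hr, hbox⟩ := (S.upper hU).exists_box ht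
    (hU.mem_nhds ((S.upper hU).curve_mem t ht))
  have hdist : ∀ x ∈ Ioo (t - r) (t + r), |x - t| < r := fun x hx => by
    rw [abs_lt]; constructor <;> linarith [hx.1, hx.2]
  have hJI : Ioo (t - r) (t + r) ⊆ S.I := fun x hx =>
    S.fst_mem _ (hbox x ((S.upper hU).γ x) (hdist x hx) (by simpa using hr))
  have hcont := (S.continuousOn_δ hU).mono hJI
  have hae := isOpen_Ioo.ae_eq_zero_of_integral_contDiff_smul_eq_zero
    (hcont.locallyIntegrableOn (μ := volume) measurableSet_Ioo) fun g hg hgc hgJ => by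
      rw [← setIntegral_eq_integral_of_forall_compl_eq_zero (s := S.I)]
      · exact S.integral_mul_δ_eq_zero hU hharm hg hgc hr
          fun x hx z hz => hbox x z (hdist x (hgJ hx)) hz
      · intro x hx
        rw [image_eq_zero_of_notMem_tsupport fun h => hx (hJI (hgJ h)), zero_smul]
  have hEq := Measure.eqOn_open_of_ae_eq (μ := volume) (f := S.δ) (g := fun _ => 0)
    ((ae_restrict_iff' measurableSet_Ioo).2 hae) isOpen_Ioo hcont continuousOn_const
  exact hEq ⟨by linarith, by linarith⟩

/-- δ = 0 only equates squares; since σ⁰ - σ⁺ and σ⁻ - σ⁰ are both nonnegative, they are equal. -/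
theorem slope_balance (hU : IsOpen U) {t : ℝ} (ht : t ∈ S.I) (hδ : S.δ t = 0) :
    S.σ0 t = (S.σplus t + S.σminus t) / 2 := by
  have h1 := S.σplus_le hU ht
  have h2 := S.le_σminus hU ht
  have h3 : (S.σ0 t - S.σplus t) ^ 2 = (S.σminus t - S.σ0 t) ^ 2 := by
    rw [δ] at hδ
    linarith
  have h4 := (sq_eq_sq₀ (by linarith) (by linarith)).1 h3
  linarith

end SmoothHerringbone

end Heis

theorem mainTheorem4 (U : Set Heis.V₀) (hU : IsOpen U) :
    (∀ w₂ : Heis.V₀ → ℝ, ContDiff ℝ ∞ w₂ → HasCompactSupport w₂ → tsupport w₂ ⊆ U →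
      -- the expansion of the energy, with constants depending only on `U`, `w₂` and `‖f‖_∞`
      (volume U ≠ ⊤ → ∀ M : ℝ, ∃ ε₀ > 0, ∃ D > 0,
        ∀ f : Heis.V₀ → ℝ, Nonempty (Heis.SmoothHerringbone U f) → (∀ v ∈ U, |f v| ≤ M) →
        Heis.HasFiniteEnergy U f ∧
        ∀ (ε : ℝ) (φ : ℝ → Heis.H → Heis.H), 0 < ε →
          Heis.IsFlowOn (Heis.contactField (w₂ ∘ Heis.proj₀)) univ ε φ →
          ∀ t : ℝ, |t| ≤ ε₀ → |t| < ε →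
            ∃ f_t : Heis.V₀ → ℝ, Heis.graph U f_t = φ t '' Heis.graph U f ∧
              Heis.HasFiniteEnergy U f_t ∧
              |Heis.energy U f_t - Heis.energy U f - Heis.A₂ U f w₂ * t|
                ≤ D * (Heis.energy U f + (volume U).toReal) * t ^ 2) ∧
      -- the formula for `A₂`
      (∀ (f : Heis.V₀ → ℝ) (S : Heis.SmoothHerringbone U f),
        IntegrableOn (Heis.variationIntegrand f w₂) U ∧
        IntegrableOn (fun s => w₂ (s, S.γ s) * S.δ s) S.I ∧
        IntegrableOn (Heis.interiorIntegrand f w₂) U ∧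
        Heis.A₂ U f w₂ =
          1 / 2 * (∫ s in S.I, w₂ (s, S.γ s) * S.δ s)
            + ∫ v in U, Heis.interiorIntegrand f w₂ v)) ∧
    -- the balance of the slopes for contact harmonic graphs
    (∀ (f : Heis.V₀ → ℝ) (S : Heis.SmoothHerringbone U f), Heis.ContactHarmonic U f →
      ∀ s ∈ S.I, S.δ s = 0 ∧ S.σ0 s = (S.σplus s + S.σminus s) / 2) := by
  refine ⟨fun w₂ hw hc hwU => ⟨fun hfin M => Heis.exists_energy_expansion hU hw hc hwU hfin M,
    fun f S => ?_⟩, fun f S hharm s hs => ?_⟩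
  · obtain ⟨h1, h2⟩ := S.first_variation hw hc hwU hU
    exact ⟨S.integrableOn_variationIntegrand hw hc hwU hU, h1,
      S.integrableOn_interiorIntegrand hw hc hwU hU, h2⟩
  · have h := S.δ_eq_zero hU hharm hs
    exact ⟨h, S.slope_balance hU hs h⟩
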